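/- **Setting.** Let $D_1,D_2,\ldots$ be i.i.d. with law $P$ on a measurable space, and let $p\ge 1$, $q\ge 0$, $L=p+q$. For $\gamma\in\mathbb R^p$ put $\tilde\gamma=(\gamma^{T},0^{T})^{T}\in\mathbb R^{L}$, and let $g(d,\gamma)=(g_1(d,\tilde\gamma)^T,g_2(d,\tilde\gamma)^T)^T\in\mathbb R^p\times\mathbb R^q$ be an estimating function, measurable in $d$ for each $\gamma$. Let $\gamma_0\in\mathbb R^p$ and $$\Sigma_{11}=E[g(D,\gamma_0)g(D,\gamma_0)^T],\qquad \Sigma_{12}=E[\partial g(D,\gamma_0)/\partial\gamma^T],\qquad \Sigma_{21}=\Sigma_{12}^T .$$ *Condition 1.* $E\,g(D,\gamma_0)=0$; $\Sigma_{11}$ is positive definite; there are a ball around $\gamma_0$ and an integrable function $K$ such that for almost every $d$ the map $g(d,\cdot)$ is $C^2$ on the ball and $\|\partial g(d,\gamma)/\partial\gamma^T\|$, $\|\partial^2 g(d,\gamma)/\partial\gamma^T\partial\gamma\|$ and $\|g(d,\gamma)\|^3$ are at most $K(d)$ there. *Condition 2.* With everything evaluated at $\gamma_0$, $E[\partial g_1/\partial\gamma^T]=-E[g_1g_1^T]$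 and $E[\partial g_2/\partial\gamma^T]=-E[g_2g_1^T]$. *Full rank.* $\operatorname{rank}\Sigma_{12}=p$. *Empirical likelihood.* For $\lambda\in\mathbb R^L$ let $R^F(\lambda,\gamma)=\prod_{i=1}^n\{1+\lambda^Tg(D_i,\gamma)\}^{-1}$ if all factors are positive, and $0$ otherwise. Let $\hat\lambda(\gamma)$ be a solution, with all $1+\lambda^Tg(D_i,\gamma)$ positive, of $\sum_{i=1}^n g(D_i,\gamma)/\{1+\lambda^Tg(D_i,\gamma)\}=0$. *Plug-in estimator.* $\hat\gamma_{EE}$ is a consistent root of the estimating equations $g_1$: with probability tending to one $\sum_{i=1}^n g_1(D_i,\hat\gamma_{EE})=0$, and $\hat\gamma_{EE}\to\gamma_0$ in probability. Put $\hat\lambda_{EE}=\hat\lambda(\hat\gamma_{EE})$. *Prior and marginal likelihood.* The prior on $\gamma$ is flat. Given $\gamma$, the deviation $\delta_1=\lambda-\hat\lambda(\gamma)$ of the multiplier from the Lagrange multiplier has a prior $\rho_n$, a probability measure on $\mathbb R^L$, such that for some $\eta>0$ the integrals $\int\exp\{\tfrac{1+\eta}{2}\delta_1^T(n\Sigma_{11})\delta_1\}\,\rho_n(d\delta_1)$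 are bounded for all large $n$ (for example $\rho_n$ is the point mass at $0$, or the law of $n^{-1/2}U$ with $U$ bounded). For a set $S$ of pairs $(\gamma,\delta_1)$ let $$P_n(S)=\int\!\!\int_{S}R^F(\hat\lambda(\gamma)+\delta_1,\gamma)\,\rho_n(d\delta_1)\,d\gamma,$$ where the integrand is $0$ if $\hat\lambda(\gamma)$ does not exist. For $\rho_n$ the point mass at $0$ this is the integral of the empirical likelihood ratio of $\gamma$ over a set of $\gamma$. Let $W_n=\{(\gamma,\delta_1):\|\gamma-\hat\gamma_{EE}\|\le r_n,\ \|\delta_1\|\le r_n\}$ be the window of the Laplace approximation, with any $r_n$ such that $n^{1/2}r_n\to\infty$ and $n^{1/3}r_n\to0$. **Theorem 1.** Under these assumptions, the marginal likelihood $P(\mathbf D\mid M)=P_n(W_n)$ over the window satisfies $$-2\log P(\mathbf D\mid M)=-2\log R^F(\hat\lambda_{EE},\hat\gamma_{EE})+p\log n+\tilde C+o_p(1),$$ $$\tilde C=\log\det(\Sigma_{21}\Sigma_{11}^{-1}\Sigma_{12})-p\log(2\pi)-2\log\tilde A,\qquad \tilde A=\int\exp\{\tfrac12\delta_1^T(n\Sigma_{11})\delta_1\}\,\rho_n(d\delta_1).$$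 The same expansion holds for the marginal likelihood $P(\mathbf D\mid M)=P_n(\Theta\times\mathbb R^L)$ over any parameter space $\Theta\subseteq\mathbb R^p$ that contains a neighbourhood of $\gamma_0$ (such as $\mathbb R^p$), provided that the Laplace approximation is applicable, that is, $P_n\big((\Theta\times\mathbb R^L)\setminus W_n\big)/P_n(W_n)\to0$ in probability. -/

import Mathlib

open MeasureTheory ProbabilityTheory Filter Topology

namespace ELCIC

/-- The parameter space of the candidate model. -/
abbrev Par (p : ℕ) : Type := EuclideanSpace ℝ (Fin p)

/-- The space of full parameters, of values of the full estimating function and of Lagrange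
multipliers, of dimension `L = p + q`; the first `p` coordinates belong to the candidate model. -/
abbrev Full (p q : ℕ) : Type := EuclideanSpace ℝ (Fin p ⊕ Fin q)

/-- The padded parameter `(γᵀ, 0ᵀ)ᵀ`. -/
def pad {p q : ℕ} (γ : Par p) : Full p q :=
  WithLp.toLp 2 (Sum.elim (fun i => γ i) (fun _ => 0))

/-- The full estimating function as a function of the parameter `γ` of the candidate model.
Its coordinates `Sum.inl j` form `g₁` and its coordinates `Sum.inr j` form `g₂`. -/
def gM {𝒟 : Type*} {p q : ℕ} (g : 𝒟 → Full p q → Full p q) (d : 𝒟) (γ : Par p) : Full p q :=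
  g d (pad γ)

/-- The matrix `E[g gᵀ]` at `γ`. -/
noncomputable def sigma11 {𝒟 : Type*} [MeasurableSpace 𝒟] {p q : ℕ}
    (g : 𝒟 → Full p q → Full p q) (P : Measure 𝒟) (γ : Par p) :
    Matrix (Fin p ⊕ Fin q) (Fin p ⊕ Fin q) ℝ :=
  Matrix.of fun i j => ∫ d, gM g d γ i * gM g d γ j ∂P

/-- The expected Jacobian `E[∂g/∂γᵀ]` at `γ`. -/
noncomputable def sigma12 {𝒟 : Type*} [MeasurableSpace 𝒟] {p q : ℕ}
    (g : 𝒟 → Full p q → Full p q) (P : Measure 𝒟) (γ : Par p) :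
    Matrix (Fin p ⊕ Fin q) (Fin p) ℝ :=
  Matrix.of fun i j => ∫ d, (fderiv ℝ (gM g d) γ (EuclideanSpace.single j 1)) i ∂P

/-- The regularity condition at the true parameter `γ₀`. -/
structure Regularity {𝒟 : Type*} [MeasurableSpace 𝒟] {p q : ℕ}
    (g : 𝒟 → Full p q → Full p q) (P : Measure 𝒟) (γ₀ : Par p) : Prop where
  measurable : ∀ γ, Measurable fun d => gM g d γ
  mean_zero : ∫ d, gM g d γ₀ ∂P = 0
  posDef : (sigma11 g P γ₀).PosDef
  smooth : ∃ r > 0, ∃ K : 𝒟 → ℝ, Integrable K P ∧ ∀ᵐ d ∂P,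
    ContDiffOn ℝ 2 (gM g d) (Metric.ball γ₀ r) ∧
    ∀ γ ∈ Metric.ball γ₀ r,
      ‖fderiv ℝ (gM g d) γ‖ ≤ K d ∧ ‖fderiv ℝ (fderiv ℝ (gM g d)) γ‖ ≤ K d ∧
        ‖gM g d γ‖ ^ 3 ≤ K d

/-- The efficiency condition: `E[∂g₁/∂γᵀ] = -E[g₁ g₁ᵀ]` and `E[∂g₂/∂γᵀ] = -E[g₂ g₁ᵀ]`. -/
def Efficiency {𝒟 : Type*} [MeasurableSpace 𝒟] {p q : ℕ}
    (g : 𝒟 → Full p q → Full p q) (P : Measure 𝒟) (γ₀ : Par p) : Prop :=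
  (∀ j k : Fin p, sigma12 g P γ₀ (Sum.inl j) k = -sigma11 g P γ₀ (Sum.inl j) (Sum.inl k)) ∧
  (∀ (j : Fin q) (k : Fin p),
    sigma12 g P γ₀ (Sum.inr j) k = -sigma11 g P γ₀ (Sum.inr j) (Sum.inl k))

/-- `1 + lamᵀ g(x, γ)`. -/
noncomputable def factor {𝒟 : Type*} {p q : ℕ} (g : 𝒟 → Full p q → Full p q)
    (d : 𝒟) (lam : Full p q) (γ : Par p) : ℝ :=
  1 + inner ℝ lam (gM g d γ)

/-- The empirical likelihood ratio `R^F(lam, γ) = ∏ {1 + lamᵀ g(xᵢ, γ)}⁻¹` of the sample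
`x 0, …, x (n - 1)`; it is zero where the implied weights are not all positive. -/
noncomputable def elRatio {𝒟 : Type*} {p q : ℕ} (g : 𝒟 → Full p q → Full p q)
    (n : ℕ) (x : ℕ → 𝒟) (lam : Full p q) (γ : Par p) : ℝ :=
  open Classical in
  if ∀ i < n, 0 < factor g (x i) lam γ then
    ∏ i ∈ Finset.range n, (factor g (x i) lam γ)⁻¹
  else 0

/-- `lam` is a Lagrange multiplier of the empirical likelihood problem at `γ`. -/
def IsMultiplier {𝒟 : Type*} {p q : ℕ} (g : 𝒟 → Full p q → Full p q)
    (n : ℕ) (x : ℕ → 𝒟) (γ : Par p) (lam : Full p q) : Prop :=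
  (∀ i < n, 0 < factor g (x i) lam γ) ∧
  ∑ i ∈ Finset.range n, (factor g (x i) lam γ)⁻¹ • gM g (x i) γ = 0

/-- The Lagrange multiplier at `γ` (zero if there is none). -/
noncomputable def multiplier {𝒟 : Type*} {p q : ℕ} (g : 𝒟 → Full p q → Full p q)
    (n : ℕ) (x : ℕ → 𝒟) (γ : Par p) : Full p q :=
  open Classical in
  if h : ∃ lam, IsMultiplier g n x γ lam then h.choose else 0

/-- The likelihood `R^F(lam(γ) + δ, γ)` as a function of `γ` and of the deviation `δ` of the
multiplier from the Lagrange multiplier `lam(γ)` at `γ`. It is zero if `γ` has no multiplier, that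
is, if the empirical likelihood of `γ` vanishes. For `δ = 0` it is the usual empirical likelihood
ratio of `γ`. -/
noncomputable def lik {𝒟 : Type*} {p q : ℕ} (g : 𝒟 → Full p q → Full p q)
    (n : ℕ) (x : ℕ → 𝒟) (γ : Par p) (δ : Full p q) : ℝ :=
  open Classical in
  if ∃ lam, IsMultiplier g n x γ lam then elRatio g n x (multiplier g n x γ + δ) γ else 0

/-- The part of the marginal likelihood that comes from the pairs `(γ, δ)` in `S`, for the flat
prior on `γ` and the prior `ρ` on `δ`. -/
noncomputable def marginal {𝒟 : Type*} {p q : ℕ} (g : 𝒟 → Full p q → Full p q)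
    (ρ : Measure (Full p q)) (n : ℕ) (x : ℕ → 𝒟) (S : Set (Par p × Full p q)) : ENNReal :=
  ∫⁻ γ, ∫⁻ δ, S.indicator (fun z => ENNReal.ofReal (lik g n x z.1 z.2)) (γ, δ) ∂ρ

/-- The window of the Laplace approximation: `γ` within `r` of `c`, and `δ` of norm at most `r`. -/
def window {p q : ℕ} (c : Par p) (r : ℝ) : Set (Par p × Full p q) :=
  {z | ‖z.1 - c‖ ≤ r ∧ ‖z.2‖ ≤ r}

/-- The quadratic form `δᵀ A δ`. -/
noncomputable def quad {p q : ℕ} (A : Matrix (Fin p ⊕ Fin q) (Fin p ⊕ Fin q) ℝ)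
    (δ : Full p q) : ℝ :=
  ∑ i, ∑ j, δ i * A i j * δ j

/-- `Ã = ∫ exp{(1/2) δᵀ (n Σ₁₁) δ} ρ(dδ)`. -/
noncomputable def priorIntegral {p q : ℕ} (A : Matrix (Fin p ⊕ Fin q) (Fin p ⊕ Fin q) ℝ)
    (ρ : Measure (Full p q)) (n : ℕ) : ℝ :=
  ∫ δ, Real.exp ((1 / 2) * (n * quad A δ)) ∂ρ

/-- The constant
`C̃ = log det(Σ₂₁ Σ₁₁⁻¹ Σ₁₂) - p log(2π) - 2 log Ã`. -/
noncomputable def cTilde {𝒟 : Type*} [MeasurableSpace 𝒟] {p q : ℕ}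
    (g : 𝒟 → Full p q → Full p q) (P : Measure 𝒟) (γ₀ : Par p)
    (ρ : Measure (Full p q)) (n : ℕ) : ℝ :=
  Real.log ((sigma12 g P γ₀).transpose * (sigma11 g P γ₀)⁻¹ * sigma12 g P γ₀).det
    - p * Real.log (2 * Real.pi) - 2 * Real.log (priorIntegral (sigma11 g P γ₀) ρ n)

/-- The priors on the deviations live on the scale `n^(-1/2)` of the Laplace approximation:
`∫ exp{((1 + η)/2) δᵀ (n Σ₁₁) δ} ρₙ(dδ)` is bounded in `n` for some `η > 0`. -/
def LocalPrior {p q : ℕ} (A : Matrix (Fin p ⊕ Fin q) (Fin p ⊕ Fin q) ℝ)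
    (ρ : ℕ → Measure (Full p q)) : Prop :=
  ∃ η > (0 : ℝ), ∃ C : ℝ, ∀ᶠ n : ℕ in atTop,
    ∫⁻ δ, ENNReal.ofReal (Real.exp (((1 + η) / 2) * (n * quad A δ))) ∂(ρ n) ≤ ENNReal.ofReal C

/-- The expansion `-2 log P_n = -2 log R^F(lam(γ̂), γ̂) + p log n + C̃ + o_p(1)`, where `P_n` is the
marginal likelihood over the set `S n ω` of pairs `(γ, δ)`. -/
def Expansion {Ω 𝒟 : Type*} [MeasurableSpace Ω] [MeasurableSpace 𝒟] {p q : ℕ}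
    (μ : Measure Ω) (P : Measure 𝒟) (D : ℕ → Ω → 𝒟) (g : 𝒟 → Full p q → Full p q)
    (γ₀ : Par p) (γhat : ℕ → Ω → Par p) (ρ : ℕ → Measure (Full p q))
    (S : ℕ → Ω → Set (Par p × Full p q)) : Prop :=
  TendstoInMeasure μ
    (fun (n : ℕ) ω =>
      -2 * Real.log (marginal g (ρ n) n (fun i => D i ω) (S n ω)).toReal
        - (-2 * Real.log (elRatio g n (fun i => D i ω)
              (multiplier g n (fun i => D i ω) (γhat n ω)) (γhat n ω))
            + p * Real.log n + cTilde g P γ₀ (ρ n) n))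
    atTop (fun _ => 0)

end ELCIC

/-!
The expansion is a Laplace approximation, carried out with errors relative to the quadratic forms
in the exponent instead of errors of third order.

Write `f γ l = ∑ log (1 + lᵀ g (xᵢ, γ))`, so that the likelihood is `exp (-f)`. A multiplier at `γ`
is a critical point of `f γ`, and since `max ‖g (xᵢ, γ)‖ · rₙ → 0` the Hessian of `f γ` at scale
`rₙ` is `-n Σ₁₁` up to a factor `1 + o(1)` (`IsMult.abs_logEL_sub_le`). This gives three facts on
the window: multipliers exist and have norm `O(rₙ)`; the deviation `δ` contributes
`exp (n δᵀ Σ₁₁ δ / 2)` to the likelihood; and the multiplier `l` solves `Σ₁₁ l ≈ ḡ(γ)`, where `ḡ`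
is the sample mean of `g`. By the efficiency condition the Jacobian of `ḡ` is about `-Σ₁₁ (I, 0)ᵀ`.
Hence the multipliers at `γ` and at the plug-in estimator `c` differ by about `-(γ - c, 0)`, a
direction orthogonal to `ḡ(c)`, and with `t = γ - c`
`f γ (l + δ) - f c l_c = n tᵀ J t / 2 - n δᵀ Σ₁₁ δ / 2 + o(1 + n ‖t‖² + n ‖δ‖²)`, where
`J = Σ₂₁ Σ₁₁⁻¹ Σ₁₂` is the leading block of `Σ₁₁`
(`NearQuadratic.abs_logEL_sub_logEL_le`, `exists_lik_bounds`).

The relative error changes the Gaussian integral over `t` by a factor `(1 + o(1))^(-p/2)`. In the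
integral over `δ` it is absorbed, by convexity of `exp`, by the integrability of the prior with the
exponent `(1 + η) / 2` (`lintegral_prior_le`, `le_lintegral_prior`). The part of both integrals
outside the window is negligible as `n rₙ² → ∞`. Together this is `exists_marginal_bounds`, which
also gives a measurable majorant of the inner integral: the likelihood need not be measurable in
`γ`, and the majorant is what makes the integral over a larger parameter space subadditive.

All of this is deterministic, for samples that satisfy `GoodSample`. These have probability close
to one (`exists_measure_not_goodSample_le`): the moments and the Jacobian at `γ₀` converge by the
law of large numbers, the bound `K` controls their oscillation near `γ₀` and the maximum of
`‖g (xᵢ, γ)‖`, and the root of `g₁` is within `O_p(n^(-1/2))` of `γ₀` because `E[g₁ g₁ᵀ]` is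
positive definite and `ḡ(γ₀) = O_p(n^(-1/2))`.
-/

namespace ELCIC

/-! ### Lagrange multipliers and the second-order expansion of the empirical likelihood -/

section

/-- Second-order expansion of `log (1 + ·)` between two small arguments, with an error relative to
the quadratic term. -/
theorem abs_log_one_add_sub_le {s t θ : ℝ} (hs : |s| ≤ θ) (ht : |t| ≤ θ) (hθ : θ ≤ 1 / 8) :
    |Real.log (1 + t) - Real.log (1 + s) - (1 + s)⁻¹ * (t - s) + (t - s) ^ 2 / 2|
      ≤ 16 * θ * (t - s) ^ 2 := by
  have hθ0 : 0 ≤ θ := (abs_nonneg s).trans hs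
  obtain ⟨hs1, hs2⟩ := abs_le.1 hs
  obtain ⟨ht1, ht2⟩ := abs_le.1 ht
  have hs0 : 0 < 1 + s := by linarith
  have ht0 : 0 < 1 + t := by linarith
  set k := (1 + s)⁻¹ with hk
  have hk0 : 0 < k := inv_pos.2 hs0
  have hks : k * (1 + s) = 1 := inv_mul_cancel₀ hs0.ne'
  have hk1 : k ≤ 8 / 7 := by
    rw [hk, inv_le_comm₀ hs0 (by norm_num)]; norm_num; linarith
  set u := k * (t - s) with hu
  have hD : |t - s| ≤ 2 * θ := by rw [abs_le]; constructor <;> linarith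
  have hu1 : |u| ≤ 8 / 7 * (2 * θ) := by
    rw [hu, abs_mul, abs_of_pos hk0]
    gcongr
  have hu2 : |u| ≤ 1 / 2 := by linarith
  have hlog : Real.log (1 + t) - Real.log (1 + s) = Real.log (1 + u) := by
    rw [← Real.log_div ht0.ne' hs0.ne']
    congr 1
    rw [hu, hk]; field_simp; ring
  have h1 : |Real.log (1 + u) - u + u ^ 2 / 2| ≤ 2 * |u| ^ 3 := by
    have := Real.abs_log_sub_add_sum_range_le (x := -u) (by rw [abs_neg]; linarith) 2
    simp only [Finset.sum_range_succ, Finset.sum_range_zero, abs_neg] at this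
    have h2 : |u| ^ (2 + 1) / (1 - |u|) ≤ 2 * |u| ^ 3 := by
      rw [div_le_iff₀ (by linarith)]
      have : 0 ≤ |u| ^ 3 := by positivity
      norm_num
      nlinarith
    refine le_trans (le_of_eq ?_) (this.trans h2)
    congr 1; push_cast; norm_num; ring
  have hu3 : u ^ 2 ≤ 64 / 49 * (t - s) ^ 2 := by
    rw [hu, mul_pow]
    have : k ^ 2 ≤ 64 / 49 := by nlinarith
    gcongr
  have h3 : 2 * |u| ^ 3 ≤ 8 * θ * (t - s) ^ 2 := by
    have : |u| ^ 3 = |u| * u ^ 2 := by rw [pow_succ', sq_abs]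
    rw [this]
    have := mul_le_mul hu1 hu3 (sq_nonneg _) (by positivity)
    have h0 : 0 ≤ θ * (t - s) ^ 2 := by positivity
    nlinarith
  have h4 : |(t - s) ^ 2 / 2 - u ^ 2 / 2| ≤ 4 * θ * (t - s) ^ 2 := by
    have e : (t - s) ^ 2 / 2 - u ^ 2 / 2 = (t - s) ^ 2 * (k ^ 2 * (2 + s) * s / 2) := by
      have : 1 = k ^ 2 * (1 + s) ^ 2 := by rw [← mul_pow, hks, one_pow]
      rw [hu]; linear_combination ((t - s) ^ 2 / 2) * this
    rw [e, abs_mul, abs_of_nonneg (sq_nonneg (t - s)), mul_comm]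
    gcongr
    rw [abs_div, abs_mul, abs_mul, abs_of_nonneg (sq_nonneg k), abs_of_pos (by linarith : 0 < 2 + s),
      abs_two]
    have : k ^ 2 * (2 + s) ≤ 64 / 49 * (17 / 8) := by
      apply mul_le_mul _ (by linarith) (by linarith) (by norm_num)
      nlinarith
    have := mul_le_mul this hs (abs_nonneg _) (by norm_num)
    linarith
  have e : Real.log (1 + t) - Real.log (1 + s) - k * (t - s) + (t - s) ^ 2 / 2
      = (Real.log (1 + u) - u + u ^ 2 / 2) + ((t - s) ^ 2 / 2 - u ^ 2 / 2) := by
    rw [hlog]; ring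
  rw [e]
  have h0 : 0 ≤ θ * (t - s) ^ 2 := by positivity
  calc _ ≤ _ := abs_add_le _ _
    _ ≤ 16 * θ * (t - s) ^ 2 := by linarith

variable {E : Type*} [NormedAddCommGroup E] [InnerProductSpace ℝ E]

/-- The logarithm `∑ log (1 + λᵀ vᵢ)` of the reciprocal of the empirical likelihood ratio of the
values `v 0, …, v (n - 1)` of an estimating function. -/
noncomputable def logEL (n : ℕ) (v : ℕ → E) (l : E) : ℝ :=
  ∑ i ∈ Finset.range n, Real.log (1 + inner ℝ l (v i))

/-- `l` is a Lagrange multiplier for the values `v 0, …, v (n - 1)` of an estimating function. -/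
def IsMult (n : ℕ) (v : ℕ → E) (l : E) : Prop :=
  (∀ i < n, 0 < 1 + inner ℝ l (v i)) ∧
    ∑ i ∈ Finset.range n, (1 + inner ℝ l (v i))⁻¹ • v i = 0

theorem IsMult.sum_inner {n : ℕ} {v : ℕ → E} {l : E} (h : IsMult n v l) (w : E) :
    ∑ i ∈ Finset.range n, (1 + inner ℝ l (v i))⁻¹ * inner ℝ w (v i) = 0 := by
  have := congrArg (fun z => inner ℝ w z) h.2
  simpa [inner_sum, inner_smul_right] using this

/-- The first-order condition tested against a direction `w`, with the linear part split off. -/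
theorem IsMult.inner_sum_eq {n : ℕ} {v : ℕ → E} {l : E} (h : IsMult n v l) (w : E) :
    inner ℝ w (∑ i ∈ Finset.range n, v i) =
      ∑ i ∈ Finset.range n, (1 + inner ℝ l (v i))⁻¹ * (inner ℝ l (v i) * inner ℝ w (v i)) := by
  rw [inner_sum, ← sub_eq_zero, ← Finset.sum_sub_distrib, ← h.sum_inner w]
  refine Finset.sum_congr rfl fun i hi => ?_
  have := (h.1 i (Finset.mem_range.1 hi)).ne'
  field_simp
  ring

/-- Every multiplier is at most of the order of the mean: in the first-order condition along `l` the
quadratic term dominates, because `1 + lᵀ vᵢ ≤ 1 + ‖l‖ m`. -/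
theorem IsMult.norm_le {n : ℕ} {v : ℕ → E} {l : E} (h : IsMult n v l) {a m : ℝ}
    (hm0 : 0 ≤ m) (ha : 0 < a)
    (hm : ∀ i < n, ‖v i‖ ≤ m) (hQ : a * ‖l‖ ^ 2 ≤ ∑ i ∈ Finset.range n, (inner ℝ l (v i)) ^ 2)
    (hT : m * ‖∑ i ∈ Finset.range n, v i‖ ≤ a / 2) :
    ‖l‖ ≤ 2 * ‖∑ i ∈ Finset.range n, v i‖ / a := by
  set T := ∑ i ∈ Finset.range n, v i with hTdef
  have h1 : a * ‖l‖ ^ 2 ≤ (1 + ‖l‖ * m) * (‖l‖ * ‖T‖) := by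
    calc a * ‖l‖ ^ 2 ≤ ∑ i ∈ Finset.range n, (inner ℝ l (v i)) ^ 2 := hQ
      _ ≤ ∑ i ∈ Finset.range n, (1 + ‖l‖ * m) *
            ((1 + inner ℝ l (v i))⁻¹ * (inner ℝ l (v i) * inner ℝ l (v i))) := by
          refine Finset.sum_le_sum fun i hi => ?_
          have hi' := Finset.mem_range.1 hi
          have hpos := h.1 i hi'
          have hle : inner ℝ l (v i) ≤ ‖l‖ * m :=
            (real_inner_le_norm _ _).trans (by gcongr; exact hm i hi')
          have : 1 ≤ (1 + ‖l‖ * m) * (1 + inner ℝ l (v i))⁻¹ := by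
            rw [← div_eq_mul_inv, one_le_div hpos]; linarith
          nlinarith [mul_self_nonneg (inner ℝ l (v i) : ℝ)]
      _ = (1 + ‖l‖ * m) * inner ℝ l T := by rw [← Finset.mul_sum, h.inner_sum_eq]
      _ ≤ _ := by gcongr; exact real_inner_le_norm _ _
  rcases eq_or_lt_of_le (norm_nonneg l) with h0 | h0
  · rw [← h0]; positivity
  · have h2 : a * ‖l‖ ≤ (1 + ‖l‖ * m) * ‖T‖ := by
      refine le_of_mul_le_mul_left (a := ‖l‖) ?_ h0
      linarith
    rw [le_div_iff₀ ha]
    nlinarith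

/-- Existence of the multiplier: the concave function `logEL n v` is negative on a sphere around
`0` on which its quadratic part dominates, so its maximum over the ball is a critical point. -/
theorem exists_isMult [FiniteDimensional ℝ E] {n : ℕ} {v : ℕ → E} {a m : ℝ} (ha : 0 < a)
    (hm : ∀ i < n, ‖v i‖ ≤ m) (hQ : ∀ l, a * ‖l‖ ^ 2 ≤ ∑ i ∈ Finset.range n, (inner ℝ l (v i)) ^ 2)
    (hT : m * ‖∑ i ∈ Finset.range n, v i‖ ≤ a / 320) : ∃ l, IsMult n v l := by
  set T := ∑ i ∈ Finset.range n, v i with hTdef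
  by_cases hT0 : T = 0
  · exact ⟨0, by simp, by simpa using hT0⟩
  have hTpos : 0 < ‖T‖ := norm_pos_iff.2 hT0
  -- on the sphere of radius `R` the quadratic part `a R² / 4` exceeds the linear part `R ‖T‖`
  set R := 5 * ‖T‖ / a with hR
  have hRpos : 0 < R := by positivity
  have hsmall : ∀ l ∈ Metric.closedBall (0 : E) R, ∀ i < n, |inner ℝ l (v i)| ≤ 1 / 64 := by
    intro l hl i hi
    rw [mem_closedBall_zero_iff] at hl
    calc |inner ℝ l (v i)| ≤ ‖l‖ * ‖v i‖ := abs_real_inner_le_norm _ _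
      _ ≤ R * m := by gcongr; exact hm i hi
      _ = 5 * (m * ‖T‖) / a := by rw [hR]; ring
      _ ≤ 5 * (a / 320) / a := by gcongr
      _ = 1 / 64 := by field_simp; norm_num
  have hpos : ∀ l ∈ Metric.closedBall (0 : E) R, ∀ i < n, 0 < 1 + (inner ℝ l (v i) : ℝ) := by
    intro l hl i hi
    have := (abs_le.1 (hsmall l hl i hi)).1
    linarith
  have hcont : ContinuousOn (logEL n v) (Metric.closedBall (0 : E) R) := by
    refine continuousOn_finsetSum _ fun i hi => ContinuousOn.log (by fun_prop) fun l hl => ?_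
    exact (hpos l hl i (Finset.mem_range.1 hi)).ne'
  obtain ⟨l, hl, hmax⟩ := (isCompact_closedBall (0 : E) R).exists_isMaxOn
    ⟨0, Metric.mem_closedBall_self hRpos.le⟩ hcont
  have hl' : ‖l‖ < R := by
    refine lt_of_le_of_ne (mem_closedBall_zero_iff.1 hl) fun heq => ?_
    have h0 : 0 ≤ logEL n v l := by
      have := hmax (Metric.mem_closedBall_self hRpos.le)
      simpa [logEL] using this
    have h1 : logEL n v l ≤ ‖l‖ * ‖T‖ - a * ‖l‖ ^ 2 / 4 := by
      calc logEL n v l ≤ ∑ i ∈ Finset.range n, (inner ℝ l (v i) - (inner ℝ l (v i)) ^ 2 / 4) := by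
            refine Finset.sum_le_sum fun i hi => ?_
            have hb := hsmall l hl i (Finset.mem_range.1 hi)
            set s : ℝ := inner ℝ l (v i)
            have := (abs_le.1 (abs_log_one_add_sub_le (s := 0) (t := s) (θ := 1 / 64) (by simp)
              hb (by norm_num))).2
            simp at this
            linarith
        _ = inner ℝ l T - (∑ i ∈ Finset.range n, (inner ℝ l (v i)) ^ 2) / 4 := by
            rw [Finset.sum_sub_distrib, ← inner_sum, Finset.sum_div]
        _ ≤ _ := by
            have := real_inner_le_norm l T
            have := hQ l
            linarith
    rw [heq] at h1
    have h2 : R * ‖T‖ - a * R ^ 2 / 4 = -(5 / 4 * ‖T‖ ^ 2 / a) := by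
      rw [hR]; field_simp; ring
    have : 0 < 5 / 4 * ‖T‖ ^ 2 / a := by positivity
    linarith
  refine ⟨l, hpos l hl, ?_⟩
  have hloc : IsLocalMax (logEL n v) l :=
    hmax.isLocalMax (Metric.closedBall_mem_nhds_of_mem (by simpa using hl'))
  have hder : HasFDerivAt (logEL n v)
      (∑ i ∈ Finset.range n, (1 + inner ℝ l (v i))⁻¹ • (innerSL ℝ (v i))) l := by
    refine HasFDerivAt.fun_sum fun i hi => HasFDerivAt.log ?_ (hpos l hl i (Finset.mem_range.1 hi)).ne'
    have : HasFDerivAt (fun l : E => (innerSL ℝ (v i)) l) (innerSL ℝ (v i)) l :=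
      (innerSL ℝ (v i)).hasFDerivAt
    refine (this.const_add 1).congr_of_eventuallyEq (Eventually.of_forall fun z => ?_)
    simp [real_inner_comm]
  have hz := hloc.hasFDerivAt_eq_zero hder
  refine ext_inner_left ℝ fun w => ?_
  have := congrArg (fun φ : E →L[ℝ] ℝ => φ w) hz
  simpa [inner_sum, inner_smul_right, real_inner_comm, sum_apply] using this

/-- The second-order expansion of `logEL` around a multiplier, with a relative error. -/
theorem IsMult.abs_logEL_sub_le {n : ℕ} {v : ℕ → E} {l : E} (h : IsMult n v l) {l' : E} {θ : ℝ}
    (hθ : θ ≤ 1 / 8) (hl : ∀ i < n, |inner ℝ l (v i)| ≤ θ) (hl' : ∀ i < n, |inner ℝ l' (v i)| ≤ θ) :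
    |logEL n v l' - logEL n v l + (∑ i ∈ Finset.range n, (inner ℝ (l' - l) (v i)) ^ 2) / 2|
      ≤ 16 * θ * ∑ i ∈ Finset.range n, (inner ℝ (l' - l) (v i)) ^ 2 := by
  have e : logEL n v l' - logEL n v l + (∑ i ∈ Finset.range n, (inner ℝ (l' - l) (v i)) ^ 2) / 2
      = ∑ i ∈ Finset.range n, (Real.log (1 + inner ℝ l' (v i)) - Real.log (1 + inner ℝ l (v i))
        - (1 + inner ℝ l (v i))⁻¹ * (inner ℝ l' (v i) - inner ℝ l (v i))
        + (inner ℝ l' (v i) - inner ℝ l (v i)) ^ 2 / 2) := by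
    have := h.sum_inner (l' - l)
    simp only [inner_sub_left] at this ⊢
    rw [Finset.sum_add_distrib, Finset.sum_sub_distrib, Finset.sum_sub_distrib, this, Finset.sum_div]
    simp [logEL]
  rw [e, Finset.mul_sum]
  refine (Finset.abs_sum_le_sum_abs _ _).trans (Finset.sum_le_sum fun i hi => ?_)
  rw [inner_sub_left]
  exact abs_log_one_add_sub_le (hl i (Finset.mem_range.1 hi)) (hl' i (Finset.mem_range.1 hi)) hθ

end

/-! ### Samples whose second moments are close to a fixed operator -/

section

variable {E : Type*} [NormedAddCommGroup E] [InnerProductSpace ℝ E]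

/-- The values `v 0, …, v (n - 1)` of an estimating function behave at the scale `r` like a sample
with second-moment operator `A`, up to a relative error `κ`, and their mean is of order `r`. -/
structure NearQuadratic (A : E →L[ℝ] E) (n : ℕ) (v : ℕ → E) (r κ C : ℝ) : Prop where
  second_moment : ∀ l w, |∑ i ∈ Finset.range n, (inner ℝ l (v i) * inner ℝ w (v i) : ℝ)
    - n * inner ℝ (A l) w| ≤ n * κ * (‖l‖ * ‖w‖)
  norm_le : ∀ i < n, r * ‖v i‖ ≤ κ
  norm_sum_le : ‖∑ i ∈ Finset.range n, v i‖ ≤ n * (C * r)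

/-- The constant of the error bounds for a sample of type `NearQuadratic`, in terms of the lower
bound `a` and the norm `b` of the second-moment operator. -/
noncomputable def errConst (a b C : ℝ) : ℝ := 16 * (4 * C / a + 1) * (b + 1) + 1

/-- The largest relative error `κ` for which the bounds on samples of type `NearQuadratic` hold. -/
noncomputable def errMax (a C : ℝ) : ℝ := min (min 1 (a / 2)) (min (a / (640 * (C + 1)))
  (1 / (8 * (4 * C / a + 1))))

theorem errMax_pos {a C : ℝ} (ha : 0 < a) (hC : 0 ≤ C) : 0 < errMax a C := by
  unfold errMax; positivity

namespace NearQuadratic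

variable {A : E →L[ℝ] E} {n : ℕ} {v : ℕ → E} {r κ C a : ℝ}

section
variable (h : NearQuadratic A n v r κ C) (ha : 0 < a) (hC : 0 ≤ C) (hr : 0 < r) (hκ : 0 ≤ κ)
  (hκ' : κ ≤ errMax a C) (hA : ∀ l, a * ‖l‖ ^ 2 ≤ inner ℝ (A l) l)

include h in
theorem sum_sq_le (hκ : κ ≤ 1) (l : E) :
    ∑ i ∈ Finset.range n, (inner ℝ l (v i)) ^ 2 ≤ n * ((‖A‖ + 1) * ‖l‖ ^ 2) := by
  have h1 := (abs_le.1 (h.second_moment l l)).2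
  have h2 : inner ℝ (A l) l ≤ ‖A‖ * ‖l‖ ^ 2 := by
    calc inner ℝ (A l) l ≤ ‖A l‖ * ‖l‖ := real_inner_le_norm _ _
      _ ≤ ‖A‖ * ‖l‖ * ‖l‖ := by gcongr; exact A.le_opNorm l
      _ = _ := by ring
  have h3 : (n : ℝ) * inner ℝ (A l) l ≤ n * (‖A‖ * ‖l‖ ^ 2) := by gcongr
  have h4 : n * κ * (‖l‖ * ‖l‖) ≤ n * 1 * (‖l‖ * ‖l‖) := by gcongr
  simp only [pow_two] at *
  linarith

include h hA in
theorem le_sum_sq (hκ : κ ≤ a / 2) (l : E) :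
    n * (a / 2) * ‖l‖ ^ 2 ≤ ∑ i ∈ Finset.range n, (inner ℝ l (v i)) ^ 2 := by
  have h1 := (abs_le.1 (h.second_moment l l)).1
  have h3 : (n : ℝ) * (a * ‖l‖ ^ 2) ≤ n * inner ℝ (A l) l := by gcongr; exact hA l
  have h4 : n * κ * (‖l‖ * ‖l‖) ≤ n * (a / 2) * (‖l‖ * ‖l‖) := by gcongr
  simp only [pow_two] at *
  linarith

include h ha hC hr hκ hκ' in
theorem bound_mul_norm_sum_le :
    κ / r * ‖∑ i ∈ Finset.range n, v i‖ ≤ n * (a / 2) / 320 := by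
  have h1 : κ ≤ a / (640 * (C + 1)) := hκ'.trans ((min_le_right _ _).trans (min_le_left _ _))
  calc κ / r * ‖∑ i ∈ Finset.range n, v i‖ ≤ κ / r * (n * (C * r)) := by
        gcongr; exact h.norm_sum_le
    _ = n * (κ * C) := by field_simp
    _ ≤ n * (a / (640 * (C + 1)) * (C + 1)) := by gcongr; linarith
    _ = n * (a / 2) / 320 := by field_simp; ring

include h ha hC hr hκ hκ' hA in
theorem exists_isMult [FiniteDimensional ℝ E] (hn : 0 < n) : ∃ l, IsMult n v l := by
  have hn' : (0 : ℝ) < n := by exact_mod_cast hn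
  refine ELCIC.exists_isMult (a := n * (a / 2)) (m := κ / r) (by positivity) ?_ ?_
    (h.bound_mul_norm_sum_le ha hC hr hκ hκ')
  · intro i hi
    rw [le_div_iff₀ hr, mul_comm]
    exact h.norm_le i hi
  · exact h.le_sum_sq hA (hκ'.trans ((min_le_left _ _).trans (min_le_right _ _)))

include h ha hC hr hκ hκ' hA in
theorem norm_mult_le (hn : 0 < n) {l : E} (hl : IsMult n v l) :
    ‖l‖ ≤ 4 / a * (‖∑ i ∈ Finset.range n, v i‖ / n) := by
  have hn' : (0 : ℝ) < n := by exact_mod_cast hn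
  refine (hl.norm_le (a := n * (a / 2)) (m := κ / r) (by positivity) (by positivity) ?_ ?_
    ?_).trans (le_of_eq ?_)
  · intro i hi
    rw [le_div_iff₀ hr, mul_comm]
    exact h.norm_le i hi
  · exact h.le_sum_sq hA (hκ'.trans ((min_le_left _ _).trans (min_le_right _ _))) l
  · refine (h.bound_mul_norm_sum_le ha hC hr hκ hκ').trans ?_
    have : 0 < n * (a / 2) := by positivity
    linarith
  · field_simp; ring

include h ha hC hr hκ hκ' hA in
theorem norm_mult_le' (hn : 0 < n) {l : E} (hl : IsMult n v l) : ‖l‖ ≤ 4 * C / a * r := by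
  have hn' : (0 : ℝ) < n := by exact_mod_cast hn
  calc ‖l‖ ≤ 4 / a * (‖∑ i ∈ Finset.range n, v i‖ / n) :=
        h.norm_mult_le ha hC hr hκ hκ' hA hn hl
    _ ≤ 4 / a * (n * (C * r) / n) := by gcongr; exact h.norm_sum_le
    _ = _ := by field_simp

include h in
theorem abs_inner_le {l : E} {i : ℕ} (hi : i < n) {c : ℝ} (hc : 0 ≤ c) (hl : ‖l‖ ≤ c * r) :
    |inner ℝ l (v i)| ≤ c * κ := by
  calc |inner ℝ l (v i)| ≤ ‖l‖ * ‖v i‖ := abs_real_inner_le_norm _ _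
    _ ≤ c * r * ‖v i‖ := by gcongr
    _ = c * (r * ‖v i‖) := by ring
    _ ≤ c * κ := by gcongr; exact h.norm_le i hi

include ha hC hκ' in
theorem mul_err_le : (4 * C / a + 1) * κ ≤ 1 / 8 := by
  have h1 : κ ≤ 1 / (8 * (4 * C / a + 1)) := hκ'.trans ((min_le_right _ _).trans (min_le_right _ _))
  have : 0 < 4 * C / a + 1 := by positivity
  calc _ ≤ (4 * C / a + 1) * (1 / (8 * (4 * C / a + 1))) := by gcongr
    _ = 1 / 8 := by field_simp

include h ha hC hr hκ hκ' hA in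
/-- The multiplier solves the linearized first-order condition up to a relative error. -/
theorem norm_sum_sub_le (hn : 0 < n) {l : E} (hl : IsMult n v l) :
    ‖∑ i ∈ Finset.range n, v i - (n : ℝ) • A l‖ ≤ n * (errConst a ‖A‖ C * κ * ‖l‖) := by
  have hκ1 : κ ≤ 1 := hκ'.trans ((min_le_left _ _).trans (min_le_left _ _))
  have hlr := h.norm_mult_le' ha hC hr hκ hκ' hA hn hl
  have hc : 0 ≤ 4 * C / a := by positivity
  set w := ∑ i ∈ Finset.range n, v i - (n : ℝ) • A l with hw
  have key : ‖w‖ * ‖w‖ ≤ n * (errConst a ‖A‖ C * κ * ‖l‖) * ‖w‖ := by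
    have e : ‖w‖ * ‖w‖ = ∑ i ∈ Finset.range n, ((1 + inner ℝ l (v i))⁻¹ - 1) *
        (inner ℝ l (v i) * inner ℝ w (v i)) + (∑ i ∈ Finset.range n,
          (inner ℝ l (v i) * inner ℝ w (v i) : ℝ) - n * inner ℝ (A l) w) := by
      rw [← real_inner_self_eq_norm_mul_norm]
      conv_lhs => rw [hw, ← hw, inner_sub_right, hl.inner_sum_eq w, inner_smul_right]
      simp only [sub_mul, Finset.sum_sub_distrib, one_mul]
      rw [real_inner_comm]
      ring
    have h1 : ∑ i ∈ Finset.range n, ((1 + inner ℝ l (v i))⁻¹ - 1) *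
        (inner ℝ l (v i) * inner ℝ w (v i)) ≤
        2 * (κ / r * ‖w‖) * ∑ i ∈ Finset.range n, (inner ℝ l (v i)) ^ 2 := by
      rw [Finset.mul_sum]
      refine Finset.sum_le_sum fun i hi => ?_
      have hi' := Finset.mem_range.1 hi
      have hs : |inner ℝ l (v i)| ≤ 1 / 8 := by
        refine (h.abs_inner_le hi' hc hlr).trans (le_trans ?_ (mul_err_le ha hC hκ'))
        linarith
      have hwv : |inner ℝ w (v i)| ≤ κ / r * ‖w‖ := by
        calc _ ≤ ‖w‖ * ‖v i‖ := abs_real_inner_le_norm _ _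
          _ ≤ ‖w‖ * (κ / r) := by
            gcongr
            rw [le_div_iff₀ hr, mul_comm]
            exact h.norm_le i hi'
          _ = _ := mul_comm _ _
      set s : ℝ := inner ℝ l (v i)
      have hpos : 0 < 1 + s := by have := (abs_le.1 hs).1; linarith
      have hinv : (1 + s)⁻¹ ≤ 2 := by
        rw [inv_le_comm₀ hpos (by norm_num)]
        have := (abs_le.1 hs).1; norm_num; linarith
      have e2 : ((1 + s)⁻¹ - 1) * (s * inner ℝ w (v i)) = (1 + s)⁻¹ * s ^ 2 * (-inner ℝ w (v i)) := by
        field_simp; ring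
      rw [e2]
      calc (1 + s)⁻¹ * s ^ 2 * (-inner ℝ w (v i)) ≤ (1 + s)⁻¹ * s ^ 2 * (κ / r * ‖w‖) := by
            have : 0 ≤ (1 + s)⁻¹ := (inv_pos.2 hpos).le
            gcongr
            exact (neg_le_abs _).trans hwv
        _ ≤ 2 * s ^ 2 * (κ / r * ‖w‖) := by gcongr
        _ = _ := by ring
    have h2 := (abs_le.1 (h.second_moment l w)).2
    have h3 : 2 * (κ / r * ‖w‖) * ∑ i ∈ Finset.range n, (inner ℝ l (v i)) ^ 2 ≤
        2 * (κ / r * ‖w‖) * (n * ((‖A‖ + 1) * (‖l‖ * (4 * C / a * r)))) := by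
      gcongr
      refine (h.sum_sq_le hκ1 l).trans ?_
      rw [pow_two]
      gcongr
    have h4 : 2 * (κ / r * ‖w‖) * (n * ((‖A‖ + 1) * (‖l‖ * (4 * C / a * r)))) =
        n * (2 * (4 * C / a) * (‖A‖ + 1) * κ * ‖l‖) * ‖w‖ := by field_simp
    have h5 : n * (2 * (4 * C / a) * (‖A‖ + 1) * κ * ‖l‖) * ‖w‖ + n * κ * (‖l‖ * ‖w‖) ≤
        n * (errConst a ‖A‖ C * κ * ‖l‖) * ‖w‖ := by
      have h6 : 2 * (4 * C / a) * (‖A‖ + 1) + 1 ≤ errConst a ‖A‖ C := by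
        unfold errConst
        have : 0 ≤ 4 * C / a * (‖A‖ + 1) := by positivity
        have := norm_nonneg A
        linarith
      calc _ = n * ((2 * (4 * C / a) * (‖A‖ + 1) + 1) * κ * ‖l‖) * ‖w‖ := by ring
        _ ≤ _ := by gcongr
    linarith
  rcases eq_or_lt_of_le (norm_nonneg w) with h0 | h0
  · rw [← h0]
    have : 0 ≤ errConst a ‖A‖ C := by unfold errConst; positivity
    positivity
  · exact le_of_mul_le_mul_right key h0

include h ha hC hr hκ hκ' hA in
/-- Around the multiplier, `logEL` is quadratic up to a relative error. -/
theorem abs_logEL_sub_le (hn : 0 < n) {l l' : E} (hl : IsMult n v l)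
    (hl' : ‖l'‖ ≤ (4 * C / a + 1) * r) :
    |logEL n v l' - logEL n v l + n * inner ℝ (A (l' - l)) (l' - l) / 2|
      ≤ n * (errConst a ‖A‖ C * κ * ‖l' - l‖ ^ 2) := by
  have hκ1 : κ ≤ 1 := hκ'.trans ((min_le_left _ _).trans (min_le_left _ _))
  have hc : 0 ≤ 4 * C / a := by positivity
  have h1 := hl.abs_logEL_sub_le (l' := l') (mul_err_le ha hC hκ')
    (fun i hi => (h.abs_inner_le hi hc (h.norm_mult_le' ha hC hr hκ hκ' hA hn hl)).trans
      (by linarith)) (fun i hi => h.abs_inner_le hi (by positivity) hl')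
  have h2 := h.second_moment (l' - l) (l' - l)
  have h3 := h.sum_sq_le hκ1 (l' - l)
  have h4 : 16 * ((4 * C / a + 1) * κ) * ∑ i ∈ Finset.range n, (inner ℝ (l' - l) (v i)) ^ 2 ≤
      16 * ((4 * C / a + 1) * κ) * (n * ((‖A‖ + 1) * ‖l' - l‖ ^ 2)) := by gcongr
  have h5 : n * (errConst a ‖A‖ C * κ * ‖l' - l‖ ^ 2) =
      16 * ((4 * C / a + 1) * κ) * (n * ((‖A‖ + 1) * ‖l' - l‖ ^ 2)) + n * κ * ‖l' - l‖ ^ 2 := by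
    unfold errConst; ring
  have h6 : 0 ≤ n * κ * ‖l' - l‖ ^ 2 := by positivity
  simp only [← pow_two] at h2
  rw [h5]
  rw [abs_le] at *
  constructor <;> linarith

end

theorem abs_quadratic_sub_le {A : E →L[ℝ] E}
    (hsymm : ∀ l w, inner ℝ (A l) w = inner ℝ (A w) l) (l lc u : E) :
    |inner ℝ (A l) l - inner ℝ (A lc) lc - inner ℝ (A u) u| ≤
      ‖A (l - lc + u)‖ * (‖lc‖ + ‖u‖ + ‖l‖) + 2 * |inner ℝ (A lc) u| := by
  have e : inner ℝ (A l) l - inner ℝ (A lc) lc - inner ℝ (A u) u =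
      inner ℝ (A (l - lc + u)) (lc - u + l) - 2 * inner ℝ (A lc) u := by
    simp only [map_add, map_sub, inner_add_left, inner_add_right, inner_sub_left, inner_sub_right]
    rw [hsymm lc l, hsymm u l, hsymm u lc]
    ring
  have h1 : |inner ℝ (A (l - lc + u)) (lc - u + l)| ≤
      ‖A (l - lc + u)‖ * (‖lc‖ + ‖u‖ + ‖l‖) := by
    refine (abs_real_inner_le_norm _ _).trans ?_
    gcongr
    exact (norm_add_le _ _).trans (add_le_add (norm_sub_le _ _) le_rfl)
  rw [e]
  refine (abs_sub _ _).trans ?_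
  rw [abs_mul, abs_two]
  linarith

set_option maxHeartbeats 1000000 in
/-- The exponent of the Laplace approximation. The mean of the sample `v` is obtained from that of
`vc` by the shift `-A u`, where `u` is orthogonal to the mean of `vc`; so the two multipliers differ
by about `-u`, and no cross term between them and `u` is left. -/
theorem abs_logEL_sub_logEL_le {vc : ℕ → E} (h : NearQuadratic A n v r κ C)
    (hvc : NearQuadratic A n vc r κ C) (ha : 0 < a) (hC : 0 ≤ C) (hr : 0 < r) (hκ : 0 ≤ κ)
    (hκ' : κ ≤ errMax a C) (hA : ∀ l, a * ‖l‖ ^ 2 ≤ inner ℝ (A l) l)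
    (hsymm : ∀ l w, inner ℝ (A l) w = inner ℝ (A w) l) (hn : 0 < n)
    {l lc u δ : E} (hl : IsMult n v l) (hlc : IsMult n vc lc) (hδ : ‖δ‖ ≤ r)
    (hu : ‖∑ i ∈ Finset.range n, v i - ∑ i ∈ Finset.range n, vc i + (n : ℝ) • A u‖ ≤ n * (κ * ‖u‖))
    (hort : inner ℝ (∑ i ∈ Finset.range n, vc i) u = 0) :
    |logEL n v (l + δ) - logEL n vc lc - n * inner ℝ (A u) u / 2 + n * inner ℝ (A δ) δ / 2|
      ≤ 16 * errConst a ‖A‖ C * (4 * (‖A‖ + 1) / a + 1) ^ 2 * κ *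
        (n * ((‖∑ i ∈ Finset.range n, vc i‖ / n) ^ 2 + ‖u‖ ^ 2 + ‖δ‖ ^ 2)) := by
  have hn' : (0 : ℝ) < n := by exact_mod_cast hn
  have hκ1 : κ ≤ 1 := hκ'.trans ((min_le_left _ _).trans (min_le_left _ _))
  set T := ∑ i ∈ Finset.range n, v i
  set Tc := ∑ i ∈ Finset.range n, vc i
  set b := ‖A‖ with hb
  have hb0 : 0 ≤ b := norm_nonneg A
  set H := 4 * (b + 1) / a + 1 with hH
  have hH1 : 1 ≤ H := by rw [hH]; have : 0 ≤ 4 * (b + 1) / a := by positivity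
                         linarith
  set K := errConst a b C with hK
  have hK1 : 1 ≤ K := by
    rw [hK]; unfold errConst
    have : 0 ≤ 16 * (4 * C / a + 1) * (b + 1) := by positivity
    linarith
  set G := ‖Tc‖ / n with hG
  have hG0 : 0 ≤ G := by positivity
  set X := G + ‖u‖ with hX
  have hX0 : 0 ≤ X := by positivity
  have hux : ‖u‖ ≤ X := by linarith
  -- all the vectors involved have norm at most a constant times `X`
  have hlc' : ‖lc‖ ≤ H * X := by
    calc ‖lc‖ ≤ 4 / a * G := hvc.norm_mult_le ha hC hr hκ hκ' hA hn hlc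
      _ ≤ 4 * (b + 1) / a * X := by
        gcongr
        · linarith
        · linarith [norm_nonneg u]
      _ ≤ H * X := by gcongr; linarith
  have hTle : ‖T‖ / n ≤ (b + 1) * X := by
    rw [div_le_iff₀ hn']
    have e : T = (T - Tc + (n : ℝ) • A u) + Tc - (n : ℝ) • A u := by abel
    have h1 : ‖(n : ℝ) • A u‖ ≤ n * (b * ‖u‖) := by
      rw [norm_smul, Real.norm_natCast]; gcongr; exact A.le_opNorm u
    have h2 : ‖T‖ ≤ n * (κ * ‖u‖) + ‖Tc‖ + n * (b * ‖u‖) := by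
      conv_lhs => rw [e]
      exact (norm_sub_le _ _).trans (add_le_add ((norm_add_le _ _).trans
        (add_le_add hu le_rfl)) h1)
    have h3 : ‖Tc‖ = n * G := by rw [hG]; field_simp
    have h4 : κ * ‖u‖ ≤ 1 * ‖u‖ := by gcongr
    have h5 : n * (κ * ‖u‖ + G + b * ‖u‖) ≤ n * ((b + 1) * X) := by
      gcongr
      rw [hX]
      nlinarith
    linarith
  have hl' : ‖l‖ ≤ H * X := by
    calc ‖l‖ ≤ 4 / a * (‖T‖ / n) := h.norm_mult_le ha hC hr hκ hκ' hA hn hl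
      _ ≤ 4 / a * ((b + 1) * X) := by gcongr
      _ = 4 * (b + 1) / a * X := by ring
      _ ≤ H * X := by gcongr; linarith
  -- the defect `l - lc + u` is negligible
  have hy : ‖A (l - lc + u)‖ ≤ 3 * K * H * κ * X := by
    have h1 := h.norm_sum_sub_le ha hC hr hκ hκ' hA hn hl
    have h2 := hvc.norm_sum_sub_le ha hC hr hκ hκ' hA hn hlc
    have e : (n : ℝ) • A (l - lc + u) =
        (T - Tc + (n : ℝ) • A u) - (T - (n : ℝ) • A l) + (Tc - (n : ℝ) • A lc) := by
      simp only [map_add, map_sub, smul_add, smul_sub]; abel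
    have h3 : (n : ℝ) * ‖A (l - lc + u)‖ ≤
        n * (κ * ‖u‖) + n * (K * κ * ‖l‖) + n * (K * κ * ‖lc‖) := by
      calc (n : ℝ) * ‖A (l - lc + u)‖ = ‖(n : ℝ) • A (l - lc + u)‖ := by
            rw [norm_smul, Real.norm_natCast]
        _ ≤ _ := by
            rw [e]
            exact (norm_add_le _ _).trans (add_le_add ((norm_sub_le _ _).trans
              (add_le_add hu h1)) h2)
    have h4 : κ * ‖u‖ ≤ K * κ * (H * X) := by
      calc κ * ‖u‖ = 1 * κ * (1 * ‖u‖) := by ring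
        _ ≤ K * κ * (H * X) := by gcongr
    have h5 : n * (κ * ‖u‖) + n * (K * κ * ‖l‖) + n * (K * κ * ‖lc‖) ≤
        n * (K * κ * (H * X)) + n * (K * κ * (H * X)) + n * (K * κ * (H * X)) := by gcongr
    refine le_of_mul_le_mul_left (a := (n : ℝ)) ?_ hn'
    linarith
  have hquad : |inner ℝ (A l) l - inner ℝ (A lc) lc - inner ℝ (A u) u| ≤ 11 * K * H ^ 2 * κ * X ^ 2 := by
    have h1 : ‖A (l - lc + u)‖ * (‖lc‖ + ‖u‖ + ‖l‖) ≤ 3 * K * H * κ * X * (H * X + H * X + H * X) := by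
      have : ‖u‖ ≤ H * X := hux.trans (le_mul_of_one_le_left hX0 hH1)
      gcongr
    have h2 : (n : ℝ) * |inner ℝ (A lc) u| ≤ n * (K * κ * (H * X) * (H * X)) := by
      have e1 : (n : ℝ) * |inner ℝ (A lc) u| = |inner ℝ (Tc - (n : ℝ) • A lc) u| := by
        rw [inner_sub_left, hort, inner_smul_left, zero_sub, abs_neg, abs_mul]
        simp
      rw [e1]
      refine (abs_real_inner_le_norm _ _).trans ?_
      calc _ ≤ n * (K * κ * ‖lc‖) * ‖u‖ := by
            gcongr
            exact hvc.norm_sum_sub_le ha hC hr hκ hκ' hA hn hlc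
        _ ≤ n * (K * κ * (H * X)) * (H * X) := by
            have : ‖u‖ ≤ H * X := hux.trans (le_mul_of_one_le_left hX0 hH1)
            gcongr
        _ = _ := by ring
    have h3 := le_of_mul_le_mul_left h2 hn'
    refine (abs_quadratic_sub_le hsymm l lc u).trans ?_
    linarith
  have hf1 := h.abs_logEL_sub_le ha hC hr hκ hκ' hA hn (l' := l + δ) hl (by
    refine (norm_add_le _ _).trans ?_
    have := h.norm_mult_le' ha hC hr hκ hκ' hA hn hl
    linarith)
  have hzero : ‖(0 : E)‖ ≤ (4 * C / a + 1) * r := by rw [norm_zero]; positivity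
  have hf2 := h.abs_logEL_sub_le ha hC hr hκ hκ' hA hn (l' := 0) hl hzero
  have hf3 := hvc.abs_logEL_sub_le ha hC hr hκ hκ' hA hn (l' := 0) hlc hzero
  simp only [add_sub_cancel_left, zero_sub, map_neg, inner_neg_neg, norm_neg] at hf1 hf2 hf3
  have hz : ∀ w : ℕ → E, logEL n w 0 = 0 := fun w => by simp [logEL]
  rw [hz] at hf2 hf3
  rw [← hb, ← hK] at hf1 hf2 hf3
  have hb1 : n * (K * κ * ‖l‖ ^ 2) ≤ n * (K * κ * (H * X) ^ 2) := by gcongr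
  have hb2 : n * (K * κ * ‖lc‖ ^ 2) ≤ n * (K * κ * (H * X) ^ 2) := by gcongr
  have hb3 : n * (K * κ * ‖δ‖ ^ 2) ≤ n * (K * H ^ 2 * κ * ‖δ‖ ^ 2) := by
    have : K * 1 ≤ K * H ^ 2 := by gcongr; nlinarith
    gcongr; linarith
  have hX2 : n * (K * H ^ 2 * κ * X ^ 2) ≤ n * (K * H ^ 2 * κ * (2 * (G ^ 2 + ‖u‖ ^ 2))) := by
    gcongr
    nlinarith [sq_nonneg (G - ‖u‖)]
  have hq1 : |n * inner ℝ (A l) l - n * inner ℝ (A lc) lc - n * inner ℝ (A u) u| ≤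
      n * (11 * K * H ^ 2 * κ * X ^ 2) := by
    rw [← mul_sub, ← mul_sub, abs_mul, abs_of_pos hn']
    gcongr
  have hδ0 : 0 ≤ n * (K * H ^ 2 * κ * ‖δ‖ ^ 2) := by positivity
  have hu0 : 0 ≤ n * (K * H ^ 2 * κ * (G ^ 2 + ‖u‖ ^ 2)) := by positivity
  have hb4 : n * (K * κ * (H * X) ^ 2) = n * (K * H ^ 2 * κ * X ^ 2) := by ring
  have hb5 : n * (11 * K * H ^ 2 * κ * X ^ 2) = 11 * (n * (K * H ^ 2 * κ * X ^ 2)) := by ring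
  have hb6 : n * (K * H ^ 2 * κ * (2 * (G ^ 2 + ‖u‖ ^ 2))) =
    2 * (n * (K * H ^ 2 * κ * (G ^ 2 + ‖u‖ ^ 2))) := by ring
  have hb7 : 16 * K * H ^ 2 * κ * (n * (G ^ 2 + ‖u‖ ^ 2 + ‖δ‖ ^ 2)) =
    16 * (n * (K * H ^ 2 * κ * (G ^ 2 + ‖u‖ ^ 2))) + 16 * (n * (K * H ^ 2 * κ * ‖δ‖ ^ 2)) := by ring
  rw [hb4] at hb1 hb2
  rw [hb5] at hq1
  rw [hb6] at hX2
  rw [hb7]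
  have e : logEL n v (l + δ) - logEL n vc lc - n * inner ℝ (A u) u / 2 + n * inner ℝ (A δ) δ / 2 =
      (logEL n v (l + δ) - logEL n v l + n * inner ℝ (A δ) δ / 2)
      - (0 - logEL n v l + n * inner ℝ (A l) l / 2)
      + (0 - logEL n vc lc + n * inner ℝ (A lc) lc / 2)
      + (n * inner ℝ (A l) l - n * inner ℝ (A lc) lc - n * inner ℝ (A u) u) / 2 := by ring
  rw [e]
  refine (abs_add_le _ _).trans ((add_le_add ((abs_add_le _ _).trans (add_le_add
    ((abs_sub _ _).trans (add_le_add hf1 hf2)) hf3)) le_rfl).trans ?_)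
  rw [abs_div, abs_two]
  linarith

end NearQuadratic

end

/-! ### Gaussian integrals and the prior on the deviation -/

section Matrix
open scoped MatrixOrder
variable {ι : Type*} [Fintype ι] [DecidableEq ι]

theorem exists_coercive {A : Matrix ι ι ℝ} (hA : A.PosDef) :
    ∃ a > 0, ∀ x : EuclideanSpace ℝ ι,
      a * ‖x‖ ^ 2 ≤ inner ℝ (Matrix.toEuclideanCLM (𝕜 := ℝ) A x) x := by
  have hpos : ∀ x : EuclideanSpace ℝ ι, x ≠ 0 →
      0 < inner ℝ (Matrix.toEuclideanCLM (𝕜 := ℝ) A x) x := by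
    intro x hx
    rw [real_inner_comm, Matrix.inner_toEuclideanCLM]
    have := hA.dotProduct_mulVec_pos (x := x.ofLp) (by simpa using hx)
    simpa using this
  rcases (Metric.sphere (0 : EuclideanSpace ℝ ι) 1).eq_empty_or_nonempty with hs | hs
  · refine ⟨1, one_pos, fun x => ?_⟩
    have : x = 0 := by
      by_contra hx
      have : ‖x‖⁻¹ • x ∈ Metric.sphere (0 : EuclideanSpace ℝ ι) 1 := by
        simp [norm_smul, norm_ne_zero_iff.2 hx]
      simp [hs] at this
    simp [this]
  · obtain ⟨y, hy, hmin⟩ := (isCompact_sphere (0 : EuclideanSpace ℝ ι) 1).exists_isMinOn hs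
      (f := fun x => inner ℝ (Matrix.toEuclideanCLM (𝕜 := ℝ) A x) x) (by fun_prop)
    refine ⟨_, hpos y (by rintro rfl; simp at hy), fun x => ?_⟩
    by_cases hx : x = 0
    · simp [hx]
    have hx' : ‖x‖ ≠ 0 := norm_ne_zero_iff.2 hx
    have := hmin (a := ‖x‖⁻¹ • x) (by simp [norm_smul, hx'])
    simp only [Set.mem_ofPred_eq, map_smul, inner_smul_left, inner_smul_right] at this
    have h2 : 0 < ‖x‖ := norm_pos_iff.2 hx
    refine (mul_le_mul_of_nonneg_right this (sq_nonneg ‖x‖)).trans (le_of_eq ?_)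
    simp
    field_simp

/-- The multivariate Gaussian integral, by the substitution `x ↦ √J x`. -/
theorem lintegral_exp_neg_quadratic {J : Matrix ι ι ℝ} (hJ : J.PosDef) {c : ℝ} (hc : 0 < c) :
    ∫⁻ x : EuclideanSpace ℝ ι, ENNReal.ofReal
        (Real.exp (-(c / 2) * inner ℝ (Matrix.toEuclideanCLM (𝕜 := ℝ) J x) x)) =
      ENNReal.ofReal ((2 * Real.pi / c) ^ ((Fintype.card ι : ℝ) / 2) / √J.det) := by
  set B := CFC.sqrt J with hB
  have hBB : B * B = J := CFC.sqrt_mul_sqrt_self J hJ.posSemidef.nonneg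
  have hBh : B.IsHermitian := (Matrix.nonneg_iff_posSemidef.1 (CFC.sqrt_nonneg J)).isHermitian
  have hdet : B.det = √J.det := by simpa using hJ.posSemidef.det_sqrt
  have hdet0 : 0 < √J.det := Real.sqrt_pos.2 hJ.det_pos
  set f := Matrix.toEuclideanCLM (𝕜 := ℝ) B with hf
  have hquad : ∀ x, inner ℝ (Matrix.toEuclideanCLM (𝕜 := ℝ) J x) x = ‖f x‖ ^ 2 := by
    intro x
    rw [← real_inner_self_eq_norm_sq, hf, real_inner_comm, Matrix.inner_toEuclideanCLM,
      Matrix.inner_toEuclideanCLM, Matrix.ofLp_toEuclideanCLM, ← hBB, ← Matrix.mulVec_mulVec,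
      Matrix.dotProduct_mulVec, ← Matrix.mulVec_transpose]
    have : B.transpose = B := by simpa [Matrix.IsHermitian] using hBh
    rw [this]
  have hdetf : LinearMap.det (f : EuclideanSpace ℝ ι →ₗ[ℝ] EuclideanSpace ℝ ι) = √J.det := by
    rw [← hdet, hf, Matrix.coe_toEuclideanCLM_eq_toEuclideanLin, Matrix.toEuclideanLin_eq_toLin_orthonormal,
      LinearMap.det_toLin]
  have hmeas : Measurable fun x : EuclideanSpace ℝ ι => ENNReal.ofReal (Real.exp (-(c / 2) * ‖x‖ ^ 2)) := by
    fun_prop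
  have hgauss := GaussianFourier.integral_rexp_neg_mul_sq_norm (V := EuclideanSpace ℝ ι)
    (half_pos hc)
  have hint : Integrable fun x : EuclideanSpace ℝ ι => Real.exp (-(c / 2) * ‖x‖ ^ 2) := by
    by_contra h
    rw [integral_undef h] at hgauss
    have := Real.pi_pos
    exact (by positivity : 0 < (Real.pi / (c / 2)) ^
      (Module.finrank ℝ (EuclideanSpace ℝ ι) / 2 : ℝ)).ne hgauss
  simp_rw [hquad]
  rw [← lintegral_map (f := fun x : EuclideanSpace ℝ ι =>
    ENNReal.ofReal (Real.exp (-(c / 2) * ‖x‖ ^ 2))) (g := f) hmeas f.continuous.measurable]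
  have := Measure.map_linearMap_addHaar_eq_smul_addHaar
    (volume : Measure (EuclideanSpace ℝ ι)) (f := (f : EuclideanSpace ℝ ι →ₗ[ℝ] EuclideanSpace ℝ ι))
    (by rw [hdetf]; exact hdet0.ne')
  rw [hdetf] at this
  -- the two coercions of `f` to a function agree only definitionally
  erw [this]
  rw [lintegral_smul_measure, smul_eq_mul, abs_of_pos (inv_pos.2 hdet0),
    ← ofReal_integral_eq_lintegral_ofReal hint
      (Eventually.of_forall fun x => (Real.exp_pos _).le), hgauss,
    ← ENNReal.ofReal_mul (inv_pos.2 hdet0).le]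
  congr 1
  rw [finrank_euclideanSpace, show Real.pi / (c / 2) = 2 * Real.pi / c by field_simp,
    div_eq_inv_mul _ (√J.det)]

end Matrix

/-- Convexity of `exp`: a small change of the coefficient of the exponent costs a small multiple of
the exponential with the larger coefficient `1 + η`. -/
theorem exp_one_add_mul_le {y ε η : ℝ} (hη : 0 < η) (hε : 0 ≤ ε) (hεη : ε ≤ η) :
    Real.exp ((1 + ε) * y) ≤ Real.exp y + ε / η * Real.exp ((1 + η) * y) := by
  have h := convexOn_exp.2 (Set.mem_univ y) (Set.mem_univ ((1 + η) * y))
    (sub_nonneg.2 ((div_le_one hη).2 hεη)) (by positivity : 0 ≤ ε / η) (by ring)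
  simp only [smul_eq_mul] at h
  have e : (1 - ε / η) * y + ε / η * ((1 + η) * y) = (1 + ε) * y := by field_simp; ring
  rw [e] at h
  have : 0 ≤ ε / η * Real.exp y := by positivity
  linarith

theorem exp_le_exp_one_sub_mul_add {y ε η : ℝ} (hη : 0 < η) (hε : 0 ≤ ε) :
    Real.exp y ≤ Real.exp ((1 - ε) * y) + ε / η * Real.exp ((1 + η) * y) := by
  have h := convexOn_exp.2 (Set.mem_univ ((1 - ε) * y)) (Set.mem_univ ((1 + η) * y))
    (by positivity : 0 ≤ η / (η + ε)) (by positivity : 0 ≤ ε / (η + ε)) (by field_simp)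
  simp only [smul_eq_mul] at h
  have e : η / (η + ε) * ((1 - ε) * y) + ε / (η + ε) * ((1 + η) * y) = y := by field_simp; ring
  rw [e] at h
  refine h.trans (add_le_add ?_ ?_)
  · exact mul_le_of_le_one_left (Real.exp_pos _).le ((div_le_one (by positivity)).2 (by linarith))
  · gcongr; linarith

theorem continuous_quad {p q : ℕ} (A : Matrix (Fin p ⊕ Fin q) (Fin p ⊕ Fin q) ℝ) :
    Continuous (quad A) := by
  unfold quad
  fun_prop

section Prior
variable {p q : ℕ} {A : Matrix (Fin p ⊕ Fin q) (Fin p ⊕ Fin q) ℝ} {ρ : Measure (Full p q)}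
  [IsProbabilityMeasure ρ] {n : ℕ} {η C a : ℝ}
  (hη : 0 < η) (ha : 0 ≤ a) (hA : ∀ δ, a * ‖δ‖ ^ 2 ≤ quad A δ)
  (hC : ∫⁻ δ, ENNReal.ofReal (Real.exp (((1 + η) / 2) * (n * quad A δ))) ∂ρ ≤ ENNReal.ofReal C)

include hη ha hA hC

omit [IsProbabilityMeasure ρ] in
theorem ofReal_priorIntegral :
    ENNReal.ofReal (priorIntegral A ρ n) =
      ∫⁻ δ, ENNReal.ofReal (Real.exp ((1 / 2) * (n * quad A δ))) ∂ρ := by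
  have hq : ∀ δ, 0 ≤ n * quad A δ := fun δ =>
    mul_nonneg n.cast_nonneg ((by positivity : (0 : ℝ) ≤ a * ‖δ‖ ^ 2).trans (hA δ))
  have hcont := continuous_quad A
  unfold priorIntegral
  refine ofReal_integral_eq_lintegral_ofReal ⟨by fun_prop, ?_⟩
    (Eventually.of_forall fun δ => (Real.exp_pos _).le)
  rw [hasFiniteIntegral_iff_ofReal (Eventually.of_forall fun δ => (Real.exp_pos _).le)]
  refine lt_of_le_of_lt (lintegral_mono fun δ => ?_) (hC.trans_lt ENNReal.ofReal_lt_top)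
  refine ENNReal.ofReal_le_ofReal (Real.exp_le_exp.2 ?_)
  have := hq δ
  nlinarith

theorem one_le_priorIntegral : 1 ≤ priorIntegral A ρ n := by
  have hq : ∀ δ, 0 ≤ n * quad A δ := fun δ =>
    mul_nonneg n.cast_nonneg ((by positivity : (0 : ℝ) ≤ a * ‖δ‖ ^ 2).trans (hA δ))
  rw [← ENNReal.one_le_ofReal, ofReal_priorIntegral hη ha hA hC]
  calc (1 : ENNReal) = ∫⁻ _, 1 ∂ρ := by simp
    _ ≤ _ := by
      refine lintegral_mono fun δ => ?_
      rw [ENNReal.one_le_ofReal, Real.one_le_exp_iff]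
      have := hq δ
      positivity

theorem prior_const_nonneg : 0 ≤ C := by
  by_contra hneg
  have h1 := one_le_priorIntegral hη ha hA hC
  have h2 : ENNReal.ofReal (priorIntegral A ρ n) ≤ ENNReal.ofReal C := by
    rw [ofReal_priorIntegral hη ha hA hC]
    refine le_trans (lintegral_mono fun δ => ?_) hC
    refine ENNReal.ofReal_le_ofReal (Real.exp_le_exp.2 ?_)
    have : 0 ≤ n * quad A δ :=
      mul_nonneg n.cast_nonneg ((by positivity : (0 : ℝ) ≤ a * ‖δ‖ ^ 2).trans (hA δ))
    nlinarith
  rw [ENNReal.ofReal_of_nonpos (not_le.1 hneg).le, nonpos_iff_eq_zero, ENNReal.ofReal_eq_zero] at h2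
  linarith

/-- A relative increase `ε` of the exponent costs a factor `1 + O(ε)` of the prior integral. -/
theorem lintegral_prior_le {ε : ℝ} (hε : 0 ≤ ε) (hεη : ε ≤ η) :
    ∫⁻ δ, ENNReal.ofReal (Real.exp ((1 + ε) * ((1 / 2) * (n * quad A δ)))) ∂ρ ≤
      ENNReal.ofReal (priorIntegral A ρ n * (1 + ε / η * C)) := by
  have hC0 := prior_const_nonneg hη ha hA hC
  have h1 := one_le_priorIntegral hη ha hA hC
  have hcont := continuous_quad A
  calc _ ≤ ∫⁻ δ, (ENNReal.ofReal (Real.exp ((1 / 2) * (n * quad A δ))) + ENNReal.ofReal (ε / η) *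
          ENNReal.ofReal (Real.exp (((1 + η) / 2) * (n * quad A δ)))) ∂ρ := by
        refine lintegral_mono fun δ => ?_
        rw [← ENNReal.ofReal_mul (by positivity), ← ENNReal.ofReal_add (by positivity) (by positivity)]
        refine ENNReal.ofReal_le_ofReal ((exp_one_add_mul_le hη hε hεη).trans (le_of_eq ?_))
        congr 3; ring
    _ = ENNReal.ofReal (priorIntegral A ρ n) + ENNReal.ofReal (ε / η) *
          ∫⁻ δ, ENNReal.ofReal (Real.exp (((1 + η) / 2) * (n * quad A δ))) ∂ρ := by
        rw [lintegral_add_left (by fun_prop), lintegral_const_mul _ (by fun_prop),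
          ofReal_priorIntegral hη ha hA hC]
    _ ≤ ENNReal.ofReal (priorIntegral A ρ n) + ENNReal.ofReal (ε / η) * ENNReal.ofReal C := by
        gcongr
    _ = ENNReal.ofReal (priorIntegral A ρ n + ε / η * C) := by
        rw [← ENNReal.ofReal_mul (by positivity), ENNReal.ofReal_add (by positivity) (by positivity)]
    _ ≤ _ := by
        refine ENNReal.ofReal_le_ofReal ?_
        have : 0 ≤ ε / η * C := by positivity
        nlinarith

/-- A relative decrease `ε` of the exponent and the restriction to `‖δ‖ ≤ r` cost a factor
`1 - O(ε) - o(1)` of the prior integral, as `n r² → ∞`. -/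
theorem le_lintegral_prior {ε r : ℝ} (hε : 0 ≤ ε) (hr : 0 ≤ r) :
    ENNReal.ofReal (priorIntegral A ρ n *
        (1 - (ε / η + Real.exp (-(η / 2 * (a * (n * r ^ 2))))) * C)) ≤
      ∫⁻ δ, {δ : Full p q | ‖δ‖ ≤ r}.indicator (fun δ =>
        ENNReal.ofReal (Real.exp ((1 - ε) * ((1 / 2) * (n * quad A δ))))) δ ∂ρ := by
  have hC0 := prior_const_nonneg hη ha hA hC
  have h1 := one_le_priorIntegral hη ha hA hC
  have hcont := continuous_quad A
  set k := ε / η + Real.exp (-(η / 2 * (a * (n * r ^ 2)))) with hk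
  have hk0 : 0 ≤ k := by positivity
  have hpt : ∀ δ, ENNReal.ofReal (Real.exp ((1 / 2) * (n * quad A δ))) ≤
      {δ : Full p q | ‖δ‖ ≤ r}.indicator (fun δ =>
        ENNReal.ofReal (Real.exp ((1 - ε) * ((1 / 2) * (n * quad A δ))))) δ +
      ENNReal.ofReal k * ENNReal.ofReal (Real.exp (((1 + η) / 2) * (n * quad A δ))) := by
    intro δ
    have e : ((1 + η) / 2) * (n * quad A δ) = (1 + η) * ((1 / 2) * (n * quad A δ)) := by ring
    rw [← ENNReal.ofReal_mul hk0, e]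
    set y := (1 / 2) * (n * quad A δ) with hy
    by_cases hδ : ‖δ‖ ≤ r
    · rw [Set.indicator_of_mem (by exact hδ), ← ENNReal.ofReal_add (by positivity) (by positivity)]
      refine ENNReal.ofReal_le_ofReal ((exp_le_exp_one_sub_mul_add hη hε).trans ?_)
      gcongr
      rw [hk]; linarith [Real.exp_pos (-(η / 2 * (a * (n * r ^ 2))))]
    · rw [Set.indicator_of_notMem (by exact hδ), zero_add]
      refine ENNReal.ofReal_le_ofReal ?_
      calc Real.exp y ≤ Real.exp (-(η / 2 * (a * (n * r ^ 2)))) * Real.exp ((1 + η) * y) := by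
            rw [← Real.exp_add, Real.exp_le_exp]
            have h2 : a * r ^ 2 ≤ quad A δ := by
              refine le_trans ?_ (hA δ)
              have := (not_le.1 hδ).le
              gcongr
            have h3 : η * ((1 / 2) * (n * (a * r ^ 2))) ≤ η * y := by rw [hy]; gcongr
            linarith
        _ ≤ k * Real.exp ((1 + η) * y) := by
            gcongr
            rw [hk]
            have : 0 ≤ ε / η := by positivity
            linarith
  have h2 : ENNReal.ofReal (priorIntegral A ρ n) ≤ (∫⁻ δ, {δ : Full p q | ‖δ‖ ≤ r}.indicator (fun δ =>
        ENNReal.ofReal (Real.exp ((1 - ε) * ((1 / 2) * (n * quad A δ))))) δ ∂ρ) +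
        ENNReal.ofReal (k * C) := by
    rw [ofReal_priorIntegral hη ha hA hC]
    refine (lintegral_mono hpt).trans ?_
    rw [lintegral_add_right _ (by fun_prop), lintegral_const_mul _ (by fun_prop),
      ENNReal.ofReal_mul hk0]
    gcongr
  calc _ ≤ ENNReal.ofReal (priorIntegral A ρ n - k * C) := by
        refine ENNReal.ofReal_le_ofReal ?_
        have : 0 ≤ k * C := by positivity
        nlinarith
    _ = ENNReal.ofReal (priorIntegral A ρ n) - ENNReal.ofReal (k * C) :=
        ENNReal.ofReal_sub _ (by positivity)
    _ ≤ _ := tsub_le_iff_right.2 h2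

end Prior

/-- Most of the mass of a concentrated Gaussian integral lies within `r` of its centre. -/
theorem le_lintegral_gauss_window {p : ℕ} {J : Matrix (Fin p) (Fin p) ℝ} (hJ : J.PosDef) {a c r : ℝ}
    (hc : 0 < c) (ha : 0 ≤ a) (hr : 0 ≤ r)
    (hA : ∀ t, a * ‖t‖ ^ 2 ≤ inner ℝ (Matrix.toEuclideanCLM (𝕜 := ℝ) J t) t) (z : Par p) :
    ENNReal.ofReal ((2 * Real.pi / c) ^ ((p : ℝ) / 2) / √J.det *
        (1 - 2 ^ ((p : ℝ) / 2) * Real.exp (-(c / 4 * (a * r ^ 2))))) ≤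
      ∫⁻ t : Par p, {t : Par p | ‖t - z‖ ≤ r}.indicator (fun t => ENNReal.ofReal
        (Real.exp (-(c / 2) * inner ℝ (Matrix.toEuclideanCLM (𝕜 := ℝ) J (t - z)) (t - z)))) t := by
  set N := (2 * Real.pi / c) ^ ((p : ℝ) / 2) / √J.det with hN
  have hdet0 : 0 < √J.det := Real.sqrt_pos.2 hJ.det_pos
  have hpi := Real.pi_pos
  have hN0 : 0 ≤ N := by positivity
  set Q : Par p → ℝ := fun t => inner ℝ (Matrix.toEuclideanCLM (𝕜 := ℝ) J t) t with hQ
  have hQc : Continuous Q := by rw [hQ]; fun_prop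
  have htrans : ∀ c : ℝ, 0 < c → ∫⁻ t : Par p, ENNReal.ofReal (Real.exp (-(c / 2) * Q (t - z))) =
      ENNReal.ofReal ((2 * Real.pi / c) ^ ((p : ℝ) / 2) / √J.det) := by
    intro c hc
    rw [lintegral_sub_right_eq_self (fun t => ENNReal.ofReal (Real.exp (-(c / 2) * Q t))) z,
      lintegral_exp_neg_quadratic hJ hc, Fintype.card_fin]
  set k := Real.exp (-(c / 4 * (a * r ^ 2))) with hk
  have hpt : ∀ t : Par p, ENNReal.ofReal (Real.exp (-(c / 2) * Q (t - z))) ≤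
      {t : Par p | ‖t - z‖ ≤ r}.indicator
        (fun t => ENNReal.ofReal (Real.exp (-(c / 2) * Q (t - z)))) t +
      ENNReal.ofReal k * ENNReal.ofReal (Real.exp (-(c / 2 / 2) * Q (t - z))) := by
    intro t
    by_cases ht : ‖t - z‖ ≤ r
    · rw [Set.indicator_of_mem (by exact ht)]; exact le_self_add
    · rw [Set.indicator_of_notMem (by exact ht), zero_add, ← ENNReal.ofReal_mul (Real.exp_pos _).le,
        ← Real.exp_add]
      refine ENNReal.ofReal_le_ofReal (Real.exp_le_exp.2 ?_)
      have h2 : a * r ^ 2 ≤ Q (t - z) := by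
        refine le_trans ?_ (hA _)
        have := (not_le.1 ht).le
        gcongr
      have h3 : c / 4 * (a * r ^ 2) ≤ c / 4 * Q (t - z) := by gcongr
      linarith
  have h2 : ENNReal.ofReal N ≤ (∫⁻ t : Par p, {t : Par p | ‖t - z‖ ≤ r}.indicator
        (fun t => ENNReal.ofReal (Real.exp (-(c / 2) * Q (t - z)))) t) +
        ENNReal.ofReal (k * (N * 2 ^ ((p : ℝ) / 2))) := by
    rw [← htrans c hc]
    refine (lintegral_mono hpt).trans ?_
    rw [lintegral_add_right _ (by fun_prop), lintegral_const_mul _ (by fun_prop),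
      ENNReal.ofReal_mul (Real.exp_pos _).le, htrans (c / 2) (by positivity)]
    gcongr
    rw [hN, show 2 * Real.pi / (c / 2) = 2 * Real.pi / c * 2 by field_simp,
      Real.mul_rpow (by positivity) (by positivity)]
    exact le_of_eq (by ring)
  calc _ = ENNReal.ofReal (N - k * (N * 2 ^ ((p : ℝ) / 2))) := by congr 1; ring
    _ = ENNReal.ofReal N - ENNReal.ofReal (k * (N * 2 ^ ((p : ℝ) / 2))) :=
        ENNReal.ofReal_sub _ (by positivity)
    _ ≤ _ := tsub_le_iff_right.2 h2

/-! ### Two-sided bounds on the window integral -/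

/-- The relative error of the upper bound on the window integral, where `κ` is the relative error
of the exponent. -/
noncomputable def upperFactor (p : ℕ) (η C κ : ℝ) : ℝ :=
  Real.exp κ * (1 - 2 * κ) ^ (-((p : ℝ) / 2)) * (1 + 2 * κ / η * C)

/-- The relative error of the lower bound on the window integral, where `κ` is the relative error
of the exponent and `m = n r²` is the squared radius of the window at the scale `n^(-1/2)`. -/
noncomputable def lowerFactor (p : ℕ) (a η C κ m : ℝ) : ℝ :=
  Real.exp (-κ) * (1 + 2 * κ) ^ (-((p : ℝ) / 2)) *
    (1 - 2 ^ ((p : ℝ) / 2) * Real.exp (-((1 + 2 * κ) / 4 * (a * m)))) *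
    (1 - (2 * κ / η + Real.exp (-(η / 2 * (a * m)))) * C)

/-- Both relative errors are within `exp (± ε)` for a suitable `κ` and large windows. -/
theorem exists_factors (p : ℕ) {a η C ε : ℝ} (ha : 0 < a) (hη : 0 < η) (hε : 0 < ε) :
    ∃ κ > 0, 2 * κ ≤ η ∧ 2 * κ < 1 ∧ upperFactor p η C κ ≤ Real.exp ε ∧
      ∀ᶠ m in atTop, 2 ^ ((p : ℝ) / 2) * Real.exp (-((1 + 2 * κ) / 4 * (a * m))) ≤ 1 ∧
        Real.exp (-ε) ≤ lowerFactor p a η C κ m := by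
  have hU : ContinuousAt (upperFactor p η C) 0 := by
    unfold upperFactor
    refine ContinuousAt.mul (ContinuousAt.mul (by fun_prop) ?_) (by fun_prop)
    exact ContinuousAt.rpow_const (by fun_prop) (Or.inl (by norm_num))
  have hV : ContinuousAt (fun κ : ℝ => Real.exp (-κ) * (1 + 2 * κ) ^ (-((p : ℝ) / 2)) *
      (1 - 2 ^ ((p : ℝ) / 2) * 0) * (1 - (2 * κ / η + 0) * C)) 0 := by
    refine ContinuousAt.mul (ContinuousAt.mul (ContinuousAt.mul (by fun_prop) ?_) (by fun_prop))
      (by fun_prop)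
    exact ContinuousAt.rpow_const (by fun_prop) (Or.inl (by norm_num))
  have h1 : ∀ᶠ κ in 𝓝[>] (0 : ℝ), upperFactor p η C κ < Real.exp ε := by
    refine nhdsWithin_le_nhds (hU.eventually_lt continuousAt_const ?_)
    simp [upperFactor, hε]
  have h2 : ∀ᶠ κ in 𝓝[>] (0 : ℝ), Real.exp (-ε) < Real.exp (-κ) * (1 + 2 * κ) ^ (-((p : ℝ) / 2)) *
      (1 - 2 ^ ((p : ℝ) / 2) * 0) * (1 - (2 * κ / η + 0) * C) := by
    refine nhdsWithin_le_nhds (continuousAt_const.eventually_lt hV ?_)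
    simp [hε]
  have h3 : ∀ᶠ κ in 𝓝[>] (0 : ℝ), κ < min (η / 2) (1 / 2) :=
    nhdsWithin_le_nhds (Iio_mem_nhds (by positivity))
  obtain ⟨κ, ⟨⟨hκ1, hκ2⟩, hκ3⟩, hκ⟩ := (((h1.and h2).and h3).and self_mem_nhdsWithin).exists
  have hκ0 : 0 < κ := hκ
  have hκ4 := hκ3.trans_le (min_le_left _ _)
  have hκ5 := hκ3.trans_le (min_le_right _ _)
  refine ⟨κ, hκ, by linarith, by linarith, hκ1.le, ?_⟩
  have hexp : ∀ b > 0, Tendsto (fun m : ℝ => Real.exp (-(b * (a * m)))) atTop (𝓝 0) := by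
    intro b hb
    refine Real.tendsto_exp_neg_atTop_nhds_zero.comp ?_
    exact (tendsto_id.const_mul_atTop ha).const_mul_atTop hb
  have t1 := hexp ((1 + 2 * κ) / 4) (by positivity)
  have t2 := hexp (η / 2) (by positivity)
  have t3 : Tendsto (fun m => lowerFactor p a η C κ m) atTop
      (𝓝 (Real.exp (-κ) * (1 + 2 * κ) ^ (-((p : ℝ) / 2)) *
      (1 - 2 ^ ((p : ℝ) / 2) * 0) * (1 - (2 * κ / η + 0) * C))) := by
    unfold lowerFactor
    exact (tendsto_const_nhds.mul (tendsto_const_nhds.sub (t1.const_mul _))).mul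
      (tendsto_const_nhds.sub ((tendsto_const_nhds.add t2).mul_const _))
  have t4 := t1.const_mul ((2 : ℝ) ^ ((p : ℝ) / 2))
  rw [mul_zero] at t4
  filter_upwards [t3.eventually_const_lt hκ2, t4.eventually_lt_const one_pos] with m hm1 hm2
  exact ⟨hm2.le, hm1.le⟩

section Sandwich
variable {𝒟 : Type*} {p q : ℕ} {g : 𝒟 → Full p q → Full p q}
  {A : Matrix (Fin p ⊕ Fin q) (Fin p ⊕ Fin q) ℝ} {J : Matrix (Fin p) (Fin p) ℝ}
  {ρ : Measure (Full p q)} [IsProbabilityMeasure ρ] {n : ℕ} {x : ℕ → 𝒟} {c : Par p}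
  {η C a r R κ : ℝ}

/-- The leading term of the Laplace approximation, where `R` is the empirical likelihood ratio at
the plug-in estimator. -/
noncomputable def laplaceTerm (J : Matrix (Fin p) (Fin p) ℝ)
    (A : Matrix (Fin p ⊕ Fin q) (Fin p ⊕ Fin q) ℝ) (ρ : Measure (Full p q)) (n : ℕ) (R : ℝ) : ℝ :=
  R * ((2 * Real.pi / n) ^ ((p : ℝ) / 2) / √J.det) * priorIntegral A ρ n

omit [IsProbabilityMeasure ρ] in
theorem laplaceTerm_nonneg (hR : 0 ≤ R) : 0 ≤ laplaceTerm J A ρ n R := by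
  have := Real.pi_pos
  have : 0 ≤ priorIntegral A ρ n := integral_nonneg fun δ => (Real.exp_pos _).le
  unfold laplaceTerm
  positivity

theorem two_pi_div_rpow {b : ℝ} (hb : 0 < b) (n : ℕ) (s : ℝ) :
    (2 * Real.pi / (b * n)) ^ s = (2 * Real.pi / n) ^ s * b ^ (-s) := by
  have := Real.pi_pos
  rw [Real.rpow_neg hb.le, ← Real.inv_rpow hb.le, ← Real.mul_rpow (by positivity) (by positivity)]
  congr 1
  rw [mul_comm b, div_mul_eq_div_div, div_eq_mul_inv _ b]

theorem laplaceTerm_le_marginal (hJ : J.PosDef) (hη : 0 < η) (ha : 0 ≤ a) (hR : 0 ≤ R)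
    (hn : 0 < n) (hr : 0 ≤ r) (hκ : 0 ≤ κ)
    (hA : ∀ δ, a * ‖δ‖ ^ 2 ≤ quad A δ)
    (hJa : ∀ t, a * ‖t‖ ^ 2 ≤ inner ℝ (Matrix.toEuclideanCLM (𝕜 := ℝ) J t) t)
    (hC : ∫⁻ δ, ENNReal.ofReal (Real.exp (((1 + η) / 2) * (n * quad A δ))) ∂ρ ≤ ENNReal.ofReal C)
    (hm : 2 ^ ((p : ℝ) / 2) * Real.exp (-((1 + 2 * κ) / 4 * (a * (n * r ^ 2)))) ≤ 1)
    (hlow : ∀ γ δ, ‖γ - c‖ ≤ r → ‖δ‖ ≤ r →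
      R * Real.exp (-(n * inner ℝ (Matrix.toEuclideanCLM (𝕜 := ℝ) J (γ - c)) (γ - c) / 2)
        + n * quad A δ / 2
        - κ * (1 + n * inner ℝ (Matrix.toEuclideanCLM (𝕜 := ℝ) J (γ - c)) (γ - c) + n * quad A δ))
        ≤ lik g n x γ δ) :
    ENNReal.ofReal (laplaceTerm J A ρ n R * lowerFactor p a η C κ (n * r ^ 2)) ≤
      marginal g ρ n x (window c r) := by
  have hn' : (0 : ℝ) < n := by exact_mod_cast hn
  have hpi := Real.pi_pos
  have hdet0 : 0 < √J.det := Real.sqrt_pos.2 hJ.det_pos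
  set G : Par p → ℝ := fun t => inner ℝ (Matrix.toEuclideanCLM (𝕜 := ℝ) J t) t with hG
  have hGc : Continuous G := by rw [hG]; fun_prop
  have hQc := continuous_quad A
  have h1 := le_lintegral_gauss_window hJ (c := (1 + 2 * κ) * n) (by positivity) ha hr hJa c
  have h2 := le_lintegral_prior hη ha hA hC (ε := 2 * κ) (by positivity) hr
  have hpt : ∀ γ δ, ENNReal.ofReal (R * Real.exp (-κ)) *
      ({t : Par p | ‖t - c‖ ≤ r}.indicator (fun t => ENNReal.ofReal
        (Real.exp (-((1 + 2 * κ) * n / 2) * G (t - c)))) γ) *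
      ({δ : Full p q | ‖δ‖ ≤ r}.indicator (fun δ =>
        ENNReal.ofReal (Real.exp ((1 - 2 * κ) * ((1 / 2) * (n * quad A δ))))) δ) ≤
      (window c r).indicator (fun z => ENNReal.ofReal (lik g n x z.1 z.2)) (γ, δ) := by
    intro γ δ
    by_cases hγ : ‖γ - c‖ ≤ r
    · by_cases hδ : ‖δ‖ ≤ r
      · rw [Set.indicator_of_mem (by exact hγ), Set.indicator_of_mem (by exact hδ),
          Set.indicator_of_mem (by exact ⟨hγ, hδ⟩), ← ENNReal.ofReal_mul (by positivity),
          ← ENNReal.ofReal_mul (by positivity)]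
        refine ENNReal.ofReal_le_ofReal (le_trans (le_of_eq ?_) (hlow γ δ hγ hδ))
        rw [mul_assoc, mul_assoc, ← Real.exp_add, ← Real.exp_add]
        congr 2
        ring
      · rw [Set.indicator_of_notMem (s := {δ : Full p q | ‖δ‖ ≤ r}) (by exact hδ), mul_zero]
        exact zero_le
    · rw [Set.indicator_of_notMem (by exact hγ), mul_zero, zero_mul]
      exact zero_le
  refine le_trans ?_ (lintegral_mono fun γ => lintegral_mono fun δ => hpt γ δ)
  have hm1 : Measurable ({δ : Full p q | ‖δ‖ ≤ r}.indicator (fun δ =>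
        ENNReal.ofReal (Real.exp ((1 - 2 * κ) * ((1 / 2) * (n * quad A δ)))))) :=
    Measurable.indicator (by fun_prop) (measurableSet_le (by fun_prop) (by fun_prop))
  have hm2 : Measurable ({t : Par p | ‖t - c‖ ≤ r}.indicator (fun t => ENNReal.ofReal
        (Real.exp (-((1 + 2 * κ) * n / 2) * G (t - c))))) :=
    Measurable.indicator (by fun_prop) (measurableSet_le (by fun_prop) (by fun_prop))
  simp_rw [lintegral_const_mul _ hm1]
  rw [lintegral_mul_const _ (hm2.const_mul _), lintegral_const_mul _ hm2]
  refine le_trans (le_of_eq ?_) (mul_le_mul' (mul_le_mul' le_rfl h1) h2)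
  rw [← ENNReal.ofReal_mul (by positivity), ← ENNReal.ofReal_mul]
  · rw [two_pi_div_rpow (by positivity)]
    unfold laplaceTerm lowerFactor
    congr 1
    rw [show (1 + 2 * κ) * n / 4 * (a * r ^ 2) = (1 + 2 * κ) / 4 * (a * (n * r ^ 2)) by ring]
    ring
  · refine mul_nonneg (by positivity) (mul_nonneg (by positivity) (sub_nonneg.2 ?_))
    rwa [show (1 + 2 * κ) * n / 4 * (a * r ^ 2) = (1 + 2 * κ) / 4 * (a * (n * r ^ 2)) by ring]

/-- The upper bound comes with a measurable majorant of the inner integral, because the inner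
integral itself need not depend measurably on `γ`. -/
theorem exists_majorant_marginal (hJ : J.PosDef) (hη : 0 < η) (ha : 0 ≤ a) (hR : 0 ≤ R)
    (hn : 0 < n) (hκ : 0 ≤ κ) (hκη : 2 * κ ≤ η) (hκ1 : 2 * κ < 1)
    (hA : ∀ δ, a * ‖δ‖ ^ 2 ≤ quad A δ)
    (hC : ∫⁻ δ, ENNReal.ofReal (Real.exp (((1 + η) / 2) * (n * quad A δ))) ∂ρ ≤ ENNReal.ofReal C)
    (hup : ∀ γ δ, ‖γ - c‖ ≤ r → ‖δ‖ ≤ r → lik g n x γ δ ≤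
      R * Real.exp (-(n * inner ℝ (Matrix.toEuclideanCLM (𝕜 := ℝ) J (γ - c)) (γ - c) / 2)
        + n * quad A δ / 2
        + κ * (1 + n * inner ℝ (Matrix.toEuclideanCLM (𝕜 := ℝ) J (γ - c)) (γ - c) + n * quad A δ))) :
    ∃ F : Par p → ENNReal, Measurable F ∧
      (∀ γ, ∫⁻ δ, (window c r).indicator (fun z => ENNReal.ofReal (lik g n x z.1 z.2)) (γ, δ) ∂ρ
        ≤ F γ) ∧
      ∫⁻ γ, F γ ≤ ENNReal.ofReal (laplaceTerm J A ρ n R * upperFactor p η C κ) := by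
  have hn' : (0 : ℝ) < n := by exact_mod_cast hn
  have hpi := Real.pi_pos
  have hdet0 : 0 < √J.det := Real.sqrt_pos.2 hJ.det_pos
  set G : Par p → ℝ := fun t => inner ℝ (Matrix.toEuclideanCLM (𝕜 := ℝ) J t) t with hG
  have hGc : Continuous G := by rw [hG]; fun_prop
  have hQc := continuous_quad A
  have hκ2 : 0 < 1 - 2 * κ := by linarith
  have h2 := lintegral_prior_le hη ha hA hC (ε := 2 * κ) (by positivity) hκη
  refine ⟨fun γ => ENNReal.ofReal (R * Real.exp κ) * ENNReal.ofReal
    (Real.exp (-((1 - 2 * κ) * n / 2) * G (γ - c))) *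
    ENNReal.ofReal (priorIntegral A ρ n * (1 + 2 * κ / η * C)), by fun_prop, fun γ => ?_, ?_⟩
  · refine le_trans ?_ (mul_le_mul' le_rfl h2)
    rw [← lintegral_const_mul _ (by fun_prop)]
    refine lintegral_mono fun δ => ?_
    by_cases hz : (γ, δ) ∈ window c r
    · rw [Set.indicator_of_mem hz, ← ENNReal.ofReal_mul (by positivity),
        ← ENNReal.ofReal_mul (by positivity)]
      refine ENNReal.ofReal_le_ofReal ((hup γ δ hz.1 hz.2).trans (le_of_eq ?_))
      rw [mul_assoc, mul_assoc, ← Real.exp_add, ← Real.exp_add]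
      congr 2
      ring
    · rw [Set.indicator_of_notMem hz]
      exact zero_le
  · rw [lintegral_mul_const _ (by fun_prop), lintegral_const_mul _ (by fun_prop),
      lintegral_sub_right_eq_self
        (fun t => ENNReal.ofReal (Real.exp (-((1 - 2 * κ) * n / 2) * G t))) c,
      lintegral_exp_neg_quadratic hJ (by positivity), Fintype.card_fin,
      ← ENNReal.ofReal_mul (by positivity), ← ENNReal.ofReal_mul (by positivity),
      two_pi_div_rpow hκ2]
    unfold laplaceTerm upperFactor
    refine le_of_eq ?_
    congr 1
    ring

end Sandwich

/-! ### The likelihood on the window -/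

section Pad
variable {p q : ℕ}

@[simp] theorem pad_inl (γ : Par p) (i : Fin p) : pad (q := q) γ (Sum.inl i) = γ i := rfl

@[simp] theorem pad_inr (γ : Par p) (i : Fin q) : pad (q := q) γ (Sum.inr i) = 0 := rfl

theorem norm_pad (γ : Par p) : ‖pad (q := q) γ‖ = ‖γ‖ := by
  simp [EuclideanSpace.norm_eq]

theorem quad_eq_inner (S : Matrix (Fin p ⊕ Fin q) (Fin p ⊕ Fin q) ℝ) (δ : Full p q) :
    quad S δ = inner ℝ (Matrix.toEuclideanCLM (𝕜 := ℝ) S δ) δ := by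
  rw [real_inner_comm, Matrix.inner_toEuclideanCLM]
  simp only [quad, dotProduct, Matrix.mulVec, Finset.mul_sum, mul_assoc]

theorem inner_toEuclideanCLM_pad (S : Matrix (Fin p ⊕ Fin q) (Fin p ⊕ Fin q) ℝ) (t : Par p) :
    inner ℝ (Matrix.toEuclideanCLM (𝕜 := ℝ) S (pad t)) (pad t) =
      inner ℝ (Matrix.toEuclideanCLM (𝕜 := ℝ) S.toBlocks₁₁ t) t := by
  rw [real_inner_comm, Matrix.inner_toEuclideanCLM, real_inner_comm, Matrix.inner_toEuclideanCLM]
  simp [dotProduct, Matrix.mulVec, Matrix.toBlocks₁₁]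

theorem inner_toEuclideanCLM_comm {ι : Type*} [Fintype ι] [DecidableEq ι] {S : Matrix ι ι ℝ}
    (hS : S.IsHermitian) (l w : EuclideanSpace ℝ ι) :
    inner ℝ (Matrix.toEuclideanCLM (𝕜 := ℝ) S l) w =
      inner ℝ (Matrix.toEuclideanCLM (𝕜 := ℝ) S w) l := by
  rw [real_inner_comm, Matrix.inner_toEuclideanCLM, real_inner_comm, Matrix.inner_toEuclideanCLM,
    Matrix.dotProduct_mulVec, dotProduct_comm, ← Matrix.mulVec_transpose]
  have : S.transpose = S := by simpa [Matrix.IsHermitian] using hS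
  rw [this]

end Pad

section Lik
variable {𝒟 : Type*} {p q : ℕ} {g : 𝒟 → Full p q → Full p q} {n : ℕ} {x : ℕ → 𝒟}

theorem isMult_multiplier {γ : Par p} (h : ∃ l, IsMult n (fun i => gM g (x i) γ) l) :
    IsMult n (fun i => gM g (x i) γ) (multiplier g n x γ) := by
  have h' : ∃ l, IsMultiplier g n x γ l := h
  unfold multiplier
  rw [dif_pos h']
  exact h'.choose_spec

theorem elRatio_eq_exp {γ : Par p} {l : Full p q}
    (h : ∀ i < n, 0 < 1 + inner ℝ l (gM g (x i) γ)) :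
    elRatio g n x l γ = Real.exp (-logEL n (fun i => gM g (x i) γ) l) := by
  unfold elRatio
  rw [if_pos (by exact h), logEL, ← Finset.sum_neg_distrib, Real.exp_sum]
  refine Finset.prod_congr rfl fun i hi => ?_
  rw [Real.exp_neg, Real.exp_log (h i (Finset.mem_range.1 hi))]
  rfl

theorem measurable_lik (γ : Par p) : Measurable (lik g n x γ) := by
  unfold lik
  split_ifs with h
  · unfold elRatio
    refine Measurable.ite ?_ ?_ measurable_const
    · have : {δ : Full p q | ∀ i < n, 0 < factor g (x i) (multiplier g n x γ + δ) γ} =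
          ⋂ i, ⋂ (_ : i < n), {δ | 0 < factor g (x i) (multiplier g n x γ + δ) γ} := by
        ext; simp
      rw [this]
      refine MeasurableSet.iInter fun i => MeasurableSet.iInter fun _ =>
        measurableSet_lt measurable_const ?_
      unfold factor; fun_prop
    · refine Finset.measurable_prod _ fun i _ => Measurable.inv ?_
      unfold factor; fun_prop
  · exact measurable_const

/-- The sample `x 0, …, x (n - 1)` behaves on the window of radius `r` around the root `c` of the
estimating equations `g₁` like its law: `A` is the second-moment operator of the estimating
function, and `-A ∘ pad` is its Jacobian. -/
structure GoodSample (g : 𝒟 → Full p q → Full p q) (A : Full p q →L[ℝ] Full p q) (n : ℕ)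
    (x : ℕ → 𝒟) (c : Par p) (r κ M : ℝ) : Prop where
  second_moment : ∀ γ, ‖γ - c‖ ≤ r → ∀ l w, |∑ i ∈ Finset.range n,
    (inner ℝ l (gM g (x i) γ) * inner ℝ w (gM g (x i) γ) : ℝ) - n * inner ℝ (A l) w|
      ≤ n * κ * (‖l‖ * ‖w‖)
  norm_le : ∀ γ, ‖γ - c‖ ≤ r → ∀ i < n, r * ‖gM g (x i) γ‖ ≤ κ
  increment : ∀ γ, ‖γ - c‖ ≤ r → ‖∑ i ∈ Finset.range n, gM g (x i) γ -
    ∑ i ∈ Finset.range n, gM g (x i) c + (n : ℝ) • A (pad (γ - c))‖ ≤ n * (κ * ‖γ - c‖)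
  norm_sum_le : ‖∑ i ∈ Finset.range n, gM g (x i) c‖ ≤ √n * M
  root : ∀ j : Fin p, ∑ i ∈ Finset.range n, gM g (x i) c (Sum.inl j) = 0

variable {A : Full p q →L[ℝ] Full p q} {c : Par p} {r κ M a : ℝ}

theorem GoodSample.nearQuadratic (h : GoodSample g A n x c r κ M) (hκ : κ ≤ 1)
    (hM : M ≤ √n * r) {γ : Par p} (hγ : ‖γ - c‖ ≤ r) :
    NearQuadratic A n (fun i => gM g (x i) γ) r κ (‖A‖ + 2) where
  second_moment := h.second_moment γ hγ
  norm_le := h.norm_le γ hγ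
  norm_sum_le := by
    have h1 := h.increment γ hγ
    have h2 := h.norm_sum_le
    have h3 : √n * M ≤ n * r := by
      calc √n * M ≤ √n * (√n * r) := by gcongr
        _ = n * r := by rw [← mul_assoc, Real.mul_self_sqrt n.cast_nonneg]
    have h4 : ‖(n : ℝ) • A (pad (γ - c))‖ ≤ n * (‖A‖ * r) := by
      rw [norm_smul, Real.norm_natCast]
      gcongr
      refine (A.le_opNorm _).trans ?_
      rw [norm_pad]
      gcongr
    have h5 : n * (κ * ‖γ - c‖) ≤ n * (1 * r) := by gcongr
    have e : ∑ i ∈ Finset.range n, gM g (x i) γ = (∑ i ∈ Finset.range n, gM g (x i) γ -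
        ∑ i ∈ Finset.range n, gM g (x i) c + (n : ℝ) • A (pad (γ - c))) +
        ∑ i ∈ Finset.range n, gM g (x i) c - (n : ℝ) • A (pad (γ - c)) := by abel
    rw [e]
    refine (norm_sub_le _ _).trans ((add_le_add (norm_add_le _ _) le_rfl).trans ?_)
    linarith

/-- The mean at the plug-in estimator has vanishing `g₁` part. -/
theorem GoodSample.inner_pad (h : GoodSample g A n x c r κ M) (t : Par p) :
    inner ℝ (∑ i ∈ Finset.range n, gM g (x i) c) (pad t) = (0 : ℝ) := by
  rw [PiLp.inner_apply]
  simp [h.root]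

/-- The error terms are bounded by the quadratic forms, up to a constant for the plug-in mean. -/
theorem sq_norms_le {E : Type*} [NormedAddCommGroup E] [InnerProductSpace ℝ E] {A : E →L[ℝ] E}
    (hA : ∀ l, a * ‖l‖ ^ 2 ≤ inner ℝ (A l) l) (ha : 0 < a) (hn : 0 < n) {T : E}
    (hT : ‖T‖ ≤ √n * M) (u δ : E) :
    n * ((‖T‖ / n) ^ 2 + ‖u‖ ^ 2 + ‖δ‖ ^ 2) ≤
      (M ^ 2 + 1 / a) * (1 + n * inner ℝ (A u) u + n * inner ℝ (A δ) δ) := by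
  have hn' : (0 : ℝ) < n := by exact_mod_cast hn
  have h1 : n * (‖T‖ / n) ^ 2 ≤ M ^ 2 := by
    have h2 : ‖T‖ ^ 2 ≤ (√n * M) ^ 2 := by gcongr
    rw [mul_pow, Real.sq_sqrt hn'.le] at h2
    have e : n * (‖T‖ / n) ^ 2 = ‖T‖ ^ 2 / n := by field_simp
    rw [e, div_le_iff₀ hn']
    linarith
  have h2 : ∀ w : E, n * ‖w‖ ^ 2 ≤ 1 / a * (n * inner ℝ (A w) w) := by
    intro w
    rw [div_mul_eq_mul_div, one_mul, le_div_iff₀ ha]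
    calc n * ‖w‖ ^ 2 * a = n * (a * ‖w‖ ^ 2) := by ring
      _ ≤ _ := by gcongr; exact hA w
  have h3 : ∀ w : E, 0 ≤ n * inner ℝ (A w) w := fun w =>
    mul_nonneg hn'.le ((by positivity : 0 ≤ a * ‖w‖ ^ 2).trans (hA w))
  have h4 := h2 u
  have h5 := h2 δ
  have h6 := mul_nonneg (sq_nonneg M) (h3 u)
  have h7 := mul_nonneg (sq_nonneg M) (h3 δ)
  have h8 : 0 < 1 / a := by positivity
  linarith

/-- The likelihood on the window is a Gaussian in `γ` times an exponential of a quadratic form in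
the deviation `δ`, up to a relative error of the exponent. -/
theorem exists_lik_bounds (ha : 0 < a) (hA : ∀ l, a * ‖l‖ ^ 2 ≤ inner ℝ (A l) l)
    (hsymm : ∀ l w, inner ℝ (A l) w = inner ℝ (A w) l) (M : ℝ) {κ' : ℝ} (hκ' : 0 < κ') :
    ∃ κ > 0, ∀ (n : ℕ) (x : ℕ → 𝒟) (c : Par p) (r : ℝ), 0 < n → 0 < r → M ≤ √n * r →
      GoodSample g A n x c r κ M →
      0 < elRatio g n x (multiplier g n x c) c ∧ ∀ γ δ, ‖γ - c‖ ≤ r → ‖δ‖ ≤ r →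
        elRatio g n x (multiplier g n x c) c *
          Real.exp (-(n * inner ℝ (A (pad (γ - c))) (pad (γ - c)) / 2) + n * inner ℝ (A δ) δ / 2
            - κ' * (1 + n * inner ℝ (A (pad (γ - c))) (pad (γ - c)) + n * inner ℝ (A δ) δ))
          ≤ lik g n x γ δ ∧
        lik g n x γ δ ≤ elRatio g n x (multiplier g n x c) c *
          Real.exp (-(n * inner ℝ (A (pad (γ - c))) (pad (γ - c)) / 2) + n * inner ℝ (A δ) δ / 2
            + κ' * (1 + n * inner ℝ (A (pad (γ - c))) (pad (γ - c)) + n * inner ℝ (A δ) δ)) := by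
  set C := ‖A‖ + 2 with hC
  have hC0 : 0 ≤ C := by positivity
  set K := 16 * errConst a ‖A‖ C * (4 * (‖A‖ + 1) / a + 1) ^ 2 with hK
  have hK0 : 0 ≤ K := by rw [hK]; unfold errConst; positivity
  set D := M ^ 2 + 1 / a with hD
  have hD0 : 0 < D := by positivity
  refine ⟨min (errMax a C) (κ' / (K * D + 1)), lt_min (errMax_pos ha hC0) (by positivity), ?_⟩
  set κ := min (errMax a C) (κ' / (K * D + 1)) with hκdef
  intro n x c r hn hr hMr h
  have hκ0 : 0 < κ := lt_min (errMax_pos ha hC0) (by positivity)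
  have hκm : κ ≤ errMax a C := min_le_left _ _
  have hκ1 : κ ≤ 1 := hκm.trans ((min_le_left _ _).trans (min_le_left _ _))
  have hκK : K * D * κ ≤ κ' := by
    calc K * D * κ ≤ (K * D + 1) * (κ' / (K * D + 1)) := by
          gcongr
          · linarith
          · exact min_le_right _ _
      _ = κ' := by field_simp
  have hn' : (0 : ℝ) < n := by exact_mod_cast hn
  have hnq : ∀ γ, ‖γ - c‖ ≤ r → NearQuadratic A n (fun i => gM g (x i) γ) r κ C :=
    fun γ hγ => h.nearQuadratic hκ1 hMr hγ
  have hcc : ‖c - c‖ ≤ r := by simpa using hr.le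
  have hmult : ∀ γ, ‖γ - c‖ ≤ r → IsMult n (fun i => gM g (x i) γ) (multiplier g n x γ) :=
    fun γ hγ => isMult_multiplier ((hnq γ hγ).exists_isMult ha hC0 hr hκ0.le hκm hA hn)
  have hRc := elRatio_eq_exp (hmult c hcc).1
  refine ⟨by rw [hRc]; positivity, fun γ δ hγ hδ => ?_⟩
  have hl := hmult γ hγ
  have hpos : ∀ i < n, 0 < 1 + (inner ℝ (multiplier g n x γ + δ) (gM g (x i) γ) : ℝ) := by
    intro i hi
    have h1 : ‖multiplier g n x γ + δ‖ ≤ (4 * C / a + 1) * r := by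
      refine (norm_add_le _ _).trans ?_
      have := (hnq γ hγ).norm_mult_le' ha hC0 hr hκ0.le hκm hA hn hl
      linarith
    have h2 := (hnq γ hγ).abs_inner_le hi (by positivity) h1
    have h3 := (abs_le.1 (h2.trans (NearQuadratic.mul_err_le ha hC0 hκm))).1
    linarith
  have hlik : lik g n x γ δ =
      Real.exp (-logEL n (fun i => gM g (x i) γ) (multiplier g n x γ + δ)) := by
    unfold lik
    rw [if_pos ⟨_, hl⟩, elRatio_eq_exp hpos]
  have key := (hnq γ hγ).abs_logEL_sub_logEL_le (hnq c hcc) ha hC0 hr hκ0.le hκm hA hsymm hn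
    (u := pad (γ - c)) hl (hmult c hcc) hδ (by rw [norm_pad]; exact h.increment γ hγ)
    (h.inner_pad _)
  have hb : K * κ * (n * ((‖∑ i ∈ Finset.range n, gM g (x i) c‖ / n) ^ 2 +
      ‖(pad (γ - c) : Full p q)‖ ^ 2 + ‖δ‖ ^ 2)) ≤
      κ' * (1 + n * inner ℝ (A (pad (γ - c))) (pad (γ - c)) + n * inner ℝ (A δ) δ) := by
    refine (mul_le_mul_of_nonneg_left (sq_norms_le hA ha hn h.norm_sum_le _ _)
      (by positivity)).trans ?_
    have h3 : ∀ w : Full p q, 0 ≤ n * inner ℝ (A w) w := fun w =>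
      mul_nonneg hn'.le ((by positivity : 0 ≤ a * ‖w‖ ^ 2).trans (hA w))
    have h4 := h3 (pad (γ - c))
    have h5 := h3 δ
    rw [← mul_assoc, mul_right_comm K]
    gcongr
  have key2 := abs_le.1 (key.trans hb)
  rw [hlik, hRc, ← Real.exp_add, ← Real.exp_add, Real.exp_le_exp, Real.exp_le_exp]
  constructor <;> linarith [key2.1, key2.2]

end Lik

/-! ### The marginal likelihood over the window -/

section Window
variable {𝒟 : Type*} {p q : ℕ} {g : 𝒟 → Full p q → Full p q}

theorem measurable_window_lik (n : ℕ) (x : ℕ → 𝒟) (c γ : Par p) (r : ℝ) :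
    Measurable fun δ => (window c r).indicator
      (fun z => ENNReal.ofReal (lik g n x z.1 z.2)) (γ, δ) := by
  by_cases hγ : ‖γ - c‖ ≤ r
  · have : (fun δ => (window c r).indicator (fun z => ENNReal.ofReal (lik g n x z.1 z.2)) (γ, δ)) =
        {δ : Full p q | ‖δ‖ ≤ r}.indicator (fun δ => ENNReal.ofReal (lik g n x γ δ)) := by
      ext δ
      by_cases hδ : ‖δ‖ ≤ r
      · rw [Set.indicator_of_mem (by exact ⟨hγ, hδ⟩), Set.indicator_of_mem (by exact hδ)]
      · rw [Set.indicator_of_notMem (fun h => hδ h.2), Set.indicator_of_notMem (by exact hδ)]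
    rw [this]
    exact (measurable_lik γ).ennreal_ofReal.indicator
      (measurableSet_le (by fun_prop) (by fun_prop))
  · have : (fun δ => (window c r).indicator (fun z => ENNReal.ofReal (lik g n x z.1 z.2)) (γ, δ)) =
        fun _ => 0 := by
      ext δ
      rw [Set.indicator_of_notMem (fun h => hγ h.1)]
    rw [this]
    exact measurable_const

theorem marginal_mono (ρ : Measure (Full p q)) (n : ℕ) (x : ℕ → 𝒟)
    {S T : Set (Par p × Full p q)} (h : S ⊆ T) : marginal g ρ n x S ≤ marginal g ρ n x T :=
  lintegral_mono fun _ => lintegral_mono fun _ =>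
    Set.indicator_le_indicator_of_subset h (fun _ => zero_le) _

/-- Subadditivity of the marginal likelihood. Lower integrals of functions that are not measurable
are not subadditive, hence the measurable majorant `F` of the window part. -/
theorem marginal_le_add_diff {ρ : Measure (Full p q)} {n : ℕ} {x : ℕ → 𝒟} {c : Par p} {r : ℝ}
    {F : Par p → ENNReal} (hF : Measurable F)
    (h : ∀ γ, ∫⁻ δ, (window c r).indicator
      (fun z => ENNReal.ofReal (lik g n x z.1 z.2)) (γ, δ) ∂ρ ≤ F γ) (S : Set (Par p × Full p q)) :
    marginal g ρ n x S ≤ (∫⁻ γ, F γ) + marginal g ρ n x (S \ window c r) := by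
  unfold marginal
  rw [← lintegral_add_left hF]
  refine lintegral_mono fun γ => ?_
  refine le_trans ?_ (add_le_add (h γ) le_rfl)
  rw [← lintegral_add_left (measurable_window_lik n x c γ r)]
  refine lintegral_mono fun δ => ?_
  by_cases hw : (γ, δ) ∈ window c r
  · rw [Set.indicator_of_mem hw]
    exact (Set.indicator_le_self _ _ _).trans le_self_add
  · by_cases hS : (γ, δ) ∈ S
    · have hd : (γ, δ) ∈ S \ window c r := ⟨hS, hw⟩
      rw [Set.indicator_of_mem hS, Set.indicator_of_mem hd]
      exact le_add_self
    · rw [Set.indicator_of_notMem hS]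
      exact zero_le

/-- The two-sided Laplace approximation of the marginal likelihood over the window. -/
theorem exists_marginal_bounds {S : Matrix (Fin p ⊕ Fin q) (Fin p ⊕ Fin q) ℝ} (hS : S.PosDef)
    {ρ : ℕ → Measure (Full p q)} [∀ n, IsProbabilityMeasure (ρ n)] (hρ : LocalPrior S ρ)
    {r : ℕ → ℝ} (hr : Tendsto (fun n : ℕ => √(n : ℝ) * r n) atTop atTop) (M : ℝ) {ε : ℝ}
    (hε : 0 < ε) :
    ∃ κ > 0, ∀ᶠ n in atTop, ∀ (x : ℕ → 𝒟) (c : Par p),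
      GoodSample g (Matrix.toEuclideanCLM (𝕜 := ℝ) S) n x c (r n) κ M →
      0 < elRatio g n x (multiplier g n x c) c ∧
      ENNReal.ofReal (laplaceTerm S.toBlocks₁₁ S (ρ n) n
        (elRatio g n x (multiplier g n x c) c) * Real.exp (-ε)) ≤
          marginal g (ρ n) n x (window c (r n)) ∧
      ∃ F : Par p → ENNReal, Measurable F ∧
        (∀ γ, ∫⁻ δ, (window c (r n)).indicator
          (fun z => ENNReal.ofReal (lik g n x z.1 z.2)) (γ, δ) ∂(ρ n) ≤ F γ) ∧
        ∫⁻ γ, F γ ≤ ENNReal.ofReal (laplaceTerm S.toBlocks₁₁ S (ρ n) n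
          (elRatio g n x (multiplier g n x c) c) * Real.exp ε) := by
  obtain ⟨η, hη, C, hC⟩ := hρ
  obtain ⟨a, ha, hA⟩ := exists_coercive hS
  obtain ⟨κ', hκ', hκη, hκ1, hU, hm⟩ := exists_factors p (a := a) (C := C) ha hη hε
  obtain ⟨κ, hκ, hlik⟩ := exists_lik_bounds (g := g) ha hA
    (inner_toEuclideanCLM_comm hS.isHermitian) M hκ'
  have hJ : S.toBlocks₁₁.PosDef := hS.submatrix (e := Sum.inl) Sum.inl_injective
  have hAJ : ∀ t : Par p, a * ‖t‖ ^ 2 ≤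
      inner ℝ (Matrix.toEuclideanCLM (𝕜 := ℝ) S.toBlocks₁₁ t) t := by
    intro t
    rw [← inner_toEuclideanCLM_pad, ← norm_pad (q := q)]
    exact hA _
  have hAq : ∀ δ : Full p q, a * ‖δ‖ ^ 2 ≤ quad S δ := by
    intro δ
    rw [quad_eq_inner]
    exact hA _
  have hnr : Tendsto (fun n : ℕ => (n : ℝ) * r n ^ 2) atTop atTop := by
    refine ((tendsto_pow_atTop two_ne_zero).comp hr).congr fun n => ?_
    simp only [Function.comp]
    rw [mul_pow, Real.sq_sqrt n.cast_nonneg]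
  refine ⟨κ, hκ, ?_⟩
  filter_upwards [hC, hnr.eventually hm, hr.eventually_ge_atTop M, hr.eventually_gt_atTop 0,
    eventually_gt_atTop 0] with n hCn hmn hMn hrn hn x c hgood
  have hrn' : 0 < r n := by
    by_contra hneg
    exact absurd hrn (not_lt.2 (mul_nonpos_of_nonneg_of_nonpos (Real.sqrt_nonneg _) (not_lt.1 hneg)))
  obtain ⟨hR, hb⟩ := hlik n x c (r n) hn hrn' hMn hgood
  simp only [inner_toEuclideanCLM_pad] at hb
  simp only [← quad_eq_inner] at hb
  have hB := laplaceTerm_nonneg (J := S.toBlocks₁₁) (A := S) (ρ := ρ n) (n := n) hR.le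
  refine ⟨hR, ?_, ?_⟩
  · refine le_trans (ENNReal.ofReal_le_ofReal ?_) (laplaceTerm_le_marginal hJ hη ha.le hR.le hn
      hrn'.le hκ'.le hAq hAJ hCn hmn.1 fun γ δ hγ hδ => (hb γ δ hγ hδ).1)
    gcongr
    exact hmn.2
  · obtain ⟨F, hF, hF1, hF2⟩ := exists_majorant_marginal hJ hη ha.le hR.le hn hκ'.le hκη hκ1 hAq
      hCn fun γ δ hγ hδ => (hb γ δ hγ hδ).2
    exact ⟨F, hF, hF1, hF2.trans (ENNReal.ofReal_le_ofReal (by gcongr))⟩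

theorem log_laplaceTerm {J : Matrix (Fin p) (Fin p) ℝ} (hJ : J.PosDef)
    {S : Matrix (Fin p ⊕ Fin q) (Fin p ⊕ Fin q) ℝ} {ρ : Measure (Full p q)} {n : ℕ} (hn : 0 < n)
    {R : ℝ} (hR : 0 < R) (hA : 0 < priorIntegral S ρ n) :
    -2 * Real.log (laplaceTerm J S ρ n R) = -2 * Real.log R + p * Real.log n +
      (Real.log J.det - p * Real.log (2 * Real.pi) - 2 * Real.log (priorIntegral S ρ n)) := by
  have hn' : (0 : ℝ) < n := by exact_mod_cast hn
  have hpi := Real.pi_pos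
  have hdet := hJ.det_pos
  have hdet0 : 0 < √J.det := Real.sqrt_pos.2 hdet
  unfold laplaceTerm
  rw [Real.log_mul (by positivity) hA.ne', Real.log_mul hR.ne' (by positivity),
    Real.log_div (by positivity) hdet0.ne', Real.log_rpow (by positivity),
    Real.log_div (by positivity) hn'.ne', Real.log_sqrt hdet.le]
  ring

theorem abs_log_toReal_sub_le {m : ENNReal} {B ε : ℝ} (hB : 0 < B)
    (h1 : ENNReal.ofReal (B * Real.exp (-ε)) ≤ m) (h2 : m ≤ ENNReal.ofReal (B * Real.exp ε)) :
    |-2 * Real.log m.toReal - -2 * Real.log B| ≤ 2 * ε := by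
  have hm : m ≠ ⊤ := (h2.trans_lt ENNReal.ofReal_lt_top).ne
  have h3 : B * Real.exp (-ε) ≤ m.toReal := (ENNReal.ofReal_le_iff_le_toReal hm).1 h1
  have h4 : m.toReal ≤ B * Real.exp ε := ENNReal.toReal_le_of_le_ofReal (by positivity) h2
  have h5 : 0 < m.toReal := lt_of_lt_of_le (by positivity) h3
  have h6 := Real.log_le_log (by positivity) h3
  have h7 := Real.log_le_log h5 h4
  rw [Real.log_mul hB.ne' (Real.exp_pos _).ne', Real.log_exp] at h6 h7
  rw [abs_le]
  constructor <;> linarith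

end Window

/-! ### From the true parameter to the window -/

section Deterministic
variable {𝒟 : Type*} {p q : ℕ} {g : 𝒟 → Full p q → Full p q}

theorem GoodSample.mono {A : Full p q →L[ℝ] Full p q} {n : ℕ} {x : ℕ → 𝒟} {c : Par p}
    {r κ κ' M : ℝ} (h : GoodSample g A n x c r κ M) (hκ : κ ≤ κ') : GoodSample g A n x c r κ' M where
  second_moment γ hγ l w := (h.second_moment γ hγ l w).trans (by gcongr)
  norm_le γ hγ i hi := (h.norm_le γ hγ i hi).trans hκ
  increment γ hγ := (h.increment γ hγ).trans (by gcongr)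
  norm_sum_le := h.norm_sum_le
  root := h.root

/-- The estimating function is smooth on a ball around `γ₀`, with derivatives and third power
bounded by `K` there, at the single observation `d`. -/
structure RegularAt (g : 𝒟 → Full p q → Full p q) (γ₀ : Par p) (r₀ K : ℝ) (d : 𝒟) : Prop where
  contDiffOn : ContDiffOn ℝ 2 (gM g d) (Metric.ball γ₀ r₀)
  bound : ∀ γ ∈ Metric.ball γ₀ r₀, ‖fderiv ℝ (gM g d) γ‖ ≤ K ∧
    ‖fderiv ℝ (fderiv ℝ (gM g d)) γ‖ ≤ K ∧ ‖gM g d γ‖ ^ 3 ≤ K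

namespace RegularAt
variable {γ₀ : Par p} {r₀ K : ℝ} {d : 𝒟}

theorem differentiableAt (h : RegularAt g γ₀ r₀ K d) {γ : Par p} (hγ : γ ∈ Metric.ball γ₀ r₀) :
    DifferentiableAt ℝ (gM g d) γ :=
  (h.contDiffOn.differentiableOn (by norm_num)).differentiableAt (Metric.isOpen_ball.mem_nhds hγ)

theorem differentiableAt_fderiv (h : RegularAt g γ₀ r₀ K d) {γ : Par p}
    (hγ : γ ∈ Metric.ball γ₀ r₀) : DifferentiableAt ℝ (fderiv ℝ (gM g d)) γ :=
  ((h.contDiffOn.fderiv_of_isOpen (m := 1) Metric.isOpen_ball (by norm_num)).differentiableOn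
    (by norm_num)).differentiableAt (Metric.isOpen_ball.mem_nhds hγ)

theorem nonneg (h : RegularAt g γ₀ r₀ K d) (hr₀ : 0 < r₀) : 0 ≤ K :=
  (norm_nonneg _).trans (h.bound γ₀ (Metric.mem_ball_self hr₀)).1

theorem norm_sub_le (h : RegularAt g γ₀ r₀ K d) {γ γ' : Par p} (hγ : γ ∈ Metric.ball γ₀ r₀)
    (hγ' : γ' ∈ Metric.ball γ₀ r₀) : ‖gM g d γ - gM g d γ'‖ ≤ K * ‖γ - γ'‖ :=
  (convex_ball γ₀ r₀).norm_image_sub_le_of_norm_fderiv_le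
    (fun _ hz => h.differentiableAt hz) (fun z hz => (h.bound z hz).1) hγ' hγ

theorem norm_fderiv_sub_le (h : RegularAt g γ₀ r₀ K d) {γ : Par p} (hγ : γ ∈ Metric.ball γ₀ r₀) :
    ‖fderiv ℝ (gM g d) γ - fderiv ℝ (gM g d) γ₀‖ ≤ K * ‖γ - γ₀‖ :=
  (convex_ball γ₀ r₀).norm_image_sub_le_of_norm_fderiv_le
    (fun _ hz => h.differentiableAt_fderiv hz) (fun z hz => (h.bound z hz).2.1)
    (Metric.mem_ball_self (Metric.pos_of_mem_ball hγ)) hγ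

/-- The mean value inequality with the derivative frozen at `γ₀`. -/
theorem norm_sub_sub_le (h : RegularAt g γ₀ r₀ K d) {τ : ℝ} (hτ : τ < r₀) {γ γ' : Par p}
    (hγ : ‖γ - γ₀‖ ≤ τ) (hγ' : ‖γ' - γ₀‖ ≤ τ) :
    ‖gM g d γ - gM g d γ' - fderiv ℝ (gM g d) γ₀ (γ - γ')‖ ≤ K * τ * ‖γ - γ'‖ := by
  have hr₀ : 0 < r₀ := ((norm_nonneg _).trans hγ).trans_lt hτ
  have hK := h.nonneg hr₀
  have hsub : ∀ z ∈ Metric.closedBall γ₀ τ, z ∈ Metric.ball γ₀ r₀ := fun z hz =>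
    Metric.closedBall_subset_ball hτ hz
  refine (convex_closedBall γ₀ τ).norm_image_sub_le_of_norm_fderiv_le'
    (fun z hz => h.differentiableAt (hsub z hz)) (fun z hz => ?_) (x := γ') (y := γ) ?_ ?_
  · refine (h.norm_fderiv_sub_le (hsub z hz)).trans ?_
    gcongr
    exact mem_closedBall_iff_norm.1 hz
  · exact mem_closedBall_iff_norm.2 hγ'
  · exact mem_closedBall_iff_norm.2 hγ

/-- The increment of `g gᵀ` is bounded by a multiple of `K`, not of a higher power of `K`, by
interpolation between the bound on the increment of `g` and the bound on `g` itself. -/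
theorem abs_inner_mul_inner_sub_le (h : RegularAt g γ₀ r₀ K d) {τ : ℝ} (hτ : τ < r₀) {γ : Par p}
    (hγ : ‖γ - γ₀‖ ≤ τ) (l w : Full p q) :
    |(inner ℝ l (gM g d γ) * inner ℝ w (gM g d γ) : ℝ)
      - inner ℝ l (gM g d γ₀) * inner ℝ w (gM g d γ₀)| ≤ √(8 * τ) * K * (‖l‖ * ‖w‖) := by
  have hτ0 : 0 ≤ τ := (norm_nonneg _).trans hγ
  have hr₀ : 0 < r₀ := hτ0.trans_lt hτ
  have hK := h.nonneg hr₀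
  have hγm : γ ∈ Metric.ball γ₀ r₀ := mem_ball_iff_norm.2 (hγ.trans_lt hτ)
  have h0m : γ₀ ∈ Metric.ball γ₀ r₀ := Metric.mem_ball_self hr₀
  set v := gM g d γ
  set v₀ := gM g d γ₀
  have h1 : ‖v‖ ^ 3 ≤ K := (h.bound γ hγm).2.2
  have h2 : ‖v₀‖ ^ 3 ≤ K := (h.bound γ₀ h0m).2.2
  have h3 : ‖v - v₀‖ ≤ K * τ := (h.norm_sub_le hγm h0m).trans (by gcongr)
  have h4 : (‖v‖ + ‖v₀‖) * ‖v - v₀‖ ≤ √(8 * τ) * K := by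
    refine le_of_sq_le_sq ?_ (by positivity)
    rw [mul_pow, mul_pow, Real.sq_sqrt (by positivity)]
    have h5 : (‖v‖ + ‖v₀‖) ^ 3 ≤ 8 * K := by
      have := add_pow_le (norm_nonneg v) (norm_nonneg v₀) 3
      norm_num at this
      linarith
    calc (‖v‖ + ‖v₀‖) ^ 2 * ‖v - v₀‖ ^ 2 = (‖v‖ + ‖v₀‖) ^ 2 * ‖v - v₀‖ * ‖v - v₀‖ := by ring
      _ ≤ (‖v‖ + ‖v₀‖) ^ 2 * (‖v‖ + ‖v₀‖) * (K * τ) := by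
          gcongr
          exact _root_.norm_sub_le _ _
      _ = (‖v‖ + ‖v₀‖) ^ 3 * (K * τ) := by ring
      _ ≤ 8 * K * (K * τ) := by gcongr
      _ = 8 * τ * K ^ 2 := by ring
  have e : (inner ℝ l v * inner ℝ w v : ℝ) - inner ℝ l v₀ * inner ℝ w v₀ =
      inner ℝ l (v - v₀) * inner ℝ w v + inner ℝ l v₀ * inner ℝ w (v - v₀) := by
    simp only [inner_sub_right]; ring
  rw [e]
  calc _ ≤ |inner ℝ l (v - v₀)| * |inner ℝ w v| + |inner ℝ l v₀| * |inner ℝ w (v - v₀)| := by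
        rw [← abs_mul, ← abs_mul]; exact abs_add_le _ _
    _ ≤ (‖l‖ * ‖v - v₀‖) * (‖w‖ * ‖v‖) + (‖l‖ * ‖v₀‖) * (‖w‖ * ‖v - v₀‖) := by
        gcongr <;> exact abs_real_inner_le_norm _ _
    _ = (‖v‖ + ‖v₀‖) * ‖v - v₀‖ * (‖l‖ * ‖w‖) := by ring
    _ ≤ _ := by gcongr

end RegularAt

/-- The sample quantities at the true parameter from which `GoodSample` follows. -/
theorem goodSample_of_regularAt {A : Full p q →L[ℝ] Full p q} {n : ℕ} {x : ℕ → 𝒟} {c γ₀ : Par p}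
    {r κ a r₀ τ M₁ M₂ : ℝ} {K : 𝒟 → ℝ} (ha : 0 < a) (hA : ∀ l, a * ‖l‖ ^ 2 ≤ inner ℝ (A l) l)
    (hκ1 : κ ≤ 1) (hκa : κ ≤ a / 2) (hn : 0 < n) (hr : 0 ≤ r)
    (hreg : ∀ i < n, RegularAt g γ₀ r₀ (K (x i)) (x i))
    (hτ : τ < r₀) (hτ1 : M₁ * τ ≤ κ / 2) (hτ2 : √(8 * τ) * M₁ ≤ κ / 2)
    (hc : ‖c - γ₀‖ ≤ τ / 2) (hrτ : r ≤ τ / 2) (hrn : (n : ℝ) ^ (1 / 3 : ℝ) * r ≤ κ)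
    (hK : ∑ i ∈ Finset.range n, K (x i) ≤ n * M₁) (hKmax : ∀ i < n, K (x i) ≤ n)
    (hmoment : ∀ l w, |∑ i ∈ Finset.range n,
      (inner ℝ l (gM g (x i) γ₀) * inner ℝ w (gM g (x i) γ₀) : ℝ) - n * inner ℝ (A l) w|
        ≤ n * (κ / 2) * (‖l‖ * ‖w‖))
    (hjac : ∀ t, ‖∑ i ∈ Finset.range n, fderiv ℝ (gM g (x i)) γ₀ t + (n : ℝ) • A (pad t)‖
      ≤ n * (κ / 2 * ‖t‖))
    (hsum : ‖∑ i ∈ Finset.range n, gM g (x i) γ₀‖ ≤ √n * M₂)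
    (hroot : ∀ j : Fin p, ∑ i ∈ Finset.range n, gM g (x i) c (Sum.inl j) = 0) :
    GoodSample g A n x c r κ ((1 + (‖A‖ + 1) * (2 / a)) * M₂) := by
  have hn' : (0 : ℝ) < n := by exact_mod_cast hn
  have hτ0 : 0 ≤ τ := by linarith
  have hnear : ∀ γ, ‖γ - c‖ ≤ r → ‖γ - γ₀‖ ≤ τ := by
    intro γ hγ
    calc ‖γ - γ₀‖ ≤ ‖γ - c‖ + ‖c - γ₀‖ := norm_sub_le_norm_sub_add_norm_sub _ _ _
      _ ≤ τ := by linarith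
  have hcτ : ‖c - γ₀‖ ≤ τ := by linarith
  have hinc : ∀ γ γ' : Par p, ‖γ - γ₀‖ ≤ τ → ‖γ' - γ₀‖ ≤ τ → ‖∑ i ∈ Finset.range n, gM g (x i) γ -
      ∑ i ∈ Finset.range n, gM g (x i) γ' + (n : ℝ) • A (pad (γ - γ'))‖ ≤ n * (κ * ‖γ - γ'‖) := by
    intro γ γ' hγ hγ'
    have e : ∑ i ∈ Finset.range n, gM g (x i) γ - ∑ i ∈ Finset.range n, gM g (x i) γ' +
        (n : ℝ) • A (pad (γ - γ')) = ∑ i ∈ Finset.range n,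
        (gM g (x i) γ - gM g (x i) γ' - fderiv ℝ (gM g (x i)) γ₀ (γ - γ')) +
        (∑ i ∈ Finset.range n, fderiv ℝ (gM g (x i)) γ₀ (γ - γ') + (n : ℝ) • A (pad (γ - γ'))) := by
      rw [Finset.sum_sub_distrib, Finset.sum_sub_distrib]; abel
    have h1 : ‖∑ i ∈ Finset.range n,
        (gM g (x i) γ - gM g (x i) γ' - fderiv ℝ (gM g (x i)) γ₀ (γ - γ'))‖ ≤
        n * (κ / 2 * ‖γ - γ'‖) := by
      calc _ ≤ ∑ i ∈ Finset.range n, K (x i) * τ * ‖γ - γ'‖ := norm_sum_le_of_le _ fun i hi =>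
            (hreg i (Finset.mem_range.1 hi)).norm_sub_sub_le hτ hγ hγ'
        _ = (∑ i ∈ Finset.range n, K (x i)) * (τ * ‖γ - γ'‖) := by
            rw [Finset.sum_mul]; simp only [mul_assoc]
        _ ≤ n * M₁ * (τ * ‖γ - γ'‖) := by gcongr
        _ = n * (M₁ * τ * ‖γ - γ'‖) := by ring
        _ ≤ _ := by gcongr
    rw [e]
    refine (norm_add_le _ _).trans ((add_le_add h1 (hjac _)).trans (le_of_eq ?_))
    ring
  refine ⟨fun γ hγ l w => ?_, fun γ hγ i hi => ?_, fun γ hγ => hinc γ c (hnear γ hγ) hcτ, ?_, hroot⟩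
  · have h1 : |∑ i ∈ Finset.range n, ((inner ℝ l (gM g (x i) γ) * inner ℝ w (gM g (x i) γ) : ℝ)
        - inner ℝ l (gM g (x i) γ₀) * inner ℝ w (gM g (x i) γ₀))| ≤ n * (κ / 2) * (‖l‖ * ‖w‖) := by
      calc _ ≤ ∑ i ∈ Finset.range n, √(8 * τ) * K (x i) * (‖l‖ * ‖w‖) :=
            (Finset.abs_sum_le_sum_abs _ _).trans (Finset.sum_le_sum fun i hi =>
              (hreg i (Finset.mem_range.1 hi)).abs_inner_mul_inner_sub_le hτ (hnear γ hγ) l w)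
        _ = √(8 * τ) * (∑ i ∈ Finset.range n, K (x i)) * (‖l‖ * ‖w‖) := by
            rw [← Finset.sum_mul, ← Finset.mul_sum]
        _ ≤ √(8 * τ) * (n * M₁) * (‖l‖ * ‖w‖) := by gcongr
        _ = n * (√(8 * τ) * M₁) * (‖l‖ * ‖w‖) := by ring
        _ ≤ _ := by gcongr
    rw [Finset.sum_sub_distrib] at h1
    have h2 := hmoment l w
    rw [abs_le] at *
    constructor <;> linarith
  · have hγm : γ ∈ Metric.ball γ₀ r₀ := mem_ball_iff_norm.2 ((hnear γ hγ).trans_lt hτ)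
    have h1 : ‖gM g (x i) γ‖ ^ 3 ≤ n := ((hreg i hi).bound γ hγm).2.2.trans (hKmax i hi)
    have h2 : ‖gM g (x i) γ‖ ≤ (n : ℝ) ^ (1 / 3 : ℝ) := by
      calc ‖gM g (x i) γ‖ = (‖gM g (x i) γ‖ ^ 3) ^ (1 / 3 : ℝ) := by
            rw [← Real.rpow_natCast, ← Real.rpow_mul (norm_nonneg _)]; norm_num
        _ ≤ _ := by gcongr
    calc r * ‖gM g (x i) γ‖ ≤ r * (n : ℝ) ^ (1 / 3 : ℝ) := by gcongr
      _ ≤ κ := by linarith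
  · -- the root is within a multiple of `‖∑ g (xᵢ, γ₀)‖ / n` of `γ₀`, by coercivity
    have h1 := hinc c γ₀ hcτ (by simpa using hτ0)
    set u := c - γ₀ with hu
    set T := ∑ i ∈ Finset.range n, gM g (x i) c with hT
    set T₀ := ∑ i ∈ Finset.range n, gM g (x i) γ₀ with hT₀
    have hort : inner ℝ T (pad u) = (0 : ℝ) := by
      rw [PiLp.inner_apply]
      simp [hT, hroot]
    have h2 : n * (a / 2) * ‖u‖ ≤ ‖T₀‖ := by
      have h3 : inner ℝ (T - T₀ + (n : ℝ) • A (pad u)) (pad u) ≤ n * (κ * ‖u‖) * ‖u‖ := by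
        refine (real_inner_le_norm _ _).trans ?_
        rw [norm_pad]
        gcongr
      have h4 : inner ℝ T₀ (pad u) ≤ ‖T₀‖ * ‖u‖ := by
        refine (real_inner_le_norm _ _).trans ?_
        rw [norm_pad]
      have h5 := hA (pad u)
      rw [norm_pad] at h5
      rw [inner_add_left, inner_sub_left, hort, inner_smul_left] at h3
      simp only [conj_trivial] at h3
      rcases eq_or_lt_of_le (norm_nonneg u) with h0 | h0
      · rw [← h0]; simp
      · refine le_of_mul_le_mul_right ?_ h0
        have h6 : n * (κ * ‖u‖) * ‖u‖ ≤ n * (a / 2 * ‖u‖) * ‖u‖ := by gcongr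
        have h7 := mul_le_mul_of_nonneg_left h5 hn'.le
        linarith
    have h3 : ‖u‖ * n ≤ 2 / a * ‖T₀‖ := by
      rw [div_mul_eq_mul_div, le_div_iff₀ ha]
      linarith
    have h4 : ‖(n : ℝ) • A (pad u)‖ ≤ n * (‖A‖ * ‖u‖) := by
      rw [norm_smul, Real.norm_natCast]
      gcongr
      refine (A.le_opNorm _).trans ?_
      rw [norm_pad]
    have h5 : n * (κ * ‖u‖) ≤ n * (1 * ‖u‖) := by gcongr
    have e : T = (T - T₀ + (n : ℝ) • A (pad u)) + T₀ - (n : ℝ) • A (pad u) := by abel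
    calc ‖T‖ ≤ n * (κ * ‖u‖) + ‖T₀‖ + n * (‖A‖ * ‖u‖) := by
          conv_lhs => rw [e]
          exact (norm_sub_le _ _).trans (add_le_add ((norm_add_le _ _).trans
            (add_le_add h1 le_rfl)) h4)
      _ ≤ ‖T₀‖ + (‖A‖ + 1) * (‖u‖ * n) := by linarith
      _ ≤ ‖T₀‖ + (‖A‖ + 1) * (2 / a * ‖T₀‖) := by gcongr
      _ = (1 + (‖A‖ + 1) * (2 / a)) * ‖T₀‖ := by ring
      _ ≤ (1 + (‖A‖ + 1) * (2 / a)) * (√n * M₂) := by gcongr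
      _ = _ := by ring

end Deterministic

/-! ### Laws of large numbers and tightness along the sample -/

section Probability
variable {Ω 𝒟 : Type*} [MeasurableSpace Ω] [MeasurableSpace 𝒟] {p q : ℕ}
  {μ : Measure Ω} {P : Measure 𝒟} {D : ℕ → Ω → 𝒟}

/-- The events `s n` have probability tending to one. The complements are measured by the outer
measure of `μ`, since the plug-in estimator need not be measurable. -/
def WithHighProb (μ : Measure Ω) (s : ℕ → Ω → Prop) : Prop :=
  Tendsto (fun n => μ {ω | ¬ s n ω}) atTop (𝓝 0)

theorem WithHighProb.mono {s t : ℕ → Ω → Prop} (h : WithHighProb μ s)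
    (hst : ∀ᶠ n in atTop, ∀ ω, s n ω → t n ω) : WithHighProb μ t := by
  refine tendsto_of_tendsto_of_tendsto_of_le_of_le' tendsto_const_nhds h
    (Eventually.of_forall fun _ => zero_le) ?_
  filter_upwards [hst] with n hn
  exact measure_mono fun ω hω hs => hω (hn ω hs)

theorem WithHighProb.and {s t : ℕ → Ω → Prop} (hs : WithHighProb μ s) (ht : WithHighProb μ t) :
    WithHighProb μ fun n ω => s n ω ∧ t n ω := by
  have h := hs.add ht
  rw [add_zero] at h
  refine tendsto_of_tendsto_of_tendsto_of_le_of_le tendsto_const_nhds h (fun _ => zero_le)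
    fun n => ?_
  refine (measure_mono fun ω hω => ?_).trans (measure_union_le _ _)
  exact not_and_or.1 hω

theorem WithHighProb.forall {ι : Type*} [Finite ι] {s : ι → ℕ → Ω → Prop}
    (h : ∀ i, WithHighProb μ (s i)) : WithHighProb μ fun n ω => ∀ i, s i n ω := by
  have := Fintype.ofFinite ι
  have h' := tendsto_finsetSum Finset.univ fun i _ => h i
  simp only [Finset.sum_const_zero] at h'
  refine tendsto_of_tendsto_of_tendsto_of_le_of_le tendsto_const_nhds h' (fun _ => zero_le)
    fun n => ?_
  refine (measure_mono fun ω hω => ?_).trans (measure_biUnion_finset_le Finset.univ _)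
  simpa using hω

theorem withHighProb_of_ae {s : ℕ → Ω → Prop} (h : ∀ᵐ ω ∂μ, ∀ n, s n ω) : WithHighProb μ s := by
  have : ∀ n, μ {ω | ¬ s n ω} = 0 := fun n => by
    have h1 : ∀ᵐ ω ∂μ, s n ω := h.mono fun ω hω => hω n
    exact h1
  simp only [WithHighProb, this]
  exact tendsto_const_nhds

theorem withHighProb_of_tendstoInMeasure {E : Type*} [SeminormedAddCommGroup E] {f : ℕ → Ω → E}
    {z : E} (h : TendstoInMeasure μ f atTop fun _ => z) {ε : ℝ} (hε : 0 < ε) :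
    WithHighProb μ fun n ω => ‖f n ω - z‖ ≤ ε := by
  have h1 := tendstoInMeasure_iff_norm.1 h ε hε
  refine tendsto_of_tendsto_of_tendsto_of_le_of_le tendsto_const_nhds h1 (fun _ => zero_le)
    fun n => measure_mono fun ω hω => (not_le.1 hω).le

variable (hDmeas : ∀ i, Measurable (D i)) (hDindep : iIndepFun D μ)
  (hDlaw : ∀ i, μ.map (D i) = P)

include hDmeas hDlaw in
theorem ae_forall_sample {Q : 𝒟 → Prop} (h : ∀ᵐ d ∂P, Q d) : ∀ᵐ ω ∂μ, ∀ i, Q (D i ω) := by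
  rw [ae_all_iff]
  intro i
  rw [← hDlaw i] at h
  exact ae_of_ae_map (hDmeas i).aemeasurable h

variable [IsProbabilityMeasure μ]

include hDmeas hDindep hDlaw in
/-- The weak law of large numbers along the sample. -/
theorem withHighProb_sum_sub_le {E : Type*} [NormedAddCommGroup E] [NormedSpace ℝ E]
    [CompleteSpace E] [MeasurableSpace E] [BorelSpace E] {f : 𝒟 → E} (hf : Integrable f P) {ε : ℝ}
    (hε : 0 < ε) :
    WithHighProb μ fun n ω => ‖∑ i ∈ Finset.range n, f (D i ω) - (n : ℝ) • ∫ d, f d ∂P‖ ≤ n * ε := by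
  set f' := hf.1.mk f with hf'def
  have hf'm : StronglyMeasurable f' := hf.1.stronglyMeasurable_mk
  have hff' : f =ᵐ[P] f' := hf.1.ae_eq_mk
  have hf' : Integrable f' P := hf.congr hff'
  have hmp : ∀ i, MeasurePreserving (D i) μ P := fun i => ⟨hDmeas i, hDlaw i⟩
  have hint : ∀ i, Integrable (fun ω => f' (D i ω)) μ := fun i =>
    (hmp i).integrable_comp_of_integrable hf'
  have hlaw := strong_law_ae (μ := μ) (fun i ω => f' (D i ω)) (hint 0)
    (fun i j hij => (hDindep.indepFun hij).comp hf'm.measurable hf'm.measurable)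
    (fun i => IdentDistrib.comp ⟨(hDmeas i).aemeasurable, (hDmeas 0).aemeasurable,
      (hDlaw i).trans (hDlaw 0).symm⟩ hf'm.measurable)
  have hmean : ∫ ω, f' (D 0 ω) ∂μ = ∫ d, f d ∂P := by
    rw [integral_congr_ae hff', ← hDlaw 0, integral_map (hDmeas 0).aemeasurable
      hf'm.aestronglyMeasurable]
  rw [hmean] at hlaw
  have htm := tendstoInMeasure_of_tendsto_ae (fun n => ?_) hlaw
  · have h1 := (withHighProb_of_tendstoInMeasure htm hε).and
      (withHighProb_of_ae (s := fun _ ω => ∀ i, f (D i ω) = f' (D i ω))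
        ((ae_forall_sample hDmeas hDlaw hff').mono fun ω hω _ => hω))
    refine h1.mono ?_
    filter_upwards [eventually_gt_atTop 0] with n hn ω hω
    have hn' : (0 : ℝ) < n := by exact_mod_cast hn
    have e : ∑ i ∈ Finset.range n, f (D i ω) - (n : ℝ) • ∫ d, f d ∂P =
        (n : ℝ) • ((n : ℝ)⁻¹ • ∑ i ∈ Finset.range n, f' (D i ω) - ∫ d, f d ∂P) := by
      rw [smul_sub, smul_inv_smul₀ hn'.ne', Finset.sum_congr rfl fun i _ => hω.2 i]
    rw [e, norm_smul, Real.norm_natCast]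
    gcongr
    exact hω.1
  · exact ((Finset.aestronglyMeasurable_fun_sum _ fun i _ => (hint i).1).const_smul _)

include hDmeas hDlaw in
/-- Markov's inequality for the sample mean of a non-negative function. -/
theorem exists_measure_sum_gt_le [IsProbabilityMeasure P] {K : 𝒟 → ℝ} (hK : Integrable K P)
    (hK0 : ∀ d, 0 ≤ K d) {ζ : ℝ} (hζ : 0 < ζ) :
    ∃ M > 0, ∀ n > 0, μ {ω | ¬ ∑ i ∈ Finset.range n, K (D i ω) ≤ n * M} ≤ ENNReal.ofReal ζ := by
  have hm : 0 ≤ ∫ d, K d ∂P := integral_nonneg hK0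
  refine ⟨(∫ d, K d ∂P + 1) / ζ, by positivity, fun n hn => ?_⟩
  have hn' : (0 : ℝ) < n := by exact_mod_cast hn
  set M := (∫ d, K d ∂P + 1) / ζ with hM
  have hM0 : 0 < M := by positivity
  have hmp : ∀ i, MeasurePreserving (D i) μ P := fun i => ⟨hDmeas i, hDlaw i⟩
  have hint : ∀ i, Integrable (fun ω => K (D i ω)) μ := fun i =>
    (hmp i).integrable_comp_of_integrable hK
  have hs : Integrable (fun ω => ∑ i ∈ Finset.range n, K (D i ω)) μ :=
    integrable_finsetSum _ fun i _ => hint i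
  have h1 := mul_meas_ge_le_integral_of_nonneg (Eventually.of_forall fun ω =>
    Finset.sum_nonneg fun i _ => hK0 (D i ω)) hs (n * M)
  have h2 : ∫ ω, ∑ i ∈ Finset.range n, K (D i ω) ∂μ = n * ∫ d, K d ∂P := by
    rw [integral_finsetSum _ fun i _ => hint i]
    have : ∀ i, ∫ ω, K (D i ω) ∂μ = ∫ d, K d ∂P := fun i => by
      rw [← hDlaw i, integral_map (hDmeas i).aemeasurable (by rw [hDlaw i]; exact hK.1)]
    simp [this]
  rw [h2] at h1
  have h3 : μ.real {ω | n * M ≤ ∑ i ∈ Finset.range n, K (D i ω)} ≤ ζ := by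
    have h4 : M * ζ = ∫ d, K d ∂P + 1 := by rw [hM]; field_simp
    have h5 : M * μ.real {ω | n * M ≤ ∑ i ∈ Finset.range n, K (D i ω)} ≤ M * ζ := by
      refine le_of_mul_le_mul_left (a := (n : ℝ)) ?_ hn'
      rw [h4]
      linarith
    exact le_of_mul_le_mul_left h5 hM0
  calc _ ≤ μ {ω | n * M ≤ ∑ i ∈ Finset.range n, K (D i ω)} :=
        measure_mono fun ω hω => (not_le.1 hω).le
    _ = ENNReal.ofReal (μ.real {ω | n * M ≤ ∑ i ∈ Finset.range n, K (D i ω)}) := by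
        rw [ofReal_measureReal]
    _ ≤ _ := ENNReal.ofReal_le_ofReal h3

omit [IsProbabilityMeasure μ] in
include hDmeas hDlaw in
/-- The maximum of `n` copies of an integrable variable is at most `n` with high probability. -/
theorem withHighProb_forall_le [IsProbabilityMeasure P] {K : 𝒟 → ℝ} (hK : Integrable K P) :
    WithHighProb μ fun n ω => ∀ i < n, K (D i ω) ≤ n := by
  set K' := hK.1.mk K
  have hK'm : Measurable K' := hK.1.stronglyMeasurable_mk.measurable
  have hKK' : K =ᵐ[P] K' := hK.1.ae_eq_mk
  have hK' : Integrable K' P := hK.congr hKK'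
  have h1 : Tendsto (fun n : ℕ => ∫⁻ d, {d | (n : ℝ) < K' d}.indicator
      (fun _ => (n : ENNReal)) d ∂P) atTop (𝓝 (∫⁻ _, 0 ∂P)) := by
    refine tendsto_lintegral_of_dominated_convergence (fun d => ENNReal.ofReal (K' d))
      (fun n => measurable_const.indicator (measurableSet_lt measurable_const hK'm))
      (fun n => Eventually.of_forall fun d => ?_) ?_ (Eventually.of_forall fun d => ?_)
    · by_cases hd : (n : ℝ) < K' d
      · rw [Set.indicator_of_mem (by exact hd), ← ENNReal.ofReal_natCast]
        exact ENNReal.ofReal_le_ofReal hd.le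
      · rw [Set.indicator_of_notMem (by exact hd)]; exact zero_le
    · exact ((hasFiniteIntegral_iff_norm _).1 hK'.2 |>.trans_le' (lintegral_mono fun d =>
        ENNReal.ofReal_le_ofReal (le_abs_self _))).ne
    · refine tendsto_const_nhds.congr' ?_
      obtain ⟨N, hN⟩ := exists_nat_ge (K' d)
      filter_upwards [eventually_ge_atTop N] with n hn
      rw [Set.indicator_of_notMem]
      simp only [Set.mem_ofPred_eq, not_lt]
      exact hN.trans (by exact_mod_cast hn)
  rw [lintegral_zero] at h1
  have h2 : WithHighProb μ fun n ω => ∀ i < n, K' (D i ω) ≤ n := by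
    refine tendsto_of_tendsto_of_tendsto_of_le_of_le tendsto_const_nhds h1 (fun _ => zero_le)
      fun n => ?_
    have hset : MeasurableSet {d | (n : ℝ) < K' d} := measurableSet_lt measurable_const hK'm
    calc μ {ω | ¬ ∀ i < n, K' (D i ω) ≤ n} ≤ μ (⋃ i ∈ Finset.range n, D i ⁻¹' {d | (n : ℝ) < K' d}) := by
          refine measure_mono fun ω hω => ?_
          simpa using hω
      _ ≤ ∑ i ∈ Finset.range n, μ (D i ⁻¹' {d | (n : ℝ) < K' d}) := measure_biUnion_finset_le _ _
      _ = ∑ i ∈ Finset.range n, P {d | (n : ℝ) < K' d} := by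
          refine Finset.sum_congr rfl fun i _ => ?_
          rw [← hDlaw i, Measure.map_apply (hDmeas i) hset]
      _ = ∫⁻ d, {d | (n : ℝ) < K' d}.indicator (fun _ => (n : ENNReal)) d ∂P := by
          rw [lintegral_indicator hset]; simp
  refine (h2.and (withHighProb_of_ae (s := fun _ ω => ∀ i, K (D i ω) = K' (D i ω))
    ((ae_forall_sample hDmeas hDlaw hKK').mono fun ω hω _ => hω))).mono
    (Eventually.of_forall fun n ω hω i hi => ?_)
  rw [hω.2 i]
  exact hω.1 i hi

include hDmeas hDindep hDlaw in
/-- Chebyshev's inequality: the sum of a centred square-integrable vector-valued function over the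
sample is of order `√n` in probability. -/
theorem exists_measure_norm_sum_gt_le [IsProbabilityMeasure P] {ι : Type*} [Fintype ι]
    {f : 𝒟 → EuclideanSpace ℝ ι} (hfm : Measurable f) (hf : Integrable (fun d => ‖f d‖ ^ 2) P)
    (hmean : ∫ d, f d ∂P = 0) {ζ : ℝ} (hζ : 0 < ζ) :
    ∃ M > 0, ∀ n > 0, μ {ω | ¬ ‖∑ i ∈ Finset.range n, f (D i ω)‖ ≤ √n * M} ≤ ENNReal.ofReal ζ := by
  have hmp : ∀ i, MeasurePreserving (D i) μ P := fun i => ⟨hDmeas i, hDlaw i⟩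
  have hfL : MemLp f 2 P := (memLp_two_iff_integrable_sq_norm hfm.aestronglyMeasurable).2 hf
  have hfint : Integrable f P := hfL.integrable (by norm_num)
  have hk : ∀ k, MemLp (fun d => f d k) 2 P := fun k => by
    refine hfL.of_le (by fun_prop) (Eventually.of_forall fun d => ?_)
    exact PiLp.norm_apply_le (f d) k
  have hmeank : ∀ k, ∫ d, f d k ∂P = 0 := fun k => by
    have := (EuclideanSpace.proj k : EuclideanSpace ℝ ι →L[ℝ] ℝ).integral_comp_comm hfint
    simpa [hmean] using this
  have hkD : ∀ k i, MemLp (fun ω => f (D i ω) k) 2 μ := fun k i =>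
    (hk k).comp_measurePreserving (hmp i)
  -- the second moment of a coordinate of the sum is that of one summand, times `n`
  have hsq : ∀ k (n : ℕ), ∫ ω, (∑ i ∈ Finset.range n, f (D i ω) k) ^ 2 ∂μ =
      n * ∫ d, (f d k) ^ 2 ∂P := by
    intro k n
    have hmean0 : ∀ i, ∫ ω, f (D i ω) k ∂μ = 0 := fun i => by
      have := integral_map (μ := μ) (hDmeas i).aemeasurable (f := fun d => f d k)
        (by fun_prop)
      rw [← this, hDlaw i, hmeank k]
    have hsecond : ∀ i, ∫ ω, (f (D i ω) k) ^ 2 ∂μ = ∫ d, (f d k) ^ 2 ∂P := fun i => by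
      have := integral_map (μ := μ) (hDmeas i).aemeasurable (f := fun d => (f d k) ^ 2)
        (by fun_prop)
      rw [← this, hDlaw i]
    have hvar := IndepFun.variance_sum (μ := μ) (X := fun i ω => f (D i ω) k)
      (s := Finset.range n) (fun i _ => hkD k i) (fun i _ j _ hij =>
        (hDindep.indepFun hij).comp (φ := fun d => f d k) (ψ := fun d => f d k)
          (by fun_prop) (by fun_prop))
    have hm1 : ∀ i, AEMeasurable (fun ω => f (D i ω) k) μ := fun i => (hkD k i).1.aemeasurable
    have hsum0 : ∫ ω, (∑ i ∈ Finset.range n, fun ω => f (D i ω) k) ω ∂μ = 0 := by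
      simp only [Finset.sum_apply]
      rw [integral_finsetSum _ fun i _ => (hkD k i).integrable (by norm_num)]
      simp [hmean0]
    rw [variance_of_integral_eq_zero (Finset.aemeasurable_sum _ fun i _ => hm1 i) hsum0] at hvar
    simp only [Finset.sum_apply] at hvar
    rw [hvar]
    have : ∀ i, variance (fun ω => f (D i ω) k) μ = ∫ d, (f d k) ^ 2 ∂P := fun i => by
      rw [variance_of_integral_eq_zero (hm1 i) (hmean0 i), hsecond i]
    simp [this]
  have hnorm : ∀ n : ℕ, ∫ ω, ‖∑ i ∈ Finset.range n, f (D i ω)‖ ^ 2 ∂μ = n * ∫ d, ‖f d‖ ^ 2 ∂P := by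
    intro n
    simp only [EuclideanSpace.real_norm_sq_eq, WithLp.ofLp_sum, Finset.sum_apply]
    rw [integral_finsetSum, integral_finsetSum, Finset.mul_sum]
    · exact Finset.sum_congr rfl fun k _ => hsq k n
    · exact fun k _ => (hk k).integrable_sq
    · exact fun k _ => (memLp_finsetSum _ fun i _ => hkD k i).integrable_sq
  have hV : 0 ≤ ∫ d, ‖f d‖ ^ 2 ∂P := integral_nonneg fun d => by positivity
  set V := ∫ d, ‖f d‖ ^ 2 ∂P with hVdef
  refine ⟨√((V + 1) / ζ), by positivity, fun n hn => ?_⟩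
  have hn' : (0 : ℝ) < n := by exact_mod_cast hn
  have hint : Integrable (fun ω => ‖∑ i ∈ Finset.range n, f (D i ω)‖ ^ 2) μ := by
    have : MemLp (fun ω => ∑ i ∈ Finset.range n, f (D i ω)) 2 μ :=
      memLp_finsetSum _ fun i _ => hfL.comp_measurePreserving (hmp i)
    exact (memLp_two_iff_integrable_sq_norm this.1).1 this
  have h1 := mul_meas_ge_le_integral_of_nonneg (Eventually.of_forall fun ω => by positivity) hint
    (n * ((V + 1) / ζ))
  rw [hnorm] at h1
  set U := {ω | n * ((V + 1) / ζ) ≤ ‖∑ i ∈ Finset.range n, f (D i ω)‖ ^ 2} with hU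
  have h3 : μ.real U ≤ ζ := by
    have h5 : (V + 1) / ζ * μ.real U ≤ (V + 1) / ζ * ζ := by
      refine le_of_mul_le_mul_left (a := (n : ℝ)) ?_ hn'
      rw [div_mul_cancel₀ _ hζ.ne']
      linarith
    exact le_of_mul_le_mul_left h5 (by positivity)
  calc _ ≤ μ U := by
        refine measure_mono fun ω hω => ?_
        have h6 := (not_le.1 hω).le
        rw [← Real.sqrt_mul hn'.le] at h6
        exact (Real.sqrt_le_left (norm_nonneg _)).1 h6
    _ = ENNReal.ofReal (μ.real U) := by rw [ofReal_measureReal]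
    _ ≤ _ := ENNReal.ofReal_le_ofReal h3

end Probability

/-! ### Moments of the estimating function and regularity of the sample -/

section Moments
variable {𝒟 : Type*} [MeasurableSpace 𝒟] {p q : ℕ} {g : 𝒟 → Full p q → Full p q} {P : Measure 𝒟}
  {γ₀ : Par p}

theorem toEuclideanCLM_single {ι : Type*} [Fintype ι] [DecidableEq ι] (S : Matrix ι ι ℝ) (i j : ι) :
    Matrix.toEuclideanCLM (𝕜 := ℝ) S (EuclideanSpace.single j 1) i = S i j := by
  rw [Matrix.ofLp_toEuclideanCLM]
  simp

/-- A linear map that is small on the standard basis is small. -/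
theorem norm_apply_le_card_mul {ι F : Type*} [Fintype ι] [DecidableEq ι] [NormedAddCommGroup F]
    [NormedSpace ℝ F] (B : EuclideanSpace ℝ ι →ₗ[ℝ] F) {ε : ℝ}
    (h : ∀ j, ‖B (EuclideanSpace.single j 1)‖ ≤ ε) (l : EuclideanSpace ℝ ι) :
    ‖B l‖ ≤ Fintype.card ι * ε * ‖l‖ := by
  have e : l = ∑ j, l j • EuclideanSpace.single j (1 : ℝ) := by
    ext i
    simp [Finset.sum_apply, Pi.single_apply]
  calc ‖B l‖ = ‖∑ j, l j • B (EuclideanSpace.single j 1)‖ := by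
        conv_lhs => rw [e, map_sum]
        simp only [map_smul]
    _ ≤ ∑ j : ι, ‖l‖ * ε := by
        refine norm_sum_le_of_le _ fun j _ => ?_
        rw [norm_smul]
        gcongr
        · exact PiLp.norm_apply_le l j
        · exact h j
    _ = _ := by simp; ring

/-- The padding of a parameter by zeros as a linear map. -/
def padLinear (p q : ℕ) : Par p →ₗ[ℝ] Full p q where
  toFun := pad
  map_add' γ γ' := by ext i; cases i <;> simp
  map_smul' a γ := by ext i; cases i <;> simp

theorem coord_integral {ι : Type*} [Fintype ι] {f : 𝒟 → EuclideanSpace ℝ ι} (hf : Integrable f P)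
    (i : ι) : (∫ d, f d ∂P) i = ∫ d, f d i ∂P :=
  ((EuclideanSpace.proj i : EuclideanSpace ℝ ι →L[ℝ] ℝ).integral_comp_comm hf).symm

theorem Efficiency.sigma12_eq (h : Efficiency g P γ₀) (i : Fin p ⊕ Fin q) (k : Fin p) :
    sigma12 g P γ₀ i k = -sigma11 g P γ₀ i (Sum.inl k) := by
  cases i with
  | inl j => exact h.1 j k
  | inr j => exact h.2 j k

/-- Under the efficiency condition, `Σ₂₁ Σ₁₁⁻¹ Σ₁₂` is the leading block `E[g₁ g₁ᵀ]` of `Σ₁₁`. -/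
theorem Efficiency.transpose_mul_inv_mul (h : Efficiency g P γ₀)
    (hS : (sigma11 g P γ₀).PosDef) :
    (sigma12 g P γ₀).transpose * (sigma11 g P γ₀)⁻¹ * sigma12 g P γ₀ =
      (sigma11 g P γ₀).toBlocks₁₁ := by
  set S := sigma11 g P γ₀
  have h12 : sigma12 g P γ₀ = -(S.submatrix id Sum.inl) := by
    ext i k
    simpa using h.sigma12_eq i k
  have hT : S.transpose = S := by simpa [Matrix.IsHermitian] using hS.isHermitian
  have h21 : (S.submatrix id Sum.inl).transpose = S.submatrix (Sum.inl : Fin p → Fin p ⊕ Fin q) id := by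
    rw [Matrix.transpose_submatrix, hT]
  have hinv : S * S⁻¹ = 1 := Matrix.mul_nonsing_inv _ (isUnit_iff_ne_zero.2 hS.det_pos.ne')
  rw [h12, Matrix.transpose_neg, h21, Matrix.neg_mul, Matrix.neg_mul, Matrix.mul_neg, neg_neg]
  have e1 : S.submatrix (Sum.inl : Fin p → Fin p ⊕ Fin q) id * S⁻¹ =
      (S * S⁻¹).submatrix Sum.inl id := rfl
  rw [e1, hinv]
  have e2 : (1 : Matrix (Fin p ⊕ Fin q) (Fin p ⊕ Fin q) ℝ).submatrix Sum.inl id *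
      S.submatrix id Sum.inl = (1 * S).submatrix (Sum.inl : Fin p → Fin p ⊕ Fin q) Sum.inl := rfl
  rw [e2, Matrix.one_mul]
  rfl

theorem Regularity.exists_regularAt (h : Regularity g P γ₀) :
    ∃ r₀ > 0, ∃ K : 𝒟 → ℝ, Integrable K P ∧ (∀ d, 0 ≤ K d) ∧
      ∀ᵐ d ∂P, RegularAt g γ₀ r₀ (K d) d := by
  obtain ⟨r₀, hr₀, K, hK, hreg⟩ := h.smooth
  refine ⟨r₀, hr₀, fun d => |K d|, hK.abs, fun d => abs_nonneg _, ?_⟩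
  filter_upwards [hreg] with d hd
  refine ⟨hd.1, fun γ hγ => ?_⟩
  obtain ⟨h1, h2, h3⟩ := hd.2 γ hγ
  have := le_abs_self (K d)
  exact ⟨h1.trans this, h2.trans this, h3.trans this⟩

theorem Regularity.integrable_sq [IsProbabilityMeasure P] (h : Regularity g P γ₀) :
    Integrable (fun d => ‖gM g d γ₀‖ ^ 2) P := by
  obtain ⟨r₀, hr₀, K, hK, -, hreg⟩ := h.exists_regularAt
  have hm := h.measurable γ₀
  refine ((integrable_const (1 : ℝ)).add hK).mono' (by fun_prop) ?_
  filter_upwards [hreg] with d hd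
  have h3 := (hd.bound γ₀ (Metric.mem_ball_self hr₀)).2.2
  rw [Real.norm_of_nonneg (by positivity)]
  have h0 := norm_nonneg (gM g d γ₀)
  simp only [Pi.add_apply]
  rcases le_total ‖gM g d γ₀‖ 1 with h1 | h1
  · have := hd.nonneg hr₀
    nlinarith
  · have : ‖gM g d γ₀‖ ^ 2 ≤ ‖gM g d γ₀‖ ^ 3 := pow_le_pow_right₀ h1 (by norm_num)
    linarith

theorem Regularity.integrable_smul [IsProbabilityMeasure P] (h : Regularity g P γ₀)
    (j : Fin p ⊕ Fin q) : Integrable (fun d => gM g d γ₀ j • gM g d γ₀) P := by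
  have hm := h.measurable γ₀
  refine h.integrable_sq.mono' (by fun_prop) (Eventually.of_forall fun d => ?_)
  rw [norm_smul, pow_two]
  gcongr
  exact PiLp.norm_apply_le _ j

theorem Regularity.integral_smul [IsProbabilityMeasure P] (h : Regularity g P γ₀)
    (j : Fin p ⊕ Fin q) : ∫ d, gM g d γ₀ j • gM g d γ₀ ∂P =
      Matrix.toEuclideanCLM (𝕜 := ℝ) (sigma11 g P γ₀) (EuclideanSpace.single j 1) := by
  ext i
  rw [coord_integral (h.integrable_smul j), toEuclideanCLM_single]
  simp [sigma11, mul_comm]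

theorem Regularity.integrable_fderiv (h : Regularity g P γ₀) (t : Par p) :
    Integrable (fun d => fderiv ℝ (gM g d) γ₀ t) P := by
  obtain ⟨r₀, hr₀, K, hK, -, hreg⟩ := h.exists_regularAt
  have hmem := Metric.mem_ball_self (x := γ₀) hr₀
  have hmeas : AEStronglyMeasurable (fun d => fderiv ℝ (gM g d) γ₀ t) P := by
    -- the directional derivative is the limit of difference quotients, which are measurable
    refine aestronglyMeasurable_of_tendsto_ae atTop
      (f := fun (n : ℕ) d => (n : ℝ) • (gM g d (γ₀ + (n : ℝ)⁻¹ • t) - gM g d γ₀)) (fun n => ?_) ?_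
    · have h1 := h.measurable (γ₀ + (n : ℝ)⁻¹ • t)
      have h2 := h.measurable γ₀
      exact ((h1.sub h2).const_smul (n : ℝ)).aestronglyMeasurable
    · filter_upwards [hreg] with d hd
      refine (hd.differentiableAt hmem).hasFDerivAt.lim t (c := fun n : ℕ => (n : ℝ)) ?_
      simpa using tendsto_natCast_atTop_atTop
  refine (hK.mul_const ‖t‖).mono' hmeas ?_
  filter_upwards [hreg] with d hd
  exact ((fderiv ℝ (gM g d) γ₀).le_opNorm t).trans (by gcongr; exact (hd.bound γ₀ hmem).1)

theorem Regularity.integral_fderiv (h : Regularity g P γ₀) (heff : Efficiency g P γ₀) (k : Fin p) :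
    ∫ d, fderiv ℝ (gM g d) γ₀ (EuclideanSpace.single k 1) ∂P =
      -Matrix.toEuclideanCLM (𝕜 := ℝ) (sigma11 g P γ₀) (pad (EuclideanSpace.single k 1)) := by
  have hpad : pad (q := q) (EuclideanSpace.single k (1 : ℝ)) =
      EuclideanSpace.single (Sum.inl k) (1 : ℝ) := by
    ext i
    cases i <;> simp
  ext i
  rw [coord_integral (h.integrable_fderiv _), hpad, PiLp.neg_apply, toEuclideanCLM_single,
    ← heff.sigma12_eq i k]
  simp [sigma12]

end Moments

section Sample
variable {Ω 𝒟 : Type*} [MeasurableSpace Ω] [MeasurableSpace 𝒟] {p q : ℕ}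
  {μ : Measure Ω} [IsProbabilityMeasure μ] {P : Measure 𝒟} [IsProbabilityMeasure P]
  {D : ℕ → Ω → 𝒟} (hDmeas : ∀ i, Measurable (D i)) (hDindep : iIndepFun D μ)
  (hDlaw : ∀ i, μ.map (D i) = P)
  {g : 𝒟 → Full p q → Full p q} {γ₀ : Par p} (hreg : Regularity g P γ₀)

include hDmeas hDindep hDlaw hreg

/-- The sample second moments at the true parameter converge, uniformly over directions. -/
theorem withHighProb_second_moment {ε : ℝ} (hε : 0 < ε) :
    WithHighProb μ fun n ω => ∀ l w, |∑ i ∈ Finset.range n,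
      (inner ℝ l (gM g (D i ω) γ₀) * inner ℝ w (gM g (D i ω) γ₀) : ℝ) -
        n * inner ℝ (Matrix.toEuclideanCLM (𝕜 := ℝ) (sigma11 g P γ₀) l) w| ≤
          n * ε * (‖l‖ * ‖w‖) := by
  set A := Matrix.toEuclideanCLM (𝕜 := ℝ) (sigma11 g P γ₀) with hA
  set ε' := ε / (Fintype.card (Fin p ⊕ Fin q) + 1) with hε'
  have hε'0 : 0 < ε' := by positivity
  refine (WithHighProb.forall fun j => withHighProb_sum_sub_le hDmeas hDindep hDlaw
    (hreg.integrable_smul j) hε'0).mono (Eventually.of_forall fun n ω hω l w => ?_)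
  set v := fun i => gM g (D i ω) γ₀
  let B : Full p q →L[ℝ] Full p q :=
    ∑ i ∈ Finset.range n, (innerSL ℝ (v i)).smulRight (v i) - (n : ℝ) • A
  have hB : ∀ l, B l = ∑ i ∈ Finset.range n, (inner ℝ (v i) l : ℝ) • v i - (n : ℝ) • A l := by
    intro l
    simp [B]
  have h1 := norm_apply_le_card_mul (B : Full p q →ₗ[ℝ] Full p q) (ε := n * ε') (fun j => by
    have := hω j
    rw [hreg.integral_smul j] at this
    refine le_trans (le_of_eq ?_) this
    congr 1
    refine (hB _).trans ?_
    simp [v, EuclideanSpace.inner_single_right, A]) l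
  have e : ∑ i ∈ Finset.range n, (inner ℝ l (v i) * inner ℝ w (v i) : ℝ) - n * inner ℝ (A l) w =
      inner ℝ (B l) w := by
    rw [hB, inner_sub_left, sum_inner, inner_smul_left]
    simp only [inner_smul_left, conj_trivial]
    congr 1
    refine Finset.sum_congr rfl fun i _ => ?_
    rw [real_inner_comm l, real_inner_comm w]
  rw [e]
  calc _ ≤ ‖B l‖ * ‖w‖ := abs_real_inner_le_norm _ _
    _ ≤ Fintype.card (Fin p ⊕ Fin q) * (n * ε') * ‖l‖ * ‖w‖ := by gcongr; exact h1
    _ = n * (Fintype.card (Fin p ⊕ Fin q) * ε') * (‖l‖ * ‖w‖) := by ring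
    _ ≤ n * ((Fintype.card (Fin p ⊕ Fin q) + 1) * ε') * (‖l‖ * ‖w‖) := by gcongr; linarith
    _ = _ := by rw [hε']; field_simp

omit [IsProbabilityMeasure P] in
/-- By the efficiency condition, the sample Jacobian at the true parameter converges to
`-Σ₁₁ ∘ pad`. -/
theorem withHighProb_jacobian (heff : Efficiency g P γ₀) {ε : ℝ} (hε : 0 < ε) :
    WithHighProb μ fun n ω => ∀ t, ‖∑ i ∈ Finset.range n, fderiv ℝ (gM g (D i ω)) γ₀ t +
      (n : ℝ) • Matrix.toEuclideanCLM (𝕜 := ℝ) (sigma11 g P γ₀) (pad t)‖ ≤ n * (ε * ‖t‖) := by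
  set A := Matrix.toEuclideanCLM (𝕜 := ℝ) (sigma11 g P γ₀) with hA
  set ε' := ε / (Fintype.card (Fin p) + 1) with hε'
  have hε'0 : 0 < ε' := by positivity
  refine (WithHighProb.forall fun k : Fin p => withHighProb_sum_sub_le hDmeas hDindep hDlaw
    (hreg.integrable_fderiv (EuclideanSpace.single k 1)) hε'0).mono
    (Eventually.of_forall fun n ω hω t => ?_)
  let B : Par p →ₗ[ℝ] Full p q :=
    ∑ i ∈ Finset.range n, (fderiv ℝ (gM g (D i ω)) γ₀ : Par p →ₗ[ℝ] Full p q) +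
      (n : ℝ) • ((A : Full p q →ₗ[ℝ] Full p q) ∘ₗ padLinear p q)
  have hB : ∀ t, B t = ∑ i ∈ Finset.range n, fderiv ℝ (gM g (D i ω)) γ₀ t +
      (n : ℝ) • A (pad t) := by
    intro t
    simp [B, LinearMap.sum_apply, padLinear]
  have h1 := norm_apply_le_card_mul B (ε := n * ε') (fun k => by
    have := hω k
    rw [hreg.integral_fderiv heff k, smul_neg, sub_neg_eq_add] at this
    rw [hB]
    exact this) t
  rw [hB] at h1
  refine h1.trans ?_
  calc _ = n * ((Fintype.card (Fin p) * ε') * ‖t‖) := by ring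
    _ ≤ n * (((Fintype.card (Fin p) + 1) * ε') * ‖t‖) := by gcongr; linarith
    _ = _ := by rw [hε']; field_simp

/-- The sample satisfies the conditions of the deterministic approximation with probability close
to one. -/
theorem exists_measure_not_goodSample_le (heff : Efficiency g P γ₀) {γhat : ℕ → Ω → Par p}
    (hroot : Tendsto (fun n => μ {ω | ¬ ∀ j : Fin p,
      ∑ i ∈ Finset.range n, gM g (D i ω) (γhat n ω) (Sum.inl j) = 0}) atTop (𝓝 0))
    (hcons : TendstoInMeasure μ γhat atTop (fun _ => γ₀)) {r : ℕ → ℝ}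
    (hr_pos : ∀ᶠ n in atTop, 0 ≤ r n)
    (hr_small : Tendsto (fun n : ℕ => (n : ℝ) ^ (1 / 3 : ℝ) * r n) atTop (𝓝 0))
    {ζ : ℝ} (hζ : 0 < ζ) :
    ∃ M : ℝ, ∀ κ > 0, ∀ᶠ n in atTop, μ {ω | ¬ GoodSample g
      (Matrix.toEuclideanCLM (𝕜 := ℝ) (sigma11 g P γ₀)) n (fun i => D i ω) (γhat n ω) (r n) κ M}
        ≤ ENNReal.ofReal ζ := by
  obtain ⟨a, ha, hA⟩ := exists_coercive hreg.posDef
  set A := Matrix.toEuclideanCLM (𝕜 := ℝ) (sigma11 g P γ₀) with hAdef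
  obtain ⟨r₀, hr₀, K, hK, hK0, hKreg⟩ := hreg.exists_regularAt
  obtain ⟨M₁, hM₁, h₁⟩ := exists_measure_sum_gt_le (μ := μ) hDmeas hDlaw hK hK0
    (ζ := ζ / 3) (by positivity)
  obtain ⟨M₂, hM₂, h₂⟩ := exists_measure_norm_sum_gt_le (μ := μ) hDmeas hDindep hDlaw
    (hreg.measurable γ₀) hreg.integrable_sq hreg.mean_zero (ζ := ζ / 3) (by positivity)
  refine ⟨(1 + (‖A‖ + 1) * (2 / a)) * M₂, fun κ' hκ' => ?_⟩
  set κ := min κ' (min 1 (a / 2)) with hκdef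
  have hκ : 0 < κ := lt_min hκ' (lt_min one_pos (by positivity))
  obtain ⟨τ, ⟨⟨hτr, hτ1⟩, hτ2⟩, hτ⟩ : ∃ τ : ℝ, ((τ < r₀ ∧ M₁ * τ < κ / 2) ∧
      √(8 * τ) * M₁ < κ / 2) ∧ 0 < τ := by
    have e1 : ∀ᶠ τ in 𝓝[>] (0 : ℝ), τ < r₀ := nhdsWithin_le_nhds (Iio_mem_nhds hr₀)
    have e2 : ∀ᶠ τ in 𝓝[>] (0 : ℝ), M₁ * τ < κ / 2 := nhdsWithin_le_nhds
      (ContinuousAt.eventually_lt (by fun_prop) continuousAt_const (by simpa using hκ))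
    have e3 : ∀ᶠ τ in 𝓝[>] (0 : ℝ), √(8 * τ) * M₁ < κ / 2 := nhdsWithin_le_nhds
      (ContinuousAt.eventually_lt (by fun_prop) continuousAt_const (by simpa using hκ))
    exact (((e1.and e2).and e3).and self_mem_nhdsWithin).exists
  have hwhp := ((((withHighProb_second_moment hDmeas hDindep hDlaw hreg (half_pos hκ)).and
    (withHighProb_jacobian hDmeas hDindep hDlaw hreg heff (half_pos hκ))).and
    (withHighProb_forall_le (μ := μ) hDmeas hDlaw hK)).and
    ((withHighProb_of_tendstoInMeasure hcons (half_pos hτ)).and (show WithHighProb μ _ from hroot))).and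
    (withHighProb_of_ae (s := fun _ ω => ∀ i, RegularAt g γ₀ r₀ (K (D i ω)) (D i ω))
      ((ae_forall_sample hDmeas hDlaw hKreg).mono fun ω hω _ => hω))
  have hr0 : ∀ᶠ n in atTop, r n ≤ τ / 2 := by
    filter_upwards [hr_small.eventually_le_const (half_pos hτ), hr_pos, eventually_gt_atTop 0]
      with n h1 h2 h3
    have h4 : (1 : ℝ) ≤ (n : ℝ) ^ (1 / 3 : ℝ) :=
      Real.one_le_rpow (by exact_mod_cast h3) (by norm_num)
    nlinarith
  filter_upwards [hr0, hr_small.eventually_le_const hκ, hr_pos, eventually_gt_atTop 0,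
    hwhp.eventually_le_const (ENNReal.ofReal_pos.2 (by positivity : 0 < ζ / 3))]
    with n hrτ hrκ hrn hn hmain
  have hle := h₁ n hn
  have hle2 := h₂ n hn
  refine (measure_mono (t := {ω | ¬ ∑ i ∈ Finset.range n, K (D i ω) ≤ n * M₁} ∪
    ({ω | ¬ ‖∑ i ∈ Finset.range n, gM g (D i ω) γ₀‖ ≤ √n * M₂} ∪ _)) ?_).trans
    ((measure_union_le _ _).trans ((add_le_add hle ((measure_union_le _ _).trans
      (add_le_add hle2 hmain))).trans (le_of_eq ?_)))
  · intro ω hω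
    by_contra hcon
    simp only [Set.mem_union, not_or, Set.mem_ofPred_eq, not_not] at hcon
    obtain ⟨hs1, hs2, ⟨⟨⟨hs3, hs4⟩, hs5⟩, hs6, hs7⟩, hs8⟩ := hcon
    refine hω ((goodSample_of_regularAt ha hA ((min_le_right _ _).trans (min_le_left _ _))
      ((min_le_right _ _).trans (min_le_right _ _)) hn hrn (fun i _ => hs8 i) hτr hτ1.le hτ2.le hs6
      hrτ hrκ hs1 hs5 hs3 hs4 hs2 hs7).mono (min_le_left _ _))
  · rw [← ENNReal.ofReal_add (by positivity) (by positivity),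
      ← ENNReal.ofReal_add (by positivity) (by positivity)]
    congr 1; ring

end Sample

/-! ### The expansion of the marginal likelihood -/

section Expansion
variable {Ω 𝒟 : Type*} [MeasurableSpace Ω] [MeasurableSpace 𝒟] {p q : ℕ}
  {μ : Measure Ω} {P : Measure 𝒟} {D : ℕ → Ω → 𝒟} {g : 𝒟 → Full p q → Full p q} {γ₀ : Par p}
  {γhat : ℕ → Ω → Par p} {ρ : ℕ → Measure (Full p q)}

/-- The leading term of the Laplace approximation at the plug-in estimator `c`. -/
noncomputable def plugInTerm (g : 𝒟 → Full p q → Full p q)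
    (S : Matrix (Fin p ⊕ Fin q) (Fin p ⊕ Fin q) ℝ) (ρ : Measure (Full p q)) (n : ℕ) (x : ℕ → 𝒟)
    (c : Par p) : ℝ :=
  laplaceTerm S.toBlocks₁₁ S ρ n (elRatio g n x (multiplier g n x c) c)

theorem tendstoInMeasure_zero_of_withHighProb {f : ℕ → Ω → ℝ}
    (h : ∀ ε > 0, WithHighProb μ fun n ω => |f n ω| ≤ ε) :
    TendstoInMeasure μ f atTop (fun _ => 0) := by
  rw [tendstoInMeasure_iff_norm]
  intro ε hε
  refine tendsto_of_tendsto_of_tendsto_of_le_of_le tendsto_const_nhds (h (ε / 2) (by positivity))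
    (fun _ => zero_le) fun n => measure_mono fun ω hω => ?_
  simp only [Set.mem_ofPred_eq, sub_zero, Real.norm_eq_abs] at hω
  simp only [Set.mem_ofPred_eq, not_le]
  linarith

theorem LocalPrior.eventually_priorIntegral_pos [∀ n, IsProbabilityMeasure (ρ n)]
    {S : Matrix (Fin p ⊕ Fin q) (Fin p ⊕ Fin q) ℝ} (hS : S.PosDef) (hρ : LocalPrior S ρ) :
    ∀ᶠ n in atTop, 0 < priorIntegral S (ρ n) n := by
  obtain ⟨η, hη, C, hC⟩ := hρ
  obtain ⟨a, ha, hA⟩ := exists_coercive hS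
  filter_upwards [hC] with n hn
  exact one_pos.trans_le (one_le_priorIntegral hη ha.le
    (fun δ => by rw [quad_eq_inner]; exact hA δ) hn)

/-- The expansion on the logarithmic scale follows from two-sided bounds with relative errors
`exp (± ε)`. -/
theorem expansion_of_withHighProb [∀ n, IsProbabilityMeasure (ρ n)] (hreg : Regularity g P γ₀)
    (heff : Efficiency g P γ₀) (hρ : LocalPrior (sigma11 g P γ₀) ρ)
    {T : ℕ → Ω → Set (Par p × Full p q)}
    (h : ∀ ε > 0, WithHighProb μ fun n ω =>
      0 < elRatio g n (fun i => D i ω) (multiplier g n (fun i => D i ω) (γhat n ω)) (γhat n ω) ∧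
      ENNReal.ofReal (plugInTerm g (sigma11 g P γ₀) (ρ n) n (fun i => D i ω) (γhat n ω) *
        Real.exp (-ε)) ≤ marginal g (ρ n) n (fun i => D i ω) (T n ω) ∧
      marginal g (ρ n) n (fun i => D i ω) (T n ω) ≤
        ENNReal.ofReal (plugInTerm g (sigma11 g P γ₀) (ρ n) n (fun i => D i ω) (γhat n ω) *
          Real.exp ε)) :
    Expansion μ P D g γ₀ γhat ρ T := by
  have hS := hreg.posDef
  have hJ : (sigma11 g P γ₀).toBlocks₁₁.PosDef := hS.submatrix (e := Sum.inl) Sum.inl_injective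
  refine tendstoInMeasure_zero_of_withHighProb fun ε hε => ?_
  refine (h (ε / 2) (by positivity)).mono ?_
  filter_upwards [hρ.eventually_priorIntegral_pos hS, eventually_gt_atTop 0] with n hA hn ω hω
  obtain ⟨hR, h1, h2⟩ := hω
  have hn' : (0 : ℝ) < n := by exact_mod_cast hn
  have hB : 0 < plugInTerm g (sigma11 g P γ₀) (ρ n) n (fun i => D i ω) (γhat n ω) := by
    have := Real.pi_pos
    have := Real.sqrt_pos.2 hJ.det_pos
    unfold plugInTerm laplaceTerm
    positivity
  have h3 := abs_log_toReal_sub_le hB h1 h2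
  rw [plugInTerm, log_laplaceTerm hJ hn hR hA] at h3
  rw [cTilde, heff.transpose_mul_inv_mul hS]
  linarith

end Expansion

end ELCIC

theorem theorem1 {Ω 𝒟 : Type*} [MeasurableSpace Ω] [MeasurableSpace 𝒟] {p q : ℕ} (hp : 0 < p)
    (μ : Measure Ω) [IsProbabilityMeasure μ] (P : Measure 𝒟) [IsProbabilityMeasure P]
    -- an i.i.d. sample with law `P`
    (D : ℕ → Ω → 𝒟) (hDmeas : ∀ i, Measurable (D i)) (hDindep : iIndepFun D μ)
    (hDlaw : ∀ i, μ.map (D i) = P)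
    -- the estimating functions and the true parameter
    (g : 𝒟 → ELCIC.Full p q → ELCIC.Full p q) (γ₀ : ELCIC.Par p)
    (hreg : ELCIC.Regularity g P γ₀) (heff : ELCIC.Efficiency g P γ₀)
    (hrank : (ELCIC.sigma12 g P γ₀).rank = p)
    -- the plug-in estimator: a consistent root of the estimating equations `g₁`
    (γhat : ℕ → Ω → ELCIC.Par p)
    (hroot : Tendsto (fun n => μ {ω | ¬ ∀ j : Fin p,
      ∑ i ∈ Finset.range n, ELCIC.gM g (D i ω) (γhat n ω) (Sum.inl j) = 0}) atTop (𝓝 0))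
    (hcons : TendstoInMeasure μ γhat atTop (fun _ => γ₀))
    -- the priors on the deviation of the multiplier
    (ρ : ℕ → Measure (ELCIC.Full p q)) [∀ n, IsProbabilityMeasure (ρ n)]
    (hρ : ELCIC.LocalPrior (ELCIC.sigma11 g P γ₀) ρ)
    -- the radii of the window of the Laplace approximation
    (r : ℕ → ℝ) (hr_large : Tendsto (fun n : ℕ => (n : ℝ) ^ (1 / 2 : ℝ) * r n) atTop atTop)
    (hr_small : Tendsto (fun n : ℕ => (n : ℝ) ^ (1 / 3 : ℝ) * r n) atTop (𝓝 0)) :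
    -- the marginal likelihood over the window
    ELCIC.Expansion μ P D g γ₀ γhat ρ (fun n ω => ELCIC.window (γhat n ω) (r n)) ∧
    -- the marginal likelihood over a parameter space `Θ`, when its part outside the window is
    -- negligible
    ∀ Θ ∈ 𝓝 γ₀,
      (∀ ε > (0 : ℝ), Tendsto (fun n => μ {ω |
        ENNReal.ofReal ε *
            ELCIC.marginal g (ρ n) n (fun i => D i ω) (ELCIC.window (γhat n ω) (r n)) <
          ELCIC.marginal g (ρ n) n (fun i => D i ω)
            ((Θ ×ˢ Set.univ) \ ELCIC.window (γhat n ω) (r n))}) atTop (𝓝 0)) →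
      ELCIC.Expansion μ P D g γ₀ γhat ρ (fun _ _ => Θ ×ˢ Set.univ) := by
  have hS := hreg.posDef
  have hr : Tendsto (fun n : ℕ => √(n : ℝ) * r n) atTop atTop := by
    simpa only [Real.sqrt_eq_rpow] using hr_large
  have hr_pos : ∀ᶠ n in atTop, 0 ≤ r n := by
    filter_upwards [hr.eventually_gt_atTop 0] with n hn
    by_contra hneg
    exact absurd hn (not_lt.2 (mul_nonpos_of_nonneg_of_nonpos (Real.sqrt_nonneg _)
      (not_le.1 hneg).le))
  -- the two-sided bound on the window, with a measurable majorant for the upper bound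
  have hwin : ∀ ε > 0, ELCIC.WithHighProb μ fun n ω =>
      0 < ELCIC.elRatio g n (fun i => D i ω)
        (ELCIC.multiplier g n (fun i => D i ω) (γhat n ω)) (γhat n ω) ∧
      ENNReal.ofReal (ELCIC.plugInTerm g (ELCIC.sigma11 g P γ₀) (ρ n) n (fun i => D i ω)
        (γhat n ω) * Real.exp (-ε)) ≤ ELCIC.marginal g (ρ n) n (fun i => D i ω)
          (ELCIC.window (γhat n ω) (r n)) ∧
      ∃ F : ELCIC.Par p → ENNReal, Measurable F ∧
        (∀ γ, ∫⁻ δ, (ELCIC.window (γhat n ω) (r n)).indicator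
          (fun z => ENNReal.ofReal (ELCIC.lik g n (fun i => D i ω) z.1 z.2)) (γ, δ) ∂(ρ n) ≤ F γ) ∧
        ∫⁻ γ, F γ ≤ ENNReal.ofReal (ELCIC.plugInTerm g (ELCIC.sigma11 g P γ₀) (ρ n) n
          (fun i => D i ω) (γhat n ω) * Real.exp ε) := by
    intro ε hε
    refine ENNReal.tendsto_nhds_zero.2 fun ζ hζ => ?_
    obtain ⟨z, hz, hzζ⟩ : ∃ z : ℝ, 0 < z ∧ ENNReal.ofReal z ≤ ζ := by
      rcases eq_or_ne ζ ⊤ with rfl | hζt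
      · exact ⟨1, one_pos, le_top⟩
      · exact ⟨ζ.toReal, ENNReal.toReal_pos hζ.ne' hζt, ENNReal.ofReal_toReal_le⟩
    obtain ⟨M, hM⟩ := ELCIC.exists_measure_not_goodSample_le hDmeas hDindep hDlaw hreg heff hroot
      hcons hr_pos hr_small hz
    obtain ⟨κ, hκ, hb⟩ := ELCIC.exists_marginal_bounds (g := g) hS hρ hr M hε
    filter_upwards [hM κ hκ, hb] with n h1 h2
    exact (h1.trans hzζ).trans' (measure_mono fun ω hω hgood => hω (h2 _ _ hgood))
  refine ⟨ELCIC.expansion_of_withHighProb hreg heff hρ fun ε hε => (hwin ε hε).mono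
    (Eventually.of_forall fun n ω hω => ?_), fun Θ hΘ htail =>
      ELCIC.expansion_of_withHighProb hreg heff hρ fun ε hε => ?_⟩
  · obtain ⟨hR, hlow, F, -, hF1, hF2⟩ := hω
    exact ⟨hR, hlow, (lintegral_mono hF1).trans hF2⟩
  · obtain ⟨s, hs, hball⟩ := Metric.mem_nhds_iff.1 hΘ
    -- the part outside the window costs a further factor `exp (ε / 2)`
    have hε2 : 0 < Real.exp (ε / 2) - 1 := by
      rw [sub_pos, Real.one_lt_exp_iff]; positivity
    have htail' : ELCIC.WithHighProb μ fun n ω =>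
        ELCIC.marginal g (ρ n) n (fun i => D i ω)
            ((Θ ×ˢ Set.univ) \ ELCIC.window (γhat n ω) (r n)) ≤
          ENNReal.ofReal (Real.exp (ε / 2) - 1) *
            ELCIC.marginal g (ρ n) n (fun i => D i ω) (ELCIC.window (γhat n ω) (r n)) := by
      simpa only [ELCIC.WithHighProb, not_le] using htail _ hε2
    have hrs : ∀ᶠ n in atTop, r n ≤ s / 4 := by
      filter_upwards [hr_small.eventually_le_const (by positivity : 0 < s / 4), hr_pos,
        eventually_gt_atTop 0] with n h1 h2 h3
      have h4 : (1 : ℝ) ≤ (n : ℝ) ^ (1 / 3 : ℝ) :=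
        Real.one_le_rpow (by exact_mod_cast h3) (by norm_num)
      nlinarith
    refine (((hwin (ε / 2) (by positivity)).and htail').and
      (ELCIC.withHighProb_of_tendstoInMeasure hcons (by positivity : 0 < s / 4))).mono ?_
    filter_upwards [hrs] with n hrn ω hω
    obtain ⟨⟨⟨hR, hlow, F, hF, hF1, hF2⟩, hdiff⟩, hc⟩ := hω
    set W := ELCIC.window (q := q) (γhat n ω) (r n)
    set B := ELCIC.plugInTerm g (ELCIC.sigma11 g P γ₀) (ρ n) n (fun i => D i ω) (γhat n ω)
    have hWΘ : W ⊆ Θ ×ˢ Set.univ := by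
      rintro ⟨γ, δ⟩ ⟨hγ, -⟩
      refine ⟨hball (mem_ball_iff_norm.2 ?_), trivial⟩
      calc ‖γ - γ₀‖ ≤ ‖γ - γhat n ω‖ + ‖γhat n ω - γ₀‖ := norm_sub_le_norm_sub_add_norm_sub _ _ _
        _ < s := by
          have : ‖γ - γhat n ω‖ ≤ r n := hγ
          linarith
    have hup : ELCIC.marginal g (ρ n) n (fun i => D i ω) W ≤
        ENNReal.ofReal (B * Real.exp (ε / 2)) := (lintegral_mono hF1).trans hF2
    have hB : 0 ≤ B := ELCIC.laplaceTerm_nonneg hR.le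
    refine ⟨hR, ?_, ?_⟩
    · refine le_trans (ENNReal.ofReal_le_ofReal ?_) (hlow.trans
        (ELCIC.marginal_mono (ρ n) n _ hWΘ))
      gcongr
      linarith
    · calc _ ≤ (∫⁻ γ, F γ) + ELCIC.marginal g (ρ n) n (fun i => D i ω) ((Θ ×ˢ Set.univ) \ W) :=
            ELCIC.marginal_le_add_diff hF hF1 _
        _ ≤ ENNReal.ofReal (B * Real.exp (ε / 2)) + ENNReal.ofReal (Real.exp (ε / 2) - 1) *
              ENNReal.ofReal (B * Real.exp (ε / 2)) :=
            add_le_add hF2 (hdiff.trans (mul_le_mul' le_rfl hup))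
        _ = ENNReal.ofReal (B * Real.exp ε) := by
            rw [← ENNReal.ofReal_mul hε2.le, ← ENNReal.ofReal_add (by positivity) (by positivity)]
            congr 1
            rw [show ε = ε / 2 + ε / 2 by ring, Real.exp_add]
            ring_nf
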